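/- **Setting.** Let $q$ be a fixed odd prime power, $Q=\log_2 q$, and let $h(x)=-x\log_2x-(1-x)\log_2(1-x)$, $g(x,y)=-x\log_2x-y\log_2y-(1-x-y)\log_2(1-x-y)$ (with $0\log_2 0=0$, and $0\cdot h(\cdot)=0\cdot g(\cdot,\cdot)=0$). Let $k,\ell,v,\varepsilon_1,\varepsilon_2$ be functions of $n$ with values in $\mathbb N$ such that $k/n\to R$, $\ell/n\to L$, $v/n\to V$, $\varepsilon_i/n\to E_i$, and put $N=k+\ell$. The smaller instance of the restricted syndrome decoding problem for $z=2$ at full weight consists of $A\in\mathbb F_q^{N\times\ell}$ and $s\in\mathbb F_q^{\ell}$; wanted are the $e\in\{\pm1\}^N$ with $eA=s$ and with exactly $v$ entries $1$. Put $$v_0=v,\quad m_0=0,\quad v_i=\tfrac{v_{i-1}}2+\varepsilon_i,\quad m_i=\tfrac{m_{i-1}}2+\varepsilon_i\qquad(i=1,2).$$ Let $D_i$ be the set of vectors in $\{0,\pm1\}^N\subset\mathbb Z^N$ with $v_i$ entries $1$ and $m_i$ entries $-1$. For $i=0,1$ let $r_i$ be the number of representations $x=x_1+x_2$ over $\mathbb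 Z$, with $x_1,x_2\in D_{i+1}$, of a vector $x\in D_i$, and let $u_i=\lfloor\log_q r_i\rfloor$. For all $n$ it is assumed that $N$ is even, $8\mid v$, $4\mid\varepsilon_1$, $2\mid\varepsilon_2$ (so that all halvings are exact), that $v_i+m_i+2\varepsilon_{i+1}\le N$ for $i=0,1$, and that $u_1\le u_0\le\ell$. **The shifted BCJ(2) algorithm.** On input $(A,s)$, compute $\tilde s=(s+(1,\dots,1)A)/2$, the syndrome of the shifted vector $\tilde e=(e+(1,\dots,1))/2\in\{0,1\}^N$. 1. Build four base lists by concatenation merges: enumerate all vectors in $\{0,\pm1\}^{N/2}$ with $v_2/2$ entries $1$ and $m_2/2$ entries $-1$, and combine two such halves $x',x''$ into $x=(x',x'')$ whenever $xA$ agrees with the target $t$ on the first $u_1$ positions; here $t=0$ for the first three lists and $t=\tilde s$ for the fourth. 2. Merge lists 1 and 2 with target $t=0$, and lists 3 and 4 with target $t=\tilde s$: form all sums $x_1+x_2$ whose syndrome agrees with $t$ on the first $u_0$ positions, and then keep those that lie in $D_1$. 3. Merge the two resulting lists in the same way, with target $\tilde s$ on all $\ell$ positions, keep the sums $\tilde e$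 that lie in $D_0$, and output the vectors $2\tilde e-(1,\dots,1)$. Duplicates are not removed. Each merge stores the second list in a table indexed by syndromes, looks up each element of the first list, and forms one sum for every collision. All steps are counted: a syndrome costs $N\ell$ steps, a table access $\ell+1$, a vector addition, a concatenation, the filtering of one vector and the output of one vector $N+1$ each, and the recursive enumeration one step per node and per written entry. **Statement.** Put $V_0=V$, $M_0=0$ and, for $i=1,2$, $$V_i=\tfrac{V_{i-1}}2+E_i,\qquad M_i=\tfrac{M_{i-1}}2+E_i,$$ $$\Sigma_i=(R+L)\,g\!\left(\tfrac{V_i}{R+L},\tfrac{M_i}{R+L}\right)\quad(i=0,1,2),$$ $$U_i=M_i+V_i+(R+L-V_i-M_i)\,h\!\left(\tfrac{2E_{i+1}}{R+L-V_i-M_i}\right)+2E_{i+1}\quad(i=0,1).$$ Then, as $n\to\infty$: * for $i=0,1,2$: $v_i/n\to V_i$, $m_i/n\to M_i$ and $\frac1n\log_2|D_i|\to\Sigma_i$; * for $i=0,1$: for every choice of $x^{(n)}\in D_i$, the number of representations of $x^{(n)}$ is $2^{(U_i+o(1))n}$; moreover $Q\,u_i/n\to U_i$; * every vector output by the algorithm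 on any input $(A,s)$ is a wanted solution; * for every $\delta>0$ and all sufficiently large $n$: for every $e\in\{\pm1\}^N$ with exactly $v/2$ entries $1$ in each of its two halves, the algorithm on input $(A,eA)$ outputs $e$ with probability at least $2^{-\delta n}$ over a uniformly random $A\in\mathbb F_q^{N\times\ell}$; * for every sequence of vectors $e=e^{(n)}\in\{\pm1\}^N$, the expected number of steps of the algorithm on input $(A,eA)$, for a uniformly random $A\in\mathbb F_q^{N\times\ell}$, is $2^{(C+o(1))n}$ with $$C=\max\left\{\tfrac{\Sigma_2}2,\ \Sigma_2-U_1,\ 2\Sigma_2-U_1-U_0,\ 2\Sigma_1-U_0-QL\right\}.$$ -/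

import Mathlib

open Filter Topology

/-! ### Step counting -/

/-- The outcome of a computation, together with the number of elementary steps it took. -/
structure Counted (α : Type) where
  val : α
  steps : ℕ

instance : Monad Counted where
  pure a := ⟨a, 0⟩
  bind x f := ⟨(f x.val).val, x.steps + (f x.val).steps⟩

namespace Counted

/-- Spend `c` elementary steps. -/
def tick (c : ℕ) : Counted Unit := ⟨(), c⟩

/-- Run `f` on every entry of a list, in order, and collect the results. -/
def forEach {α β : Type} (f : α → Counted β) : List α → Counted (List β)
  | [] => pure []
  | a :: l => do
      let b ← f a
      let bs ← forEach f l
      pure (b :: bs)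

end Counted

namespace ShiftedBCJ

open Counted

/-! ### Signed ternary vectors and representations -/

/-- `x` has entries in `{0, 1, -1}`, exactly `v` entries `1` and exactly `m` entries `-1`. -/
def WellFormed {N : ℕ} (v m : ℕ) (x : Fin N → ℤ) : Prop :=
  (∀ j, x j = 0 ∨ x j = 1 ∨ x j = -1) ∧
    (Finset.univ.filter fun j => x j = 1).card = v ∧
    (Finset.univ.filter fun j => x j = -1).card = m

instance {N : ℕ} (v m : ℕ) (x : Fin N → ℤ) : Decidable (WellFormed v m x) := by
  unfold WellFormed; infer_instance

/-- The search space: all well-formed vectors of length `N`. -/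
def searchSpace (N v m : ℕ) : Finset (Fin N → ℤ) :=
  (Fintype.piFinset fun _ => ({0, 1, -1} : Finset ℤ)).filter (WellFormed v m)

/-- The representations `x = x₁ + x₂` with `x₁`, `x₂` both having `v'` entries `1` and `m'`
entries `-1`; such a representation is determined by `x₁`. -/
def representations {N : ℕ} (v' m' : ℕ) (x : Fin N → ℤ) : Finset (Fin N → ℤ) :=
  (searchSpace N v' m').filter fun x₁ => WellFormed v' m' (x - x₁)

/-- The number of representations of a vector with `v` entries `1` and `m` entries `-1`.
(It is the same for all such vectors, so the maximum is the common value.) -/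
def numReps (N v m v' m' : ℕ) : ℕ :=
  (searchSpace N v m).sup fun x => (representations v' m' x).card

/-- Number of entries `1` on level `i`: `v_i = v_{i-1} / 2 + ε_i`. -/
def ones (v : ℕ) (ε : ℕ → ℕ) : ℕ → ℕ
  | 0 => v
  | i + 1 => ones v ε i / 2 + ε (i + 1)

/-- Number of entries `-1` on level `i`: `m_0 = 0` and `m_i = m_{i-1} / 2 + ε_i`. -/
def negs (ε : ℕ → ℕ) : ℕ → ℕ
  | 0 => 0
  | i + 1 => negs ε i / 2 + ε (i + 1)

/-- Number of representations `r_i` of a level-`i` vector as a sum of two level-`(i+1)` vectors. -/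
def levelReps (N v : ℕ) (ε : ℕ → ℕ) (i : ℕ) : ℕ :=
  numReps N (ones v ε i) (negs ε i) (ones v ε (i + 1)) (negs ε (i + 1))

/-- Number of positions `u_i = ⌊log_q r_i⌋` on which the lists of level `i` are merged. -/
def mergeLength (q N v : ℕ) (ε : ℕ → ℕ) (i : ℕ) : ℕ := Nat.log q (levelReps N v ε i)

/-! ### The algorithm

The smaller instance consists of a matrix `A` with `h + h = k + ℓ` rows and `ℓ` columns and of a
syndrome `s`. -/

/-- Enumerate all vectors in `{0, 1, -1}^N` with `v` entries `1` and `m` entries `-1`. One step is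
charged per visited node and one per entry that is written. -/
def enumerate : (N v m : ℕ) → Counted (List (Fin N → ℤ))
  | 0, v, m => do
      tick 1
      pure (if v = 0 ∧ m = 0 then [Fin.elim0] else [])
  | N + 1, v, m => do
      tick 1
      if N + 1 < v + m then pure [] else
      let prepend (a : ℤ) (l : List (Fin N → ℤ)) : Counted (List (Fin (N + 1) → ℤ)) :=
        forEach (fun x => do tick 1; pure (Fin.cons a x)) l
      let zeros ← (do prepend 0 (← enumerate N v m))
      let plus ← (if v = 0 then pure [] else do prepend 1 (← enumerate N (v - 1) m))
      let minus ← (if m = 0 then pure [] else do prepend (-1) (← enumerate N v (m - 1)))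
      pure (zeros ++ plus ++ minus)

section
variable {F : Type} [Field F] [DecidableEq F] {N ℓ : ℕ}

/-- `x A`, the syndrome of the integer vector `x`; `N * ℓ` multiply-and-add steps. -/
def syndrome (A : Matrix (Fin N) (Fin ℓ) F) (x : Fin N → ℤ) : Counted (Fin ℓ → F) := do
  tick (N * ℓ)
  pure (Matrix.vecMul (fun j => (x j : F)) A)

/-- Keep the first `u` positions only. -/
def firstPositions (u : ℕ) (t : Fin ℓ → F) : Fin ℓ → F := fun j => if (j : ℕ) < u then t j else 0

/-- Store the entries of a list in a table indexed by their keys; besides the computation of the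
key, `ℓ + 1` steps for each insertion. -/
def buildTable {β : Type} (key : β → Counted (Fin ℓ → F)) :
    List β → Counted ((Fin ℓ → F) → List β)
  | [] => pure fun _ => []
  | b :: l => do
      let tab ← buildTable key l
      let κ ← key b
      tick (ℓ + 1)
      pure (Function.update tab κ (b :: tab κ))

/-- Combine all pairs from `L₁ × L₂` with equal keys: the second list is stored in a table, and
each entry of the first list is looked up, at `ℓ + 1` steps for each look-up. The steps of each
collision are those of `combine`. -/
def merge {α β γ : Type} (key₁ : α → Counted (Fin ℓ → F)) (key₂ : β → Counted (Fin ℓ → F))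
    (combine : α → β → Counted γ) (L₁ : List α) (L₂ : List β) : Counted (List γ) := do
  let tab ← buildTable key₂ L₂
  let rows ← forEach (fun a => do
    let κ ← key₁ a
    tick (ℓ + 1)
    forEach (combine a) (tab κ)) L₁
  pure rows.flatten

/-- Representation merge: collect the sums `x + y` whose syndrome agrees with `t` on the first `u`
positions, then filter out those that do not have `v` entries `1` and `m` entries `-1`. -/
def representationMerge (A : Matrix (Fin N) (Fin ℓ) F) (u : ℕ) (t : Fin ℓ → F) (v m : ℕ)
    (L₁ L₂ : List (Fin N → ℤ)) : Counted (List (Fin N → ℤ)) := do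
  let sums ← merge
    (fun x => do let σ ← syndrome A x; pure (firstPositions u σ))
    (fun y => do let σ ← syndrome A y; pure (firstPositions u (t - σ)))
    (fun x y => do tick (N + 1); pure (x + y)) L₁ L₂
  let _ ← forEach (fun _ => tick (N + 1)) sums
  pure (sums.filter fun x => decide (WellFormed v m x))

/-- Concatenation merge: all vectors `(x, y)` whose two halves have `v / 2` entries `1` and `m / 2`
entries `-1` each, and whose syndrome agrees with `t` on the first `u` positions. -/
def baseList {h : ℕ} (A : Matrix (Fin (h + h)) (Fin ℓ) F) (u : ℕ) (t : Fin ℓ → F) (v m : ℕ) :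
    Counted (List (Fin (h + h) → ℤ)) := do
  let X ← enumerate h (v / 2) (m / 2)
  let Y ← enumerate h (v / 2) (m / 2)
  merge
    (fun x => do let σ ← syndrome A (Fin.append x 0); pure (firstPositions u σ))
    (fun y => do let σ ← syndrome A (Fin.append 0 y); pure (firstPositions u (t - σ)))
    (fun x y => do tick (h + h + 1); pure (Fin.append x y)) X Y

/-- The shifted BCJ(2) algorithm: a concatenation merge followed by two representation merges, for
the vectors `e ∈ {1, -1}^(k + ℓ)` with `e A = s` and with `v` entries `1`. It looks for
`(e + (1, …, 1)) / 2 ∈ {0, 1}^(k + ℓ)`, whose syndrome is `(s + (1, …, 1) A) / 2`.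
Of the four base lists, the first three (target `0`) coincide and are computed once. -/
def shiftedBCJ2 [Fintype F] {h : ℕ} (v : ℕ) (ε : ℕ → ℕ)
    (A : Matrix (Fin (h + h)) (Fin ℓ) F) (s : Fin ℓ → F) :
    Counted (List (Fin (h + h) → ℤ)) := do
  let u := mergeLength (Fintype.card F) (h + h) v ε
  let σ ← syndrome A 1
  tick (2 * ℓ)
  let t : Fin ℓ → F := fun j => (s j + σ j) / 2
  let B₀ ← baseList A (u 1) 0 (ones v ε 2) (negs ε 2)
  let B₁ ← baseList A (u 1) t (ones v ε 2) (negs ε 2)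
  let Y₀ ← representationMerge A (u 0) 0 (ones v ε 1) (negs ε 1) B₀ B₀
  let Y₁ ← representationMerge A (u 0) t (ones v ε 1) (negs ε 1) B₀ B₁
  let S ← representationMerge A ℓ t (ones v ε 0) (negs ε 0) Y₀ Y₁
  forEach (fun x => do tick (h + h + 1); pure (fun j => 2 * x j - 1)) S

/-- The syndrome `e A` of an integer vector over the field `F`. -/
def syndromeOf (A : Matrix (Fin N) (Fin ℓ) F) (e : Fin N → ℤ) : Fin ℓ → F :=
  Matrix.vecMul (fun j => (e j : F)) A

end

/-- Expected number of steps of the algorithm on the instance `(A, e A)` for a uniformly random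
matrix `A`. -/
noncomputable def expectedSteps (F : Type) [Field F] [Fintype F] [DecidableEq F]
    {h : ℕ} (ℓ v : ℕ) (ε : ℕ → ℕ) (e : Fin (h + h) → ℤ) : ℝ :=
  (∑ A : Matrix (Fin (h + h)) (Fin ℓ) F, ((shiftedBCJ2 v ε A (syndromeOf A e)).steps : ℝ)) /
    (Fintype.card (Matrix (Fin (h + h)) (Fin ℓ) F) : ℝ)

/-- Probability, over a uniformly random matrix `A`, that the algorithm on the instance `(A, e A)`
finds `e`. -/
noncomputable def successProb (F : Type) [Field F] [Fintype F] [DecidableEq F]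
    {h : ℕ} (ℓ v : ℕ) (ε : ℕ → ℕ) (e : Fin (h + h) → ℤ) : ℝ :=
  ((Finset.univ.filter fun A : Matrix (Fin (h + h)) (Fin ℓ) F =>
      e ∈ (shiftedBCJ2 v ε A (syndromeOf A e)).val).card : ℝ) /
    (Fintype.card (Matrix (Fin (h + h)) (Fin ℓ) F) : ℝ)

/-! ### The exponents -/

/-- Binary entropy in bits. -/
noncomputable def hBin (x : ℝ) : ℝ := -x * Real.logb 2 x - (1 - x) * Real.logb 2 (1 - x)

/-- `g(x, y) = -x log₂ x - y log₂ y - (1 - x - y) log₂ (1 - x - y)`. -/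
noncomputable def gTri (x y : ℝ) : ℝ :=
  -x * Real.logb 2 x - y * Real.logb 2 y - (1 - x - y) * Real.logb 2 (1 - x - y)

/-- `V_0 = V` and `V_i = V_{i-1} / 2 + E_i`. -/
noncomputable def Vlim (V : ℝ) (E : ℕ → ℝ) : ℕ → ℝ
  | 0 => V
  | i + 1 => Vlim V E i / 2 + E (i + 1)

/-- `M_0 = 0` and `M_i = M_{i-1} / 2 + E_i`. -/
noncomputable def Mlim (E : ℕ → ℝ) : ℕ → ℝ
  | 0 => 0
  | i + 1 => Mlim E i / 2 + E (i + 1)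

/-- `Σ_i = (R + L) g(V_i / (R + L), M_i / (R + L))`. -/
noncomputable def SigmaExp (R L V : ℝ) (E : ℕ → ℝ) (i : ℕ) : ℝ :=
  (R + L) * gTri (Vlim V E i / (R + L)) (Mlim E i / (R + L))

/-- `U_i = M_i + V_i + (R + L - V_i - M_i) h(2 E_{i+1} / (R + L - V_i - M_i)) + 2 E_{i+1}`. -/
noncomputable def UExp (R L V : ℝ) (E : ℕ → ℝ) (i : ℕ) : ℝ :=
  Mlim E i + Vlim V E i
    + (R + L - Vlim V E i - Mlim E i) * hBin (2 * E (i + 1) / (R + L - Vlim V E i - Mlim E i))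
    + 2 * E (i + 1)

/-- `max {Σ₂ / 2, Σ₂ - U₁, 2 Σ₂ - U₁ - U₀, 2 Σ₁ - U₀ - Q L}`. -/
noncomputable def costExp (Q R L V : ℝ) (E : ℕ → ℝ) : ℝ :=
  max (max (SigmaExp R L V E 2 / 2) (SigmaExp R L V E 2 - UExp R L V E 1))
    (max (2 * SigmaExp R L V E 2 - UExp R L V E 1 - UExp R L V E 0)
      (2 * SigmaExp R L V E 1 - UExp R L V E 0 - Q * L))

end ShiftedBCJ

/-! Everything reduces to counting vectors and to one fact about a uniformly random matrix `A`.

Counting. In a representation x = x₁ + x₂, each entry ±1 of x comes from one of the two summands,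
and on 2ε zeros of x the summands cancel. Counting these choices freely gives an upper bound with
powers of 2. Splitting every set exactly in half gives a lower bound with central binomial
coefficients, and both have the same exponent (`card_representations_le`,
`repsLower_le_card_representations`, `tendsto_logb_of_reps_bounds`). The base lists contain only
vectors whose two halves have equal weights. Representing each half separately shows that this loses
nothing in the exponent, which is homogeneous of degree 1 (`repsLower_sq_le_card_balancedReps`,
`repsExp_half`).

Random matrices. The target is τA, where τ is the shifted solution, so every collision is a
homogeneous linear condition: the first u entries of xA vanish. Such a condition always costs a
factor of at most q^u in probability (`prob_cons_ge`), and exactly q^u if x lies outside the span of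
the earlier vectors (`prob_cons_eq`). Only boundedly many conditions are ever imposed at once, so
that span has bounded size, and the dependent vectors contribute bounded additive terms
(`sum_prob_cons_le`).

Success. A solution z is found as soon as some triple (x, y₁, y₃), with x a summand of z and y₁, y₃
summands of x and z - x, satisfies three conditions (`mem_finalVecs`). The number of good triples
has subexponentially small loss in the mean, because q^u agrees with the number of representations
up to such factors, and its second moment is bounded. Cauchy–Schwarz then bounds the probability
from below (`sq_sum_prob_le`, `sq_card_le_mul_prob_exists`).

Cost. Up to polynomial factors the steps are governed by the number of half vectors, the base list
sizes and the collisions on both levels (`le_steps`, `steps_le`). Their means are iterated sums of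
probabilities, bounded from both sides (`le_expectedSteps`, `expectedSteps_le`). The upper bound has
one further term, of exponent Σ₁ - U₀. It is dominated because a vector of level 1 together with a
representation is a pair of vectors of level 2, whence Σ₁ + U₁ ≤ 2Σ₂. -/

set_option linter.unusedSectionVars false

namespace ShiftedBCJ

/-! ### Counting signed ternary vectors and representations -/

section Counting

variable {N : ℕ}

theorem mem_searchSpace {v m : ℕ} {x : Fin N → ℤ} :
    x ∈ searchSpace N v m ↔ WellFormed v m x := by
  simp only [searchSpace, Finset.mem_filter, Fintype.mem_piFinset, Finset.mem_insert,
    Finset.mem_singleton, and_iff_right_iff_imp]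
  exact fun h => h.1

theorem mem_representations {v' m' : ℕ} {x x₁ : Fin N → ℤ} :
    x₁ ∈ representations v' m' x ↔ WellFormed v' m' x₁ ∧ WellFormed v' m' (x - x₁) := by
  simp [representations, mem_searchSpace]

/-- The vector with entries `1` on `P`, entries `-1` on `M` and zeros elsewhere. -/
def signedIndicator (P M : Finset (Fin N)) : Fin N → ℤ :=
  fun j => if j ∈ P then 1 else if j ∈ M then -1 else 0

theorem signedIndicator_eq_one {P M : Finset (Fin N)} {j : Fin N} :
    signedIndicator P M j = 1 ↔ j ∈ P := by
  unfold signedIndicator; split_ifs <;> simp_all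

theorem signedIndicator_eq_neg_one {P M : Finset (Fin N)} (h : Disjoint P M) {j : Fin N} :
    signedIndicator P M j = -1 ↔ j ∈ M := by
  have : j ∈ P → j ∉ M := fun h₁ => Finset.disjoint_left.1 h h₁
  unfold signedIndicator; split_ifs <;> simp_all

theorem wellFormed_signedIndicator {P M : Finset (Fin N)} (h : Disjoint P M) :
    WellFormed P.card M.card (signedIndicator P M) := by
  refine ⟨fun j => ?_, ?_, ?_⟩
  · unfold signedIndicator; split_ifs <;> simp
  · simp [signedIndicator_eq_one]
  · simp [signedIndicator_eq_neg_one h]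

theorem card_searchSpace (N v m : ℕ) :
    (searchSpace N v m).card = N.choose v * (N - v).choose m := by
  have : (searchSpace N v m).card = ((Finset.powersetCard v (Finset.univ : Finset (Fin N))).sigma
      fun P => Finset.powersetCard m Pᶜ).card := by
    refine Finset.card_bij' (fun x _ => ⟨Finset.univ.filter (x · = 1), Finset.univ.filter (x · = -1)⟩)
      (fun p _ => signedIndicator p.1 p.2) ?_ ?_ ?_ ?_
    · intro x hx
      have hx := mem_searchSpace.1 hx
      simp only [Finset.mem_sigma, Finset.mem_powersetCard, Finset.subset_univ, true_and]
      refine ⟨hx.2.1, fun j hj => ?_, hx.2.2⟩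
      simp at hj; simp [hj]
    · rintro ⟨P, M⟩ hp
      simp only [Finset.mem_sigma, Finset.mem_powersetCard, Finset.subset_univ, true_and] at hp
      obtain ⟨rfl, hM, rfl⟩ := hp
      exact mem_searchSpace.2 (wellFormed_signedIndicator (Finset.subset_compl_iff_disjoint_left.1 hM))
    · intro x hx
      have hx := mem_searchSpace.1 hx
      funext j
      have := hx.1 j
      simp only [signedIndicator, Finset.mem_filter, Finset.mem_univ, true_and]
      grind
    · rintro ⟨P, M⟩ hp
      simp only [Finset.mem_sigma, Finset.mem_powersetCard, Finset.subset_univ, true_and] at hp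
      obtain ⟨rfl, hM, rfl⟩ := hp
      simp [signedIndicator_eq_one,
        signedIndicator_eq_neg_one (Finset.subset_compl_iff_disjoint_left.1 hM)]
  rw [this, Finset.card_sigma, Finset.sum_congr rfl (g := fun _ => (N - v).choose m)]
  · simp
  · intro P hP
    rw [Finset.mem_powersetCard] at hP
    simp [Finset.card_compl, hP.2]

theorem WellFormed.add_le {v m : ℕ} {x : Fin N → ℤ} (hx : WellFormed v m x) : v + m ≤ N := by
  rw [← hx.2.1, ← hx.2.2, ← Finset.card_union_of_disjoint]
  · exact (Finset.card_le_univ _).trans (by simp)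
  · exact Finset.disjoint_filter.2 fun j _ h => by omega

theorem WellFormed.card_zeros {v m : ℕ} {x : Fin N → ℤ} (hx : WellFormed v m x) :
    (Finset.univ.filter fun j => x j = 0).card = N - v - m := by
  have h1 : (Finset.univ.filter fun j => x j = 0) =
      ((Finset.univ.filter fun j => x j = 1) ∪ (Finset.univ.filter fun j => x j = -1))ᶜ := by
    ext j
    have := hx.1 j
    simp only [Finset.mem_filter, Finset.mem_univ, true_and, Finset.mem_compl, Finset.mem_union]
    grind
  rw [h1, Finset.card_compl, Finset.card_union_of_disjoint, hx.2.1, hx.2.2, Fintype.card_fin,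
    Nat.sub_sub]
  exact Finset.disjoint_filter.2 fun j _ h => by omega

theorem searchSpace_nonempty {v m : ℕ} (h : v + m ≤ N) : (searchSpace N v m).Nonempty := by
  rw [← Finset.card_pos, card_searchSpace]
  exact Nat.mul_pos (Nat.choose_pos (by omega)) (Nat.choose_pos (by omega))

/-- On a 1 of x the first summand is 0 or 1, on a -1 it is 0 or -1, and on a zero the two summands
are opposite. So the first summand is determined by a subset of the ones, a subset of the -1s, and
its support and positive part on the zeros. Of all weight conditions only the size of that support
is kept, which does not change the exponent. -/
theorem card_representations_le {v m v' m' ε : ℕ} {x : Fin N → ℤ} (hx : WellFormed v m x)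
    (hv : 2 * v' = v + 2 * ε) :
    (representations v' m' x).card ≤
      2 ^ v * 2 ^ m * ((N - v - m).choose (2 * ε) * 2 ^ (2 * ε)) := by
  set P := Finset.univ.filter fun j => x j = 1 with hP
  set M := Finset.univ.filter fun j => x j = -1 with hM
  set Z := Finset.univ.filter fun j => x j = 0 with hZ
  have hcard : (P.powerset ×ˢ M.powerset ×ˢ
      ((Finset.powersetCard (2 * ε) Z).sigma fun S => S.powerset)).card =
      2 ^ v * 2 ^ m * ((N - v - m).choose (2 * ε) * 2 ^ (2 * ε)) := by
    rw [Finset.card_product, Finset.card_product, Finset.card_sigma,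
      Finset.sum_congr rfl (g := fun _ => 2 ^ (2 * ε))]
    · rw [Finset.card_powerset, Finset.card_powerset, hx.2.1, hx.2.2, Finset.sum_const,
        Finset.card_powersetCard, hx.card_zeros, smul_eq_mul, mul_assoc]
    · intro S hS
      rw [Finset.card_powerset, (Finset.mem_powersetCard.1 hS).2]
  rw [← hcard]
  refine Finset.card_le_card_of_injOn (fun x₁ => ⟨P.filter (x₁ · = 1), M.filter (x₁ · = -1),
    Z.filter (x₁ · ≠ 0), Z.filter (x₁ · = 1)⟩) ?_ ?_
  · intro x₁ hx₁
    obtain ⟨h1, h2⟩ := mem_representations.1 hx₁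
    simp only [Finset.coe_product, Set.mem_prod, Finset.mem_coe, Finset.mem_powerset,
      Finset.filter_subset, true_and, Finset.mem_sigma, Finset.mem_powersetCard]
    refine ⟨?_, fun j hj => ?_⟩
    -- The support on the zeros has size 2ε: the ones of x₁ and of x - x₁ together number 2v', and
    -- they consist of the v ones of x and one entry for each zero of x on which the summands
    -- cancel.
    · have e1 : (Finset.univ.filter fun j => x₁ j = 1) =
          P.filter (x₁ · = 1) ∪ Z.filter (x₁ · = 1) := by
        ext j
        have := h1.1 j; have := h2.1 j; have := hx.1 j
        simp only [hP, hZ, Finset.mem_filter, Finset.mem_univ, true_and, Finset.mem_union,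
          Pi.sub_apply] at *
        omega
      have e2 : (Finset.univ.filter fun j => (x - x₁) j = 1) =
          P.filter (x₁ · = 0) ∪ Z.filter (x₁ · = -1) := by
        ext j
        have := h1.1 j; have := h2.1 j; have := hx.1 j
        simp only [hP, hZ, Finset.mem_filter, Finset.mem_univ, true_and, Finset.mem_union,
          Pi.sub_apply] at *
        omega
      have e3 : P = P.filter (x₁ · = 1) ∪ P.filter (x₁ · = 0) := by
        ext j
        have := h1.1 j; have := h2.1 j; have := hx.1 j
        simp only [hP, Finset.mem_filter, Finset.mem_univ, true_and, Finset.mem_union,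
          Pi.sub_apply] at *
        omega
      have e4 : Z.filter (x₁ · ≠ 0) = Z.filter (x₁ · = 1) ∪ Z.filter (x₁ · = -1) := by
        ext j
        have := h1.1 j
        simp only [hZ, Finset.mem_filter, Finset.mem_univ, true_and, Finset.mem_union] at *
        omega
      have d : Disjoint P Z := Finset.disjoint_filter.2 fun j _ h => by omega
      have c1 := h1.2.1
      have c2 := h2.2.1
      have c3 := hx.2.1
      rw [e1, Finset.card_union_of_disjoint (Finset.disjoint_filter_filter d)] at c1
      rw [e2, Finset.card_union_of_disjoint (Finset.disjoint_filter_filter d)] at c2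
      rw [← hP, e3, Finset.card_union_of_disjoint
        (Finset.disjoint_filter.2 fun j _ h => by omega)] at c3
      rw [e4, Finset.card_union_of_disjoint (Finset.disjoint_filter.2 fun j _ h => by omega)]
      omega
    · simp only [Finset.mem_filter] at *
      exact ⟨hj.1, by omega⟩
  · intro x₁ hx₁ y₁ hy₁ h
    obtain ⟨h1, h2⟩ := mem_representations.1 hx₁
    obtain ⟨k1, k2⟩ := mem_representations.1 hy₁
    simp only [Prod.mk.injEq, Sigma.mk.injEq, heq_eq_eq, Finset.ext_iff, Finset.mem_filter, hP, hM,
      hZ, Finset.mem_univ, true_and] at h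
    obtain ⟨a1, a2, a3, a4⟩ := h
    funext j
    have := h1.1 j; have := h2.1 j; have := hx.1 j; have := k1.1 j; have := k2.1 j
    have := a1 j; have := a2 j; have := a3 j; have := a4 j
    simp only [Pi.sub_apply] at *
    omega

/-- One coordinate of the second summand in `repsLower_le_card_representations`. The propositions p,
m, s, t stand for membership in the chosen ones, the chosen -1s, the chosen zeros and those chosen
zeros that get +1. The second summand is given by the complementary choices. -/
theorem signed_sub_entry {x : ℤ} {p m s t : Prop} [Decidable p] [Decidable m] [Decidable s]
    [Decidable t] (h : x = 0 ∨ x = 1 ∨ x = -1) (hp : p → x = 1) (hm : m → x = -1) (hs : s → x = 0)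
    (ht : t → s) :
    x - (if p ∨ t then 1 else if m ∨ (s ∧ ¬t) then -1 else 0) =
      if (x = 1 ∧ ¬p) ∨ (s ∧ ¬t) then 1 else if (x = -1 ∧ ¬m) ∨ t then -1 else 0 := by
  by_cases p <;> by_cases m <;> by_cases t <;> by_cases s <;> rcases h with h | h | h <;> simp_all

/-- Coordinatewise injectivity: the entry of x shows which choices are possible at the coordinate,
and the entry of the summand then shows which was made. -/
theorem signed_entry_inj {x : ℤ} {p m s t p' m' s' t' : Prop} [Decidable p] [Decidable m]
    [Decidable s] [Decidable t] [Decidable p'] [Decidable m'] [Decidable s'] [Decidable t']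
    (hp : p → x = 1) (hm : m → x = -1) (hs : s → x = 0) (ht : t → s)
    (hp' : p' → x = 1) (hm' : m' → x = -1) (hs' : s' → x = 0) (ht' : t' → s')
    (h : (if p ∨ t then (1 : ℤ) else if m ∨ (s ∧ ¬t) then -1 else 0) =
      if p' ∨ t' then 1 else if m' ∨ (s' ∧ ¬t') then -1 else 0) :
    (p ↔ p') ∧ (m ↔ m') ∧ (s ↔ s') ∧ (t ↔ t') := by
  by_cases x = 0
  · by_cases p <;> by_cases m <;> by_cases p' <;> by_cases m' <;> split_ifs at h <;> simp_all
  · by_cases s <;> by_cases s' <;> by_cases t <;> by_cases t' <;> split_ifs at h <;> simp_all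

/-- A lower bound for the number of representations of a vector with `2 * a` entries `1` and
`2 * b` entries `-1`. -/
def repsLower (N a b ε : ℕ) : ℕ :=
  (2 * a).choose a * ((2 * b).choose b *
    ((N - 2 * a - 2 * b).choose (2 * ε) * (2 * ε).choose ε))

/-- The first summand receives half of the ones, half of the -1s, and equally many +1 and -1 on 2ε
zeros. This is only a lower bound: taking j fewer ones, j more -1s and j more positive zeros also
gives the right weights. -/
theorem repsLower_le_card_representations {a b ε : ℕ} {x : Fin N → ℤ}
    (hx : WellFormed (2 * a) (2 * b) x) :
    repsLower N a b ε ≤ (representations (a + ε) (b + ε) x).card := by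
  set P := Finset.univ.filter fun j => x j = 1 with hP
  set M := Finset.univ.filter fun j => x j = -1 with hM
  set Z := Finset.univ.filter fun j => x j = 0 with hZ
  have hcard : (Finset.powersetCard a P ×ˢ Finset.powersetCard b M ×ˢ
      ((Finset.powersetCard (2 * ε) Z).sigma fun S => Finset.powersetCard ε S)).card =
      repsLower N a b ε := by
    rw [Finset.card_product, Finset.card_product, Finset.card_sigma,
      Finset.sum_congr rfl (g := fun _ => (2 * ε).choose ε)]
    · rw [Finset.card_powersetCard, Finset.card_powersetCard, hx.2.1, hx.2.2, Finset.sum_const,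
        Finset.card_powersetCard, hx.card_zeros, smul_eq_mul, repsLower]
    · intro S hS
      rw [Finset.card_powersetCard, (Finset.mem_powersetCard.1 hS).2]
  rw [← hcard]
  have hPx : ∀ j, j ∈ P ↔ x j = 1 := by simp [hP]
  have hMx : ∀ j, j ∈ M ↔ x j = -1 := by simp [hM]
  have hZx : ∀ j, j ∈ Z ↔ x j = 0 := by simp [hZ]
  have key : ∀ p ∈ Finset.powersetCard a P ×ˢ Finset.powersetCard b M ×ˢ
      ((Finset.powersetCard (2 * ε) Z).sigma fun S => Finset.powersetCard ε S),
      (p.1 ⊆ P ∧ p.2.1 ⊆ M ∧ p.2.2.1 ⊆ Z ∧ p.2.2.2 ⊆ p.2.2.1) ∧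
      p.1.card = a ∧ p.2.1.card = b ∧ p.2.2.1.card = 2 * ε ∧ p.2.2.2.card = ε := by
    intro p hp
    simp only [Finset.mem_product, Finset.mem_sigma, Finset.mem_powersetCard] at hp
    tauto
  have dPZ : Disjoint P Z := Finset.disjoint_filter.2 fun j _ h => by omega
  have dPM : Disjoint P M := Finset.disjoint_filter.2 fun j _ h => by omega
  have dMZ : Disjoint M Z := Finset.disjoint_filter.2 fun j _ h => by omega
  refine Finset.card_le_card_of_injOn
    (fun p => signedIndicator (p.1 ∪ p.2.2.2) (p.2.1 ∪ (p.2.2.1 \ p.2.2.2))) ?_ ?_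
  · rintro ⟨P', M', S, T⟩ hp
    obtain ⟨⟨s1, s2, s3, s4⟩, c1, c2, c3, c4⟩ := key _ hp
    dsimp only at s1 s2 s3 s4 c1 c2 c3 c4
    have cST : (S \ T).card = ε := by rw [Finset.card_sdiff_of_subset s4]; omega
    have disj : Disjoint (P' ∪ T) (M' ∪ S \ T) := by
      simp only [Finset.disjoint_union_left, Finset.disjoint_union_right]
      exact ⟨⟨dPM.mono s1 s2, (dMZ.mono s2 (s4.trans s3)).symm⟩,
        dPZ.mono s1 (Finset.sdiff_subset.trans s3), Finset.disjoint_sdiff⟩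
    have disj' : Disjoint ((P \ P') ∪ (S \ T)) ((M \ M') ∪ T) := by
      simp only [Finset.disjoint_union_left, Finset.disjoint_union_right]
      exact ⟨⟨dPM.mono Finset.sdiff_subset Finset.sdiff_subset,
        (dMZ.mono Finset.sdiff_subset (Finset.sdiff_subset.trans s3)).symm⟩,
        dPZ.mono Finset.sdiff_subset (s4.trans s3), Finset.sdiff_disjoint⟩
    have comp : x - signedIndicator (P' ∪ T) (M' ∪ S \ T) =
        signedIndicator ((P \ P') ∪ (S \ T)) ((M \ M') ∪ T) := by
      funext j
      have := signed_sub_entry (hx.1 j) (fun h => (hPx j).1 (s1 h)) (fun h => (hMx j).1 (s2 h))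
        (fun h => (hZx j).1 (s3 h)) (fun h => s4 h)
      simpa only [Pi.sub_apply, signedIndicator, Finset.mem_union, Finset.mem_sdiff, hPx,
        hMx] using this
    have w1 := wellFormed_signedIndicator disj
    have w2 := wellFormed_signedIndicator disj'
    have dP'Z : Disjoint P' S := dPZ.mono s1 s3
    have dM'Z : Disjoint M' S := dMZ.mono s2 s3
    have dP'' : Disjoint (P \ P') S := dPZ.mono Finset.sdiff_subset s3
    have dM'' : Disjoint (M \ M') S := dMZ.mono Finset.sdiff_subset s3
    have cP : P.card = 2 * a := hx.2.1
    have cM : M.card = 2 * b := hx.2.2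
    rw [Finset.card_union_of_disjoint (dP'Z.mono_right s4),
      Finset.card_union_of_disjoint (dM'Z.mono_right Finset.sdiff_subset), c1, c2, c4, cST] at w1
    rw [Finset.card_union_of_disjoint (dP''.mono_right Finset.sdiff_subset),
      Finset.card_union_of_disjoint (dM''.mono_right s4), Finset.card_sdiff_of_subset s1,
      Finset.card_sdiff_of_subset s2, c1, c2, c4, cST, cP, cM, ← comp,
      show 2 * a - a = a by omega, show 2 * b - b = b by omega] at w2
    exact mem_representations.2 ⟨w1, w2⟩
  · rintro ⟨P', M', S, T⟩ hp ⟨P₂, M₂, S₂, T₂⟩ hp₂ h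
    obtain ⟨⟨s1, s2, s3, s4⟩, -⟩ := key _ hp
    obtain ⟨⟨t1, t2, t3, t4⟩, -⟩ := key _ hp₂
    dsimp only at s1 s2 s3 s4 t1 t2 t3 t4 h
    have hall : ∀ j, (j ∈ P' ↔ j ∈ P₂) ∧ (j ∈ M' ↔ j ∈ M₂) ∧ (j ∈ S ↔ j ∈ S₂) ∧
        (j ∈ T ↔ j ∈ T₂) := by
      intro j
      have hj := congrFun h j
      simp only [signedIndicator, Finset.mem_union, Finset.mem_sdiff] at hj
      exact signed_entry_inj (fun h => (hPx j).1 (s1 h)) (fun h => (hMx j).1 (s2 h))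
        (fun h => (hZx j).1 (s3 h)) (fun h => s4 h) (fun h => (hPx j).1 (t1 h))
        (fun h => (hMx j).1 (t2 h)) (fun h => (hZx j).1 (t3 h)) (fun h => t4 h) hj
    obtain rfl : P' = P₂ := Finset.ext fun j => (hall j).1
    obtain rfl : M' = M₂ := Finset.ext fun j => (hall j).2.1
    obtain rfl : S = S₂ := Finset.ext fun j => (hall j).2.2.1
    obtain rfl : T = T₂ := Finset.ext fun j => (hall j).2.2.2
    rfl

/-! ### Vectors with prescribed weights in each half -/

theorem wellFormed_append {h₁ h₂ v m v' m' : ℕ} {x : Fin h₁ → ℤ} {y : Fin h₂ → ℤ}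
    (hx : WellFormed v m x) (hy : WellFormed v' m' y) :
    WellFormed (v + v') (m + m') (Fin.append x y) := by
  refine ⟨fun j => ?_, ?_, ?_⟩
  · refine Fin.addCases (fun i => ?_) (fun i => ?_) j
    · simpa using hx.1 i
    · simpa using hy.1 i
  · rw [← hx.2.1, ← hy.2.1, Finset.card_filter, Finset.card_filter, Finset.card_filter,
      Fin.sum_univ_add]
    simp only [Fin.append_left, Fin.append_right]
  · rw [← hx.2.2, ← hy.2.2, Finset.card_filter, Finset.card_filter, Finset.card_filter,
      Fin.sum_univ_add]
    simp only [Fin.append_left, Fin.append_right]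

/-- The vectors of length `h + h` both of whose halves have `v` entries `1` and `m` entries
`-1`. -/
def balancedSpace (h v m : ℕ) : Finset (Fin (h + h) → ℤ) :=
  (searchSpace h v m ×ˢ searchSpace h v m).image fun p => Fin.append p.1 p.2

theorem append_injective {α : Type*} {h₁ h₂ : ℕ} :
    Function.Injective fun p : (Fin h₁ → α) × (Fin h₂ → α) => Fin.append p.1 p.2 := by
  rintro ⟨x, y⟩ ⟨x', y'⟩ h
  simp only at h
  refine Prod.ext (funext fun i => ?_) (funext fun i => ?_)
  · simpa using congrFun h (Fin.castAdd _ i)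
  · simpa using congrFun h (Fin.natAdd _ i)

theorem sum_balancedSpace {β : Type*} [AddCommMonoid β] {h v m : ℕ}
    (f : (Fin (h + h) → ℤ) → β) :
    ∑ z ∈ balancedSpace h v m, f z =
      ∑ x ∈ searchSpace h v m, ∑ y ∈ searchSpace h v m, f (Fin.append x y) := by
  rw [balancedSpace, Finset.sum_image append_injective.injOn, Finset.sum_product]

theorem card_balancedSpace (h v m : ℕ) :
    (balancedSpace h v m).card = (searchSpace h v m).card ^ 2 := by
  rw [balancedSpace, Finset.card_image_of_injective _ append_injective, Finset.card_product, sq]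

theorem append_mem_balancedSpace {h v m : ℕ} {x y : Fin h → ℤ} :
    Fin.append x y ∈ balancedSpace h v m ↔ WellFormed v m x ∧ WellFormed v m y := by
  rw [balancedSpace]
  constructor
  · intro hz
    obtain ⟨p, hp, hpe⟩ := Finset.mem_image.1 hz
    have := append_injective (a₁ := p) (a₂ := (x, y)) hpe
    subst this
    simpa [mem_searchSpace] using hp
  · intro hz
    exact Finset.mem_image.2 ⟨(x, y), by simpa [mem_searchSpace] using hz, rfl⟩

theorem wellFormed_of_mem_balancedSpace {h v m : ℕ} {z : Fin (h + h) → ℤ}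
    (hz : z ∈ balancedSpace h v m) : WellFormed (2 * v) (2 * m) z := by
  rw [← Fin.append_castAdd_natAdd (f := z), append_mem_balancedSpace] at hz
  rw [← Fin.append_castAdd_natAdd (f := z), two_mul, two_mul]
  exact wellFormed_append hz.1 hz.2

theorem balancedSpace_subset {h v m : ℕ} :
    balancedSpace h v m ⊆ searchSpace (h + h) (2 * v) (2 * m) :=
  fun _ hz => mem_searchSpace.2 (wellFormed_of_mem_balancedSpace hz)

theorem append_sub_append {h₁ h₂ : ℕ} (x x' : Fin h₁ → ℤ) (y y' : Fin h₂ → ℤ) :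
    Fin.append x y - Fin.append x' y' = Fin.append (x - x') (y - y') := by
  funext j
  refine Fin.addCases (fun i => ?_) (fun i => ?_) j <;> simp

/-- Representations both of whose summands are balanced. -/
def balancedReps {h : ℕ} (v' m' : ℕ) (z : Fin (h + h) → ℤ) : Finset (Fin (h + h) → ℤ) :=
  (balancedSpace h v' m').filter fun y => z - y ∈ balancedSpace h v' m'

/-- Representations of the two halves can be chosen independently, which yields the square. At half
the length the exponent is half as large, so the balanced representations have the same exponent as
all representations. -/
theorem repsLower_sq_le_card_balancedReps {h a b ε : ℕ} {z : Fin (h + h) → ℤ}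
    (hz : z ∈ balancedSpace h (2 * a) (2 * b)) :
    repsLower h a b ε ^ 2 ≤ (balancedReps (a + ε) (b + ε) z).card := by
  obtain ⟨⟨x, y⟩, hxy, rfl⟩ := Finset.mem_image.1 hz
  rw [Finset.mem_product, mem_searchSpace, mem_searchSpace] at hxy
  calc repsLower h a b ε ^ 2
      ≤ (representations (a + ε) (b + ε) x ×ˢ representations (a + ε) (b + ε) y).card := by
        rw [Finset.card_product, sq]
        exact Nat.mul_le_mul (repsLower_le_card_representations hxy.1)
          (repsLower_le_card_representations hxy.2)
    _ ≤ _ := by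
        refine Finset.card_le_card_of_injOn (fun p => Fin.append p.1 p.2) ?_
          append_injective.injOn
        rintro ⟨x₁, y₁⟩ hp
        simp only [Finset.coe_product, Set.mem_prod, Finset.mem_coe, mem_representations] at hp
        simp only [balancedReps, Finset.coe_filter, Set.mem_ofPred_eq, append_mem_balancedSpace,
          append_sub_append]
        exact ⟨⟨hp.1.1, hp.2.1⟩, hp.1.2, hp.2.2⟩

theorem balancedReps_subset {h v' m' : ℕ} {z : Fin (h + h) → ℤ} :
    balancedReps v' m' z ⊆ representations (2 * v') (2 * m') z := by
  intro y hy
  rw [balancedReps, Finset.mem_filter] at hy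
  exact mem_representations.2
    ⟨wellFormed_of_mem_balancedSpace hy.1, wellFormed_of_mem_balancedSpace hy.2⟩

end Counting

end ShiftedBCJ

/-! ### Values and step counts of counted computations -/

namespace Counted

@[simp] theorem pure_val {α : Type} (a : α) : (pure a : Counted α).val = a := rfl
@[simp] theorem pure_steps {α : Type} (a : α) : (pure a : Counted α).steps = 0 := rfl
@[simp] theorem bind_val {α β : Type} (x : Counted α) (f : α → Counted β) :
    (x >>= f).val = (f x.val).val := rfl
@[simp] theorem bind_steps {α β : Type} (x : Counted α) (f : α → Counted β) :
    (x >>= f).steps = x.steps + (f x.val).steps := rfl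
@[simp] theorem tick_steps (c : ℕ) : (tick c).steps = c := rfl

@[simp] theorem forEach_val {α β : Type} (f : α → Counted β) (l : List α) :
    (forEach f l).val = l.map fun a => (f a).val := by
  induction l with
  | nil => rfl
  | cons a l ih => simp [forEach, ih]

@[simp] theorem forEach_steps {α β : Type} (f : α → Counted β) (l : List α) :
    (forEach f l).steps = (l.map fun a => (f a).steps).sum := by
  induction l with
  | nil => rfl
  | cons a l ih => simp [forEach, ih]

end Counted

namespace ShiftedBCJ

open Counted

/-! ### The lists and the steps of the algorithm -/

theorem wellFormed_cons {N v m : ℕ} {a : ℤ} {x : Fin N → ℤ} :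
    WellFormed v m (Fin.cons a x : Fin (N + 1) → ℤ) ↔
      (a = 0 ∧ WellFormed v m x) ∨ (a = 1 ∧ v ≠ 0 ∧ WellFormed (v - 1) m x) ∨
        (a = -1 ∧ m ≠ 0 ∧ WellFormed v (m - 1) x) := by
  unfold WellFormed
  rw [Fin.forall_fin_succ, Finset.card_filter, Finset.card_filter, Fin.sum_univ_succ,
    Fin.sum_univ_succ]
  simp only [Fin.cons_zero, Fin.cons_succ, ← Finset.card_filter]
  constructor
  · rintro ⟨⟨rfl | rfl | rfl, h⟩, h1, h2⟩
    · simp at h1 h2; simp [h, h1, h2]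
    · simp at h1 h2; right; left; exact ⟨rfl, by omega, h, by omega, by omega⟩
    · simp at h1 h2; right; right; exact ⟨rfl, by omega, h, by omega, by omega⟩
  · rintro (⟨rfl, h, h1, h2⟩ | ⟨rfl, hv, h, h1, h2⟩ | ⟨rfl, hv, h, h1, h2⟩)
    · simp [h, h1, h2]
    · simp [h, h1, h2]; omega
    · simp [h, h1, h2]; omega

theorem enumerate_zero_val (v m : ℕ) :
    (enumerate 0 v m).val = if v = 0 ∧ m = 0 then [Fin.elim0] else [] := by
  simp [enumerate]

theorem enumerate_succ_val (N v m : ℕ) :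
    (enumerate (N + 1) v m).val = if N + 1 < v + m then [] else
      (((enumerate N v m).val.map fun x => Fin.cons 0 x) ++
        (if v = 0 then [] else (enumerate N (v - 1) m).val.map fun x => Fin.cons 1 x)) ++
        (if m = 0 then [] else (enumerate N v (m - 1)).val.map fun x => Fin.cons (-1) x) := by
  rw [enumerate]
  split_ifs <;> simp

theorem enumerate_succ_steps (N v m : ℕ) :
    (enumerate (N + 1) v m).steps = if N + 1 < v + m then 1 else
      1 + ((enumerate N v m).steps + (enumerate N v m).val.length) +
        (if v = 0 then 0 else
          (enumerate N (v - 1) m).steps + (enumerate N (v - 1) m).val.length) +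
        (if m = 0 then 0 else
          (enumerate N v (m - 1)).steps + (enumerate N v (m - 1)).val.length) := by
  rw [enumerate]
  split_ifs <;> simp <;> ring

theorem mem_enumerate {N v m : ℕ} {x : Fin N → ℤ} :
    x ∈ (enumerate N v m).val ↔ WellFormed v m x := by
  induction N generalizing v m with
  | zero =>
    rw [enumerate_zero_val, Subsingleton.elim x Fin.elim0]
    split_ifs with h
    · simp [WellFormed, h]
    · simp [WellFormed]; omega
  | succ N ih =>
    rw [enumerate_succ_val]
    split_ifs with h h1 h2 h2
    · simp only [List.not_mem_nil, false_iff]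
      intro hx; have := hx.add_le; omega
    all_goals
      rw [← Fin.cons_self_tail x, wellFormed_cons]
      simp only [List.mem_append, List.mem_map, List.not_mem_nil, or_false, ih, Fin.cons_inj,
        exists_eq_right_right]
      grind

theorem nodup_enumerate (N v m : ℕ) : (enumerate N v m).val.Nodup := by
  induction N generalizing v m with
  | zero => rw [enumerate_zero_val]; split_ifs <;> simp
  | succ N ih =>
    rw [enumerate_succ_val]
    have hinj : ∀ a : ℤ, Function.Injective
        fun x : Fin N → ℤ => (Fin.cons a x : Fin (N + 1) → ℤ) :=
      fun a _ _ h => (Fin.cons_inj.1 h).2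
    have hd : ∀ {a b : ℤ}, a ≠ b → ∀ l l' : List (Fin N → ℤ),
        (l.map fun x => (Fin.cons a x : Fin (N + 1) → ℤ)).Disjoint
          (l'.map fun x => (Fin.cons b x : Fin (N + 1) → ℤ)) := by
      intro a b hab l l' x hx hx'
      obtain ⟨y, -, rfl⟩ := List.mem_map.1 hx
      obtain ⟨y', -, h⟩ := List.mem_map.1 hx'
      exact hab (Fin.cons_inj.1 h).1.symm
    split_ifs with h h1 h2 h2
    · simp
    all_goals simp only [List.append_nil, List.nodup_append', List.disjoint_append_left]
    · exact (ih _ _).map (hinj 0)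
    · exact ⟨(ih _ _).map (hinj 0), (ih _ _).map (hinj _), hd (by decide) _ _⟩
    · exact ⟨(ih _ _).map (hinj 0), (ih _ _).map (hinj _), hd (by decide) _ _⟩
    · exact ⟨⟨(ih _ _).map (hinj 0), (ih _ _).map (hinj _), hd (by decide) _ _⟩,
        (ih _ _).map (hinj _), hd (by decide) _ _, hd (by decide) _ _⟩

theorem sum_enumerate {β : Type*} [AddCommMonoid β] (N v m : ℕ) (f : (Fin N → ℤ) → β) :
    ((enumerate N v m).val.map f).sum = ∑ x ∈ searchSpace N v m, f x := by
  rw [← List.sum_toFinset f (nodup_enumerate N v m)]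
  congr 1
  ext x
  rw [List.mem_toFinset, mem_enumerate, mem_searchSpace]

theorem length_enumerate (N v m : ℕ) :
    (enumerate N v m).val.length = (searchSpace N v m).card := by
  have := sum_enumerate N v m (fun _ => 1)
  simpa using this

/-- The pruning test makes every surviving node lead to at least one vector, so the tree has no
large dead parts. The constant 4 allows, for each vector and level, one written entry and the
additive 1 of each of at most three children. -/
theorem enumerate_steps_le (N v m : ℕ) :
    (enumerate N v m).steps ≤ 1 + 4 * N * (searchSpace N v m).card := by
  simp_rw [← length_enumerate]
  induction N generalizing v m with
  | zero => simp [enumerate]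
  | succ N ih =>
    rw [enumerate_succ_steps]
    by_cases h : N + 1 < v + m
    · rw [if_pos h]; omega
    have hpos : 1 ≤ (enumerate (N + 1) v m).val.length := by
      rw [length_enumerate]
      exact (searchSpace_nonempty (by omega)).card_pos
    have h0 := ih v m
    have h1 := ih (v - 1) m
    have h2 := ih v (m - 1)
    rw [enumerate_succ_val, if_neg h] at hpos ⊢
    rw [if_neg h]
    simp only [List.length_append, apply_ite List.length, List.length_map, List.length_nil]
      at hpos ⊢
    split_ifs at hpos ⊢ <;> nlinarith

section

variable {F : Type} [Field F] [DecidableEq F] {N ℓ : ℕ}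

/-- The first `u` entries of `x A` vanish. -/
def Vanish (A : Matrix (Fin N) (Fin ℓ) F) (x : Fin N → F) (u : ℕ) : Prop :=
  ∀ j : Fin ℓ, (j : ℕ) < u → Matrix.vecMul x A j = 0

instance (A : Matrix (Fin N) (Fin ℓ) F) (x : Fin N → F) (u : ℕ) : Decidable (Vanish A x u) := by
  unfold Vanish; infer_instance

/-- Reduction of an integer vector. -/
def castVec (F : Type) [Field F] {N : ℕ} (x : Fin N → ℤ) : Fin N → F := fun j => (x j : F)

theorem castVec_add (x y : Fin N → ℤ) : castVec F (x + y) = castVec F x + castVec F y := by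
  funext j; simp [castVec]

theorem castVec_sub (x y : Fin N → ℤ) : castVec F (x - y) = castVec F x - castVec F y := by
  funext j; simp [castVec]

theorem firstPositions_eq_iff {u : ℕ} {t t' : Fin ℓ → F} :
    firstPositions u t = firstPositions u t' ↔ ∀ j : Fin ℓ, (j : ℕ) < u → t j = t' j := by
  unfold firstPositions
  rw [funext_iff]
  refine forall_congr' fun j => ?_
  split_ifs with h <;> simp [h]

@[simp] theorem syndrome_val (A : Matrix (Fin N) (Fin ℓ) F) (x : Fin N → ℤ) :
    (syndrome A x).val = Matrix.vecMul (castVec F x) A := rfl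

@[simp] theorem syndrome_steps (A : Matrix (Fin N) (Fin ℓ) F) (x : Fin N → ℤ) :
    (syndrome A x).steps = N * ℓ := rfl

/-- With a target of the form τA, equality of keys is a homogeneous linear condition on `A`. This is
what makes the events of the algorithm subspaces of the space of matrices. -/
theorem firstPositions_eq_iff_vanish {A : Matrix (Fin N) (Fin ℓ) F} {u : ℕ} {x y τ : Fin N → F} :
    firstPositions u (Matrix.vecMul τ A - Matrix.vecMul y A) =
      firstPositions u (Matrix.vecMul x A) ↔ Vanish A (x + y - τ) u := by
  rw [firstPositions_eq_iff]
  refine forall₂_congr fun j _ => ?_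
  rw [Matrix.sub_vecMul, Matrix.add_vecMul]
  simp only [Pi.sub_apply, Pi.add_apply]
  constructor <;> intro h <;> linear_combination -h

theorem buildTable_val {β : Type} (key : β → Counted (Fin ℓ → F)) (L : List β) (κ : Fin ℓ → F) :
    (buildTable key L).val κ = L.filter fun b => (key b).val = κ := by
  induction L with
  | nil => rfl
  | cons b L ih =>
    simp only [buildTable, bind_val, pure_val, List.filter_cons]
    by_cases h : (key b).val = κ
    · subst h; simp [ih]
    · simp [h, Function.update_of_ne (Ne.symm h), ih]

theorem buildTable_steps {β : Type} (key : β → Counted (Fin ℓ → F)) (K : ℕ)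
    (hK : ∀ b, (key b).steps = K) (L : List β) :
    (buildTable key L).steps = L.length * (K + (ℓ + 1)) := by
  induction L with
  | nil => simp [buildTable]
  | cons b L ih =>
    simp only [buildTable, bind_steps, ih, hK, tick_steps, pure_steps, List.length_cons]
    ring

/-! ### Lists and collisions produced by a merge -/

section merge

variable {α β γ : Type} (key₁ : α → Counted (Fin ℓ → F)) (key₂ : β → Counted (Fin ℓ → F))
  (combine : α → β → Counted γ) (L₁ : List α) (L₂ : List β)

theorem merge_val :
    (merge key₁ key₂ combine L₁ L₂).val = L₁.flatMap fun a =>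
      (L₂.filter fun b => (key₂ b).val = (key₁ a).val).map fun b => (combine a b).val := by
  simp [merge, buildTable_val, List.flatMap_def]

theorem mem_merge {c : γ} :
    c ∈ (merge key₁ key₂ combine L₁ L₂).val ↔
      ∃ a ∈ L₁, ∃ b ∈ L₂, (key₂ b).val = (key₁ a).val ∧ (combine a b).val = c := by
  simp [merge_val, and_assoc]

theorem sum_map_filter {δ : Type*} (L : List δ) (p : δ → Prop) [DecidablePred p] (f : δ → ℝ) :
    ((L.filter fun b => decide (p b)).map f).sum = (L.map fun b => if p b then f b else 0).sum := by
  induction L with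
  | nil => rfl
  | cons b L ih => by_cases h : p b <;> simp [h, ih]

theorem sum_flatMap {δ δ' : Type*} (L : List δ) (g : δ → List δ') (f : δ' → ℝ) :
    ((L.flatMap g).map f).sum = (L.map fun a => ((g a).map f).sum).sum := by
  induction L with
  | nil => rfl
  | cons b L ih => simp [ih]

theorem sum_merge (f : γ → ℝ) :
    ((merge key₁ key₂ combine L₁ L₂).val.map f).sum = (L₁.map fun a =>
      (L₂.map fun b =>
        if (key₂ b).val = (key₁ a).val then f (combine a b).val else 0).sum).sum := by
  rw [merge_val, sum_flatMap]
  congr 1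
  refine List.map_congr_left fun a _ => ?_
  rw [List.map_map, sum_map_filter]
  rfl

theorem merge_steps (K c : ℕ) (h₁ : ∀ a, (key₁ a).steps = K) (h₂ : ∀ b, (key₂ b).steps = K)
    (hc : ∀ a b, (combine a b).steps = c) :
    (merge key₁ key₂ combine L₁ L₂).steps = (L₁.length + L₂.length) * (K + (ℓ + 1)) +
      (merge key₁ key₂ combine L₁ L₂).val.length * c := by
  rw [merge_val, merge]
  simp only [bind_steps, buildTable_steps key₂ K h₂, buildTable_val, forEach_steps, h₁, hc,
    tick_steps, pure_steps, List.length_flatMap, List.length_map, List.map_const',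
    List.sum_replicate, smul_eq_mul]
  generalize L₂.length = n
  clear h₂
  induction L₁ with
  | nil => simp
  | cons a L ih => simp at ih ⊢; linarith

end merge

theorem length_eq_sum {δ : Type*} (L : List δ) : (L.length : ℝ) = (L.map fun _ => (1 : ℝ)).sum := by
  simp

/-- The number of pairs from `L₁ × L₂` whose sums agree with `τ` on the first `u` positions of the
syndrome. -/
noncomputable def collisions (A : Matrix (Fin N) (Fin ℓ) F) (u : ℕ) (τ : Fin N → F)
    (L₁ L₂ : List (Fin N → ℤ)) : ℝ :=
  (L₁.map fun x => (L₂.map fun y =>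
    if Vanish A (castVec F x + castVec F y - τ) u then (1 : ℝ) else 0).sum).sum

variable (A : Matrix (Fin N) (Fin ℓ) F) (u : ℕ) (τ : Fin N → F) (v m : ℕ)
  (L₁ L₂ : List (Fin N → ℤ))

theorem mem_representationMerge {z : Fin N → ℤ} :
    z ∈ (representationMerge A u (Matrix.vecMul τ A) v m L₁ L₂).val ↔
      ∃ x ∈ L₁, ∃ y ∈ L₂, Vanish A (castVec F x + castVec F y - τ) u ∧
        WellFormed v m (x + y) ∧ x + y = z := by
  simp only [representationMerge, bind_val, pure_val, List.mem_filter, mem_merge, syndrome_val,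
    firstPositions_eq_iff_vanish, decide_eq_true_eq]
  constructor
  · rintro ⟨⟨x, hx, y, hy, h, rfl⟩, hz⟩
    exact ⟨x, hx, y, hy, h, hz, rfl⟩
  · rintro ⟨x, hx, y, hy, h, hz, rfl⟩
    exact ⟨⟨x, hx, y, hy, h, rfl⟩, hz⟩

/-- Duplicates are kept, so a statistic of the list is an iterated sum of indicators over pairs. Its
mean over `A` can therefore be taken term by term. -/
theorem sum_representationMerge (f : (Fin N → ℤ) → ℝ) :
    ((representationMerge A u (Matrix.vecMul τ A) v m L₁ L₂).val.map f).sum =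
      (L₁.map fun x => (L₂.map fun y =>
        if Vanish A (castVec F x + castVec F y - τ) u then
          (if WellFormed v m (x + y) then f (x + y) else 0) else 0).sum).sum := by
  simp only [representationMerge, bind_val, pure_val]
  rw [sum_map_filter, sum_merge]
  simp only [bind_val, pure_val, syndrome_val, firstPositions_eq_iff_vanish]

theorem representationMerge_steps :
    ((representationMerge A u (Matrix.vecMul τ A) v m L₁ L₂).steps : ℝ) =
      ((L₁.length : ℝ) + L₂.length) * (N * ℓ + (ℓ + 1)) +
        2 * (N + 1) * collisions A u τ L₁ L₂ := by
  simp only [representationMerge, bind_steps, pure_steps]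
  rw [merge_steps _ _ _ _ _ (N * ℓ) (N + 1) (by simp) (by simp) (by simp)]
  simp only [forEach_steps, tick_steps, List.map_const', List.sum_replicate, smul_eq_mul]
  push_cast
  rw [length_eq_sum (merge _ _ _ _ _).val, sum_merge]
  simp only [bind_val, pure_val, syndrome_val, firstPositions_eq_iff_vanish, collisions]
  ring

theorem length_representationMerge_le :
    ((representationMerge A u (Matrix.vecMul τ A) v m L₁ L₂).val.length : ℝ) ≤
      collisions A u τ L₁ L₂ := by
  rw [length_eq_sum, sum_representationMerge]
  refine List.sum_le_sum fun x _ => List.sum_le_sum fun y _ => ?_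
  split_ifs <;> simp

theorem castVec_append {h : ℕ} (x y : Fin h → ℤ) :
    castVec F (Fin.append x 0) + castVec F (Fin.append 0 y) = castVec F (Fin.append x y) := by
  rw [← castVec_add]
  congr 1
  funext j
  refine Fin.addCases (fun i => ?_) (fun i => ?_) j <;>
    simp only [Pi.add_apply, Fin.append_left, Fin.append_right, Pi.zero_apply, add_zero, zero_add]

section base

variable {h : ℕ} (A : Matrix (Fin (h + h)) (Fin ℓ) F) (u : ℕ) (τ : Fin (h + h) → F) (v m : ℕ)

theorem mem_baseList {z : Fin (h + h) → ℤ} :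
    z ∈ (baseList A u (Matrix.vecMul τ A) v m).val ↔
      z ∈ balancedSpace h (v / 2) (m / 2) ∧ Vanish A (castVec F z - τ) u := by
  simp only [baseList, bind_val, mem_merge, pure_val, syndrome_val, firstPositions_eq_iff_vanish,
    castVec_append, mem_enumerate]
  constructor
  · rintro ⟨x, hx, y, hy, h, rfl⟩
    exact ⟨append_mem_balancedSpace.2 ⟨hx, hy⟩, h⟩
  · rintro ⟨hz, h⟩
    rw [← Fin.append_castAdd_natAdd (f := z)] at hz h ⊢
    obtain ⟨hx, hy⟩ := append_mem_balancedSpace.1 hz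
    exact ⟨_, hx, _, hy, h, rfl⟩

theorem sum_baseList (f : (Fin (h + h) → ℤ) → ℝ) :
    ((baseList A u (Matrix.vecMul τ A) v m).val.map f).sum =
      ∑ z ∈ balancedSpace h (v / 2) (m / 2),
        if Vanish A (castVec F z - τ) u then f z else 0 := by
  simp only [baseList, bind_val]
  rw [sum_merge, sum_enumerate, sum_balancedSpace]
  simp only [sum_enumerate, bind_val, pure_val, syndrome_val, firstPositions_eq_iff_vanish,
    castVec_append]

theorem baseList_steps :
    (baseList A u (Matrix.vecMul τ A) v m).steps =
      2 * (enumerate h (v / 2) (m / 2)).steps +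
        2 * (searchSpace h (v / 2) (m / 2)).card * ((h + h) * ℓ + (ℓ + 1)) +
        (baseList A u (Matrix.vecMul τ A) v m).val.length * (h + h + 1) := by
  simp only [baseList, bind_steps, bind_val]
  rw [merge_steps _ _ _ _ _ ((h + h) * ℓ) (h + h + 1) (by simp) (by simp) (by simp)]
  simp only [length_enumerate]
  ring

end base

end

end ShiftedBCJ

namespace ShiftedBCJ

/-! ### Random matrices -/

section Probability

variable {F : Type} [Field F] [Fintype F] [DecidableEq F] {N ℓ : ℕ}

/-- The matrices that satisfy all constraints in a list; the constraint `(x, u)` says that the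
first `u` entries of `x A` vanish. -/
def solutions (ℓ : ℕ) (cs : List ((Fin N → F) × ℕ)) : Submodule F (Matrix (Fin N) (Fin ℓ) F) where
  carrier := {A | ∀ c ∈ cs, Vanish A c.1 c.2}
  add_mem' := by
    intro A B hA hB c hc j hj
    rw [Matrix.vecMul_add, Pi.add_apply, hA c hc j hj, hB c hc j hj, add_zero]
  zero_mem' := by intro c _ j _; simp
  smul_mem' := by
    intro a A hA c hc j hj
    rw [Matrix.vecMul_smul, Pi.smul_apply, hA c hc j hj, smul_zero]

theorem mem_solutions {cs : List ((Fin N → F) × ℕ)} {A : Matrix (Fin N) (Fin ℓ) F} :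
    A ∈ solutions ℓ cs ↔ ∀ c ∈ cs, Vanish A c.1 c.2 := Iff.rfl

/-- The probability that a uniformly random matrix satisfies all constraints in a list. -/
noncomputable def prob (ℓ : ℕ) (cs : List ((Fin N → F) × ℕ)) : ℝ :=
  (Nat.card (solutions ℓ cs) : ℝ) / Fintype.card (Matrix (Fin N) (Fin ℓ) F)

theorem prob_nonneg (cs : List ((Fin N → F) × ℕ)) : 0 ≤ prob ℓ cs := by
  unfold prob; positivity

theorem prob_mono {cs cs' : List ((Fin N → F) × ℕ)}
    (h : ∀ A : Matrix (Fin N) (Fin ℓ) F, (∀ c ∈ cs', Vanish A c.1 c.2) →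
      ∀ c ∈ cs, Vanish A c.1 c.2) :
    prob ℓ cs' ≤ prob ℓ cs := by
  unfold prob
  gcongr
  exact Nat.card_mono (Set.toFinite (solutions ℓ cs : Set (Matrix (Fin N) (Fin ℓ) F))) h

theorem prob_subset {cs cs' : List ((Fin N → F) × ℕ)} (h : cs ⊆ cs') :
    prob ℓ cs' ≤ prob ℓ cs :=
  prob_mono fun _ hA c hc => hA c (h hc)

theorem prob_nil : prob (F := F) (N := N) ℓ [] = 1 := by
  have : solutions (F := F) (N := N) ℓ [] = ⊤ := by
    ext A; simp [mem_solutions]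
  have hpos : (0 : ℝ) < Fintype.card (Matrix (Fin N) (Fin ℓ) F) :=
    Nat.cast_pos.2 Fintype.card_pos
  rw [prob, this, Nat.card_congr (Submodule.topEquiv).toEquiv, Nat.card_eq_fintype_card]
  exact div_self hpos.ne'

theorem sum_indicator_div (P : Matrix (Fin N) (Fin ℓ) F → Prop) [DecidablePred P]
    (cs : List ((Fin N → F) × ℕ)) (h : ∀ A, P A ↔ ∀ c ∈ cs, Vanish A c.1 c.2) :
    (∑ A : Matrix (Fin N) (Fin ℓ) F, if P A then (1 : ℝ) else 0) /
      Fintype.card (Matrix (Fin N) (Fin ℓ) F) = prob ℓ cs := by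
  rw [prob, Finset.sum_boole]
  congr 2
  rw [← Fintype.card_subtype, ← Nat.card_eq_fintype_card]
  exact Nat.card_congr (Equiv.subtypeEquivRight h)

/-- The first `u` entries of `x A`. -/
def leadingEntries {u : ℕ} (hu : u ≤ ℓ) (x : Fin N → F) :
    Matrix (Fin N) (Fin ℓ) F →ₗ[F] (Fin u → F) where
  toFun A i := Matrix.vecMul x A (Fin.castLE hu i)
  map_add' A B := by funext i; simp [Matrix.vecMul_add]
  map_smul' a A := by funext i; simp [Matrix.vecMul_smul]

theorem leadingEntries_eq_zero {u : ℕ} (hu : u ≤ ℓ) (x : Fin N → F)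
    (A : Matrix (Fin N) (Fin ℓ) F) : leadingEntries hu x A = 0 ↔ Vanish A x u := by
  constructor
  · intro h j hj
    exact congrFun h ⟨j, hj⟩
  · intro h
    funext i
    exact h _ i.2

/-- Rank–nullity: a further condition divides the number of admissible matrices by q to the rank of
the map A ↦ (first u entries of xA) on the space cut out by the earlier conditions. -/
theorem card_solutions_cons {u : ℕ} (hu : u ≤ ℓ) (x : Fin N → F)
    (cs : List ((Fin N → F) × ℕ)) :
    Nat.card (solutions ℓ cs) = Fintype.card F ^ Module.finrank F
      (LinearMap.range ((leadingEntries hu x).domRestrict (solutions ℓ cs))) *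
      Nat.card (solutions ℓ ((x, u) :: cs)) := by
  set f := (leadingEntries hu x).domRestrict (solutions ℓ cs)
  have e : Nat.card (solutions ℓ ((x, u) :: cs)) = Nat.card (LinearMap.ker f) := by
    refine Nat.card_congr ⟨fun A => ⟨⟨A.1, fun c hc => A.2 c (List.mem_cons_of_mem _ hc)⟩, ?_⟩,
      fun A => ⟨A.1.1, ?_⟩, fun _ => rfl, fun _ => rfl⟩
    · rw [LinearMap.mem_ker]
      exact (leadingEntries_eq_zero hu x A.1).2 (A.2 _ List.mem_cons_self)
    · refine List.forall_mem_cons.2 ⟨?_, A.1.2⟩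
      exact (leadingEntries_eq_zero hu x A.1.1).1 (LinearMap.mem_ker.1 A.2)
  have h := LinearMap.finrank_range_add_finrank_ker f
  rw [e, Module.natCard_eq_pow_finrank (K := F) (V := solutions ℓ cs),
    Module.natCard_eq_pow_finrank (K := F) (V := LinearMap.ker f), ← h, pow_add,
    Nat.card_eq_fintype_card]

theorem card_pos_real : (0 : ℝ) < Fintype.card F := Nat.cast_pos.2 Fintype.card_pos

theorem one_lt_card_real : (1 : ℝ) < Fintype.card F := Nat.one_lt_cast.2 Fintype.one_lt_card

/-- The rank in `card_solutions_cons` is at most u, whatever relations hold among the vectors. Hence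
all lower bounds on means hold without any independence. -/
theorem prob_cons_ge {u : ℕ} (hu : u ≤ ℓ) (x : Fin N → F) (cs : List ((Fin N → F) × ℕ)) :
    prob ℓ cs / (Fintype.card F : ℝ) ^ u ≤ prob ℓ ((x, u) :: cs) := by
  have hq := card_pos_real (F := F)
  rw [div_le_iff₀ (by positivity), prob, prob, div_mul_eq_mul_div, card_solutions_cons hu x cs]
  gcongr
  push_cast
  rw [mul_comm]
  gcongr
  · exact one_lt_card_real.le
  · exact (Submodule.finrank_le _).trans (by simp)

theorem exists_dual_vector {S : Submodule F (Fin N → F)} {x : Fin N → F} (hx : x ∉ S) :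
    ∃ c : Fin N → F, (∀ y ∈ S, y ⬝ᵥ c = 0) ∧ x ⬝ᵥ c = 1 := by
  obtain ⟨f, hf, hS⟩ := Submodule.exists_le_ker_of_notMem hx
  have hrep : ∀ y : Fin N → F, f y = y ⬝ᵥ fun i => f (Pi.single i 1) := by
    intro y
    rw [LinearMap.pi_apply_eq_sum_univ f y]
    simp only [dotProduct, smul_eq_mul]
    refine Finset.sum_congr rfl fun i _ => ?_
    congr 2
    funext j
    simp [Pi.single_apply, eq_comm]
  refine ⟨(f x)⁻¹ • fun i => f (Pi.single i 1), fun y hy => ?_, ?_⟩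
  · rw [dotProduct_smul, ← hrep, LinearMap.mem_ker.1 (hS hy), smul_zero]
  · rw [dotProduct_smul, ← hrep, smul_eq_mul, inv_mul_cancel₀ hf]

/-- Outside the span of the earlier vectors the rank is full, so the new condition is independent of
the earlier ones. -/
theorem prob_cons_eq {u : ℕ} (hu : u ≤ ℓ) {x : Fin N → F} {cs : List ((Fin N → F) × ℕ)}
    (hx : x ∉ Submodule.span F ((cs.map Prod.fst).toFinset : Set (Fin N → F))) :
    prob ℓ ((x, u) :: cs) = prob ℓ cs / (Fintype.card F : ℝ) ^ u := by
  have hq := card_pos_real (F := F)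
  have hrange : LinearMap.range ((leadingEntries hu x).domRestrict (solutions ℓ cs)) = ⊤ := by
    obtain ⟨c, hc, hxc⟩ := exists_dual_vector hx
    rw [LinearMap.range_eq_top]
    intro w
    -- The rank-one matrix c ⊗ w: the vector c is orthogonal to all earlier vectors, so their
    -- conditions hold, while x ⬝ c = 1 makes w appear as the first u entries of xA.
    set A : Matrix (Fin N) (Fin ℓ) F :=
      Matrix.vecMulVec c fun j => if h : (j : ℕ) < u then w ⟨j, h⟩ else 0 with hA
    refine ⟨⟨A, fun d hd j _ => ?_⟩, ?_⟩
    · have : d.1 ⬝ᵥ c = 0 := hc _ (Submodule.subset_span (by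
        simp only [Finset.mem_coe, List.mem_toFinset, List.mem_map]; exact ⟨d, hd, rfl⟩))
      rw [hA, Matrix.vecMul_vecMulVec, this]
      simp
    · funext i
      change Matrix.vecMul x A (Fin.castLE hu i) = w i
      rw [hA, Matrix.vecMul_vecMulVec, hxc]
      simp
  rw [prob, prob, card_solutions_cons hu x cs, hrange]
  simp only [finrank_top, Module.finrank_fintype_fun_eq_card, Fintype.card_fin]
  push_cast
  field_simp

theorem card_span_le (cs : List ((Fin N → F) × ℕ)) :
    Nat.card (Submodule.span F ((cs.map Prod.fst).toFinset : Set (Fin N → F))) ≤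
      Fintype.card F ^ cs.length := by
  rw [Module.natCard_eq_pow_finrank (K := F), Nat.card_eq_fintype_card]
  refine Nat.pow_le_pow_right Fintype.card_pos ?_
  refine (finrank_span_finset_le_card _).trans ((List.toFinset_card_le _).trans ?_)
  simp

/-- The vectors outside the span of the earlier ones contribute exactly q^(-u) each. Inside it there
are at most q^(length of `cs`) vectors, since f is injective, and for these the new condition is
simply dropped. With boundedly many conditions the correction is a constant. -/
theorem sum_prob_cons_le {ι : Type*} {u : ℕ} (hu : u ≤ ℓ) (cs : List ((Fin N → F) × ℕ))
    (I : Finset ι) (f : ι → Fin N → F) (hf : Set.InjOn f I) :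
    ∑ i ∈ I, prob ℓ ((f i, u) :: cs) ≤
      prob ℓ cs * (I.card / (Fintype.card F : ℝ) ^ u + (Fintype.card F : ℝ) ^ cs.length) := by
  classical
  set S := Submodule.span F ((cs.map Prod.fst).toFinset : Set (Fin N → F))
  rw [← Finset.sum_filter_add_sum_filter_not I (fun i => f i ∉ S), mul_add]
  refine add_le_add ?_ ?_
  · rw [Finset.sum_congr rfl fun i hi => prob_cons_eq hu (Finset.mem_filter.1 hi).2,
      Finset.sum_const, nsmul_eq_mul, mul_div, mul_comm, ← mul_div]
    have := prob_nonneg (ℓ := ℓ) cs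
    have hq := card_pos_real (F := F)
    gcongr
    exact Finset.filter_subset _ _
  · refine (Finset.sum_le_card_nsmul _ _ (prob ℓ cs)
      fun i _ => prob_subset (List.subset_cons_self _ _)).trans ?_
    rw [nsmul_eq_mul, mul_comm]
    refine mul_le_mul_of_nonneg_left ?_ (prob_nonneg cs)
    have h1 : (I.filter fun i => ¬f i ∉ S).card ≤ Nat.card S := by
      rw [Nat.card_eq_fintype_card, Fintype.card_subtype]
      refine Finset.card_le_card_of_injOn f (fun i hi => ?_)
        (hf.mono (Finset.coe_subset.2 (Finset.filter_subset _ _)))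
      have := (Finset.mem_filter.1 hi).2
      simpa using this
    exact_mod_cast h1.trans (card_span_le cs)

end Probability

end ShiftedBCJ

namespace ShiftedBCJ

/-! ### Exponents of factorials and binomial coefficients -/

section Asymptotics

/-- A weak form of Stirling's formula, with an error of order log a, by induction from log x ≤ x -
1. -/
theorem le_log_factorial (a : ℕ) : a * Real.log a - a ≤ Real.log (a.factorial : ℝ) := by
  induction a with
  | zero => simp
  | succ a ih =>
    rw [Nat.factorial_succ, Nat.cast_mul, Real.log_mul (by positivity) (by positivity)]
    rcases Nat.eq_zero_or_pos a with rfl | ha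
    · simp
    have ha' : (0 : ℝ) < a := Nat.cast_pos.2 ha
    have h := Real.log_le_sub_one_of_pos (x := (a + 1) / a) (by positivity)
    rw [Real.log_div (by positivity) (by positivity)] at h
    have h2 : a * (Real.log (a + 1) - Real.log a) ≤ 1 := by
      calc a * (Real.log (a + 1) - Real.log a) ≤ a * ((a + 1) / a - 1) := by gcongr
        _ = 1 := by field_simp; ring
    push_cast
    linarith

theorem log_factorial_le (a : ℕ) :
    Real.log (a.factorial : ℝ) ≤ a * Real.log a - a + (1 + Real.log a) := by
  induction a with
  | zero => simp
  | succ a ih =>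
    rw [Nat.factorial_succ, Nat.cast_mul, Real.log_mul (by positivity) (by positivity)]
    rcases Nat.eq_zero_or_pos a with rfl | ha
    · simp
    have ha' : (0 : ℝ) < a := Nat.cast_pos.2 ha
    have h := Real.log_le_sub_one_of_pos (x := a / (a + 1)) (by positivity)
    rw [Real.log_div (by positivity) (by positivity)] at h
    have h2 : (a + 1) * (Real.log a - Real.log (a + 1)) ≤ -1 := by
      calc (a + 1) * (Real.log a - Real.log (a + 1)) ≤ (a + 1) * (a / (a + 1) - 1) := by gcongr
        _ = -1 := by field_simp; ring
    push_cast
    linarith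

theorem log_le_two_mul_sqrt {x : ℝ} (hx : 0 < x) : Real.log x ≤ 2 * √x := by
  have h := Real.log_le_sub_one_of_pos (Real.sqrt_pos.2 hx)
  rw [Real.log_sqrt hx.le] at h
  linarith

theorem tendsto_log_div_zero {a : ℕ → ℝ} {A : ℝ} (h1 : ∀ n, 1 ≤ a n)
    (ha : Tendsto (fun n => a n / n) atTop (𝓝 A)) :
    Tendsto (fun n : ℕ => Real.log (a n) / n) atTop (𝓝 0) := by
  have h := ((ha.mul tendsto_inv_atTop_nhds_zero_nat).sqrt).const_mul 2
  rw [mul_zero, Real.sqrt_zero, mul_zero] at h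
  refine squeeze_zero (fun n => div_nonneg (Real.log_nonneg (h1 n)) (Nat.cast_nonneg n)) ?_ h
  intro n
  have h0 : (0 : ℝ) < a n := zero_lt_one.trans_le (h1 n)
  calc Real.log (a n) / n ≤ 2 * √(a n) / n := by gcongr; exact log_le_two_mul_sqrt h0
    _ = 2 * √(a n / n * (n : ℝ)⁻¹) := by
        rw [show a n / n * (n : ℝ)⁻¹ = a n / (n : ℝ) ^ 2 by rw [div_mul_eq_mul_div]; field_simp,
          Real.sqrt_div h0.le, Real.sqrt_sq (Nat.cast_nonneg n), mul_div_assoc]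

theorem tendsto_add_one_div {a : ℕ → ℕ} {A : ℝ}
    (ha : Tendsto (fun n => (a n : ℝ) / n) atTop (𝓝 A)) :
    Tendsto (fun n => ((a n : ℝ) + 1) / n) atTop (𝓝 A) := by
  have := ha.add tendsto_inv_atTop_nhds_zero_nat
  simpa [add_div] using this

/-- Writing a log a = a log n + n · (a/n) log (a/n) separates the divergent part. Since x log x is
continuous at 0, the case A = 0 needs no separate treatment in the limit. -/
theorem tendsto_log_factorial {a : ℕ → ℕ} {A : ℝ}
    (ha : Tendsto (fun n => (a n : ℝ) / n) atTop (𝓝 A)) :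
    Tendsto (fun n : ℕ => (Real.log ((a n).factorial : ℝ) - a n * Real.log n + a n) / n) atTop
      (𝓝 (A * Real.log A)) := by
  have h1 : Tendsto (fun n : ℕ => ((a n : ℝ) / n) * Real.log ((a n : ℝ) / n)) atTop
      (𝓝 (A * Real.log A)) := (Real.continuous_mul_log.tendsto A).comp ha
  have h2 : Tendsto (fun n : ℕ => ((a n : ℝ) / n) * Real.log ((a n : ℝ) / n) +
      ((n : ℝ)⁻¹ + Real.log ((a n : ℝ) + 1) / n)) atTop (𝓝 (A * Real.log A)) := by
    simpa using h1.add (tendsto_inv_atTop_nhds_zero_nat.add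
      (tendsto_log_div_zero (fun n => by simp) (tendsto_add_one_div ha)))
  have key : ∀ n : ℕ, 0 < n → ((a n : ℝ) / n) * Real.log ((a n : ℝ) / n) =
      (a n * Real.log (a n) - a n * Real.log n) / n := by
    intro n hn
    have hn' : (0 : ℝ) < n := Nat.cast_pos.2 hn
    rcases Nat.eq_zero_or_pos (a n) with h | h
    · simp [h]
    · have : (0 : ℝ) < a n := Nat.cast_pos.2 h
      rw [Real.log_div this.ne' hn'.ne']; ring
  refine tendsto_of_tendsto_of_tendsto_of_le_of_le' h1 h2 ?_ ?_
  · filter_upwards [eventually_gt_atTop 0] with n hn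
    rw [key n hn]
    have := le_log_factorial (a n)
    gcongr
    linarith
  · filter_upwards [eventually_gt_atTop 0] with n hn
    rw [key n hn, inv_eq_one_div, ← add_div, ← add_div]
    have := log_factorial_le (a n)
    have hlog : Real.log (a n) ≤ Real.log (a n + 1) := by
      rcases Nat.eq_zero_or_pos (a n) with h | h
      · simp [h]
      · have : (0 : ℝ) < a n := Nat.cast_pos.2 h
        exact Real.log_le_log this (by linarith)
    exact div_le_div_of_nonneg_right (by linarith) (Nat.cast_nonneg n)

/-! ### Entropy in homogeneous form and the exponents of binomial coefficients -/

theorem mul_hBin_div {A B : ℝ} (hB : 0 ≤ B) (hBA : B ≤ A) :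
    A * hBin (B / A) =
      (A * Real.log A - B * Real.log B - (A - B) * Real.log (A - B)) / Real.log 2 := by
  rcases hB.eq_or_lt with rfl | hB
  · simp [hBin]
  have hA : 0 < A := hB.trans_le hBA
  rcases hBA.eq_or_lt with rfl | hBA
  · simp [hBin, hA.ne']
  have h1 : 1 - B / A = (A - B) / A := by field_simp
  have hAB : 0 < A - B := sub_pos.2 hBA
  have hl : Real.log 2 ≠ 0 := (Real.log_pos one_lt_two).ne'
  rw [hBin, h1, Real.logb, Real.logb, Real.log_div hB.ne' hA.ne', Real.log_div hAB.ne' hA.ne']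
  field_simp
  ring

theorem mul_gTri_div {A B C : ℝ} (hB : 0 ≤ B) (hC : 0 ≤ C) (h : B + C ≤ A) :
    A * gTri (B / A) (C / A) =
      (A * Real.log A - B * Real.log B - C * Real.log C - (A - B - C) * Real.log (A - B - C)) /
        Real.log 2 := by
  rcases (by linarith : 0 ≤ A).eq_or_lt with rfl | hA
  · obtain rfl : B = 0 := by linarith
    obtain rfl : C = 0 := by linarith
    simp
  have h1 : 1 - B / A - C / A = (A - B - C) / A := by field_simp
  have hl : Real.log 2 ≠ 0 := (Real.log_pos one_lt_two).ne'
  have key : ∀ x : ℝ, x / A * Real.logb 2 (x / A) * A * Real.log 2 =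
      x * Real.log x - x * Real.log A := by
    intro x
    rcases eq_or_ne x 0 with rfl | hx
    · simp
    rw [Real.logb, Real.log_div hx hA.ne']
    field_simp
  rw [gTri, h1, eq_div_iff hl]
  linear_combination -(key B) - key C - key (A - B - C)

theorem tendsto_sub_div {a b : ℕ → ℕ} {A B : ℝ} (hab : ∀ n, b n ≤ a n)
    (ha : Tendsto (fun n => (a n : ℝ) / n) atTop (𝓝 A))
    (hb : Tendsto (fun n => (b n : ℝ) / n) atTop (𝓝 B)) :
    Tendsto (fun n => ((a n - b n : ℕ) : ℝ) / n) atTop (𝓝 (A - B)) := by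
  refine (ha.sub hb).congr fun n => ?_
  rw [Nat.cast_sub (hab n), sub_div]

theorem tendsto_limit_nonneg {a : ℕ → ℕ} {A : ℝ}
    (ha : Tendsto (fun n => (a n : ℝ) / n) atTop (𝓝 A)) : 0 ≤ A :=
  ge_of_tendsto' ha fun n => by positivity

theorem tendsto_limit_le {a b : ℕ → ℕ} {A B : ℝ} (hab : ∀ n, b n ≤ a n)
    (ha : Tendsto (fun n => (a n : ℝ) / n) atTop (𝓝 A))
    (hb : Tendsto (fun n => (b n : ℝ) / n) atTop (𝓝 B)) : B ≤ A :=
  le_of_tendsto_of_tendsto' hb ha fun n => by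
    gcongr
    exact hab n

/-- The terms a log n - a from the three factorials cancel, because the two lower factorials have
arguments adding up to the upper one. What remains is the homogeneous form in `mul_hBin_div`, also
valid on the boundary of the range of B. -/
theorem tendsto_logb_choose {a b : ℕ → ℕ} {A B : ℝ} (hab : ∀ n, b n ≤ a n)
    (ha : Tendsto (fun n => (a n : ℝ) / n) atTop (𝓝 A))
    (hb : Tendsto (fun n => (b n : ℝ) / n) atTop (𝓝 B)) :
    Tendsto (fun n => Real.logb 2 ((a n).choose (b n) : ℝ) / n) atTop (𝓝 (A * hBin (B / A))) := by
  rw [mul_hBin_div (tendsto_limit_nonneg hb) (tendsto_limit_le hab ha hb)]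
  refine ((((tendsto_log_factorial ha).sub (tendsto_log_factorial hb)).sub
    (tendsto_log_factorial (tendsto_sub_div hab ha hb))).div_const (Real.log 2)).congr fun n => ?_
  rw [Nat.cast_choose ℝ (hab n), Real.logb, Real.log_div (by positivity) (by positivity),
    Real.log_mul (by positivity) (by positivity), Nat.cast_sub (hab n)]
  ring

theorem tendsto_logb_mul {a b : ℕ → ℝ} {A B : ℝ} (ha0 : ∀ n, a n ≠ 0) (hb0 : ∀ n, b n ≠ 0)
    (ha : Tendsto (fun n : ℕ => Real.logb 2 (a n) / n) atTop (𝓝 A))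
    (hb : Tendsto (fun n : ℕ => Real.logb 2 (b n) / n) atTop (𝓝 B)) :
    Tendsto (fun n : ℕ => Real.logb 2 (a n * b n) / n) atTop (𝓝 (A + B)) := by
  refine (ha.add hb).congr fun n => ?_
  rw [Real.logb_mul (ha0 n) (hb0 n), add_div]

theorem tendsto_logb_div {a b : ℕ → ℝ} {A B : ℝ} (ha0 : ∀ n, a n ≠ 0) (hb0 : ∀ n, b n ≠ 0)
    (ha : Tendsto (fun n : ℕ => Real.logb 2 (a n) / n) atTop (𝓝 A))
    (hb : Tendsto (fun n : ℕ => Real.logb 2 (b n) / n) atTop (𝓝 B)) :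
    Tendsto (fun n : ℕ => Real.logb 2 (a n / b n) / n) atTop (𝓝 (A - B)) := by
  refine (ha.sub hb).congr fun n => ?_
  rw [Real.logb_div (ha0 n) (hb0 n), sub_div]

theorem tendsto_logb_pow {a : ℕ → ℝ} {A : ℝ} (k : ℕ)
    (ha : Tendsto (fun n : ℕ => Real.logb 2 (a n) / n) atTop (𝓝 A)) :
    Tendsto (fun n : ℕ => Real.logb 2 (a n ^ k) / n) atTop (𝓝 (k * A)) := by
  refine (ha.const_mul (k : ℝ)).congr fun n => ?_
  rw [Real.logb_pow, mul_div_assoc]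

theorem tendsto_logb_const (c : ℝ) :
    Tendsto (fun n : ℕ => Real.logb 2 c / n) atTop (𝓝 0) :=
  tendsto_const_div_atTop_nhds_zero_nat _

theorem tendsto_logb_const_pow (c : ℝ) {u : ℕ → ℕ} {U : ℝ}
    (hu : Tendsto (fun n => (u n : ℝ) / n) atTop (𝓝 U)) :
    Tendsto (fun n : ℕ => Real.logb 2 (c ^ u n) / n) atTop (𝓝 (Real.logb 2 c * U)) := by
  refine (hu.const_mul (Real.logb 2 c)).congr fun n => ?_
  rw [Real.logb_pow]; ring

theorem tendsto_logb_card_searchSpace {N v m : ℕ → ℕ} {S V M : ℝ} (h : ∀ n, v n + m n ≤ N n)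
    (hN : Tendsto (fun n => (N n : ℝ) / n) atTop (𝓝 S))
    (hv : Tendsto (fun n => (v n : ℝ) / n) atTop (𝓝 V))
    (hm : Tendsto (fun n => (m n : ℝ) / n) atTop (𝓝 M)) :
    Tendsto (fun n => Real.logb 2 ((searchSpace (N n) (v n) (m n)).card : ℝ) / n) atTop
      (𝓝 (S * gTri (V / S) (M / S))) := by
  have hle : ∀ n, v n ≤ N n := fun n => by have := h n; omega
  have hle' : ∀ n, m n ≤ N n - v n := fun n => by have := h n; omega
  have hNv := tendsto_sub_div hle hN hv
  have hM := tendsto_limit_nonneg hm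
  have hV := tendsto_limit_nonneg hv
  have hMV := tendsto_limit_le hle' hNv hm
  -- The chain rule for entropy, matching the choice of the ones first and of the -1s among the
  -- remaining positions.
  have e : S * gTri (V / S) (M / S) = S * hBin (V / S) + (S - V) * hBin (M / (S - V)) := by
    rw [mul_gTri_div hV hM (by linarith), mul_hBin_div hV (by linarith), mul_hBin_div hM hMV]
    ring
  rw [e]
  refine (tendsto_logb_mul (fun n => ?_) (fun n => ?_) (tendsto_logb_choose hle hN hv)
    (tendsto_logb_choose hle' hNv hm)).congr fun n => ?_
  · exact Nat.cast_ne_zero.2 (Nat.choose_pos (hle n)).ne'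
  · exact Nat.cast_ne_zero.2 (Nat.choose_pos (hle' n)).ne'
  · rw [card_searchSpace, Nat.cast_mul]

/-- An upper bound for the number of representations of a vector with `2 * a` entries `1` and
`2 * b` entries `-1`. -/
def repsUpper (N a b ε : ℕ) : ℕ :=
  2 ^ (2 * a) * 2 ^ (2 * b) * ((N - 2 * a - 2 * b).choose (2 * ε) * 2 ^ (2 * ε))

theorem hBin_half : hBin (1 / 2) = 1 := by
  rw [hBin, show (1 : ℝ) - 1 / 2 = 1 / 2 by norm_num, one_div, Real.logb_inv,
    Real.logb_self_eq_one one_lt_two]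
  norm_num

theorem tendsto_two_mul_div {a : ℕ → ℕ} {A : ℝ}
    (ha : Tendsto (fun n => (a n : ℝ) / n) atTop (𝓝 A)) :
    Tendsto (fun n => ((2 * a n : ℕ) : ℝ) / n) atTop (𝓝 (2 * A)) := by
  refine (ha.const_mul 2).congr fun n => ?_
  push_cast; ring

theorem tendsto_logb_centralBinom {a : ℕ → ℕ} {A : ℝ}
    (ha : Tendsto (fun n => (a n : ℝ) / n) atTop (𝓝 A)) :
    Tendsto (fun n => Real.logb 2 ((2 * a n).choose (a n) : ℝ) / n) atTop (𝓝 (2 * A)) := by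
  have h := tendsto_logb_choose (fun n => by omega) (tendsto_two_mul_div ha) ha
  -- For A = 0 the ratio A / (2A) is 0 instead of 1/2, but the entropy is multiplied by 0.
  rcases eq_or_ne A 0 with rfl | hA
  · simpa using h
  · rwa [show A / (2 * A) = 1 / 2 by field_simp, hBin_half, mul_one] at h

/-! ### Exponents of the bounds on the number of representations -/

section reps

variable {N a b ε : ℕ → ℕ} {S A B E : ℝ} (h : ∀ n, 2 * a n + 2 * b n + 2 * ε n ≤ N n)
    (hN : Tendsto (fun n => (N n : ℝ) / n) atTop (𝓝 S))
    (ha : Tendsto (fun n => (a n : ℝ) / n) atTop (𝓝 A))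
    (hb : Tendsto (fun n => (b n : ℝ) / n) atTop (𝓝 B))
    (hε : Tendsto (fun n => (ε n : ℝ) / n) atTop (𝓝 E))

include h hN ha hb hε

theorem tendsto_logb_choose_zeros :
    Tendsto (fun n => Real.logb 2 ((N n - 2 * a n - 2 * b n).choose (2 * ε n) : ℝ) / n) atTop
      (𝓝 ((S - 2 * A - 2 * B) * hBin (2 * E / (S - 2 * A - 2 * B)))) := by
  have h1 : ∀ n, 2 * a n ≤ N n := fun n => by have := h n; omega
  have h2 : ∀ n, 2 * b n ≤ N n - 2 * a n := fun n => by have := h n; omega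
  have h3 : ∀ n, 2 * ε n ≤ N n - 2 * a n - 2 * b n := fun n => by have := h n; omega
  exact tendsto_logb_choose h3 (tendsto_sub_div h2 (tendsto_sub_div h1 hN (tendsto_two_mul_div ha))
    (tendsto_two_mul_div hb)) (tendsto_two_mul_div hε)

theorem tendsto_logb_repsLower :
    Tendsto (fun n => Real.logb 2 (repsLower (N n) (a n) (b n) (ε n) : ℝ) / n) atTop
      (𝓝 (2 * B + 2 * A + (S - 2 * A - 2 * B) * hBin (2 * E / (S - 2 * A - 2 * B)) + 2 * E)) := by
  have h3 : ∀ n, 2 * ε n ≤ N n - 2 * a n - 2 * b n := fun n => by have := h n; omega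
  have p1 : ∀ c : ℕ, ((2 * c).choose c : ℝ) ≠ 0 := fun c =>
    Nat.cast_ne_zero.2 (Nat.choose_pos (by omega)).ne'
  have p2 : ∀ n, ((N n - 2 * a n - 2 * b n).choose (2 * ε n) : ℝ) ≠ 0 := fun n =>
    Nat.cast_ne_zero.2 (Nat.choose_pos (h3 n)).ne'
  have key := tendsto_logb_mul (fun n => p1 (a n))
    (fun n => mul_ne_zero (p1 (b n)) (mul_ne_zero (p2 n) (p1 (ε n))))
    (tendsto_logb_centralBinom ha) (tendsto_logb_mul (fun n => p1 (b n))
      (fun n => mul_ne_zero (p2 n) (p1 (ε n))) (tendsto_logb_centralBinom hb)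
      (tendsto_logb_mul p2 (fun n => p1 (ε n)) (tendsto_logb_choose_zeros h hN ha hb hε)
        (tendsto_logb_centralBinom hε)))
  convert key using 2
  · unfold repsLower; push_cast; rfl
  · ring

theorem tendsto_logb_repsUpper :
    Tendsto (fun n => Real.logb 2 (repsUpper (N n) (a n) (b n) (ε n) : ℝ) / n) atTop
      (𝓝 (2 * B + 2 * A + (S - 2 * A - 2 * B) * hBin (2 * E / (S - 2 * A - 2 * B)) + 2 * E)) := by
  have h3 : ∀ n, 2 * ε n ≤ N n - 2 * a n - 2 * b n := fun n => by have := h n; omega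
  have p1 : ∀ c : ℕ, ((2 : ℝ) ^ c) ≠ 0 := fun c => by positivity
  have p2 : ∀ n, ((N n - 2 * a n - 2 * b n).choose (2 * ε n) : ℝ) ≠ 0 := fun n =>
    Nat.cast_ne_zero.2 (Nat.choose_pos (h3 n)).ne'
  have key := tendsto_logb_mul (fun n => mul_ne_zero (p1 (2 * a n)) (p1 (2 * b n)))
    (fun n => mul_ne_zero (p2 n) (p1 (2 * ε n)))
    (tendsto_logb_mul (fun n => p1 (2 * a n)) (fun n => p1 (2 * b n))
      (tendsto_logb_const_pow 2 (tendsto_two_mul_div ha))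
      (tendsto_logb_const_pow 2 (tendsto_two_mul_div hb)))
    (tendsto_logb_mul p2 (fun n => p1 (2 * ε n)) (tendsto_logb_choose_zeros h hN ha hb hε)
        (tendsto_logb_const_pow 2 (tendsto_two_mul_div hε)))
  convert key using 2
  · unfold repsUpper; push_cast; rfl
  · rw [Real.logb_self_eq_one one_lt_two]; ring

/-- The lower and upper bounds differ only by replacing central binomial coefficients with powers of
2, so they have a common exponent. This serves both for the representations of single vectors and
for their maximum. -/
theorem tendsto_logb_of_reps_bounds {r : ℕ → ℕ}
    (hl : ∀ n, repsLower (N n) (a n) (b n) (ε n) ≤ r n)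
    (hr : ∀ n, r n ≤ repsUpper (N n) (a n) (b n) (ε n)) :
    Tendsto (fun n => Real.logb 2 (r n : ℝ) / n) atTop
      (𝓝 (2 * B + 2 * A + (S - 2 * A - 2 * B) * hBin (2 * E / (S - 2 * A - 2 * B)) + 2 * E)) := by
  have pos : ∀ n, 0 < repsLower (N n) (a n) (b n) (ε n) := fun n => by
    have := h n
    unfold repsLower
    exact Nat.mul_pos (Nat.choose_pos (by omega)) (Nat.mul_pos (Nat.choose_pos (by omega))
      (Nat.mul_pos (Nat.choose_pos (by omega)) (Nat.choose_pos (by omega))))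
  refine tendsto_of_tendsto_of_tendsto_of_le_of_le (tendsto_logb_repsLower h hN ha hb hε)
    (tendsto_logb_repsUpper h hN ha hb hε) (fun n => ?_) (fun n => ?_)
  · have := pos n
    dsimp only
    gcongr
    · norm_num
    · exact hl n
  · have := (pos n).trans_le (hl n)
    dsimp only
    gcongr
    · norm_num
    · exact hr n

end reps

/-- Rounding down to an integer power of q changes the base-2 logarithm by at most log₂ q, which
disappears after division by n. -/
theorem tendsto_log_mul_div {q : ℕ} (hq : 1 < q) {r : ℕ → ℕ} (hr : ∀ n, 1 ≤ r n) {U : ℝ}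
    (h : Tendsto (fun n => Real.logb 2 (r n : ℝ) / n) atTop (𝓝 U)) :
    Tendsto (fun n => Real.logb 2 (q : ℝ) * ((Nat.log q (r n) : ℝ) / n)) atTop (𝓝 U) := by
  have hq0 : (0 : ℝ) < q := by positivity
  have h1 : Tendsto (fun n : ℕ => Real.logb 2 (r n : ℝ) / n - Real.logb 2 (q : ℝ) / n) atTop
      (𝓝 U) := by simpa using h.sub (tendsto_logb_const (q : ℝ))
  refine tendsto_of_tendsto_of_tendsto_of_le_of_le h1 h (fun n => ?_) (fun n => ?_)
  · have hlt : (r n : ℝ) ≤ (q : ℝ) ^ (Nat.log q (r n) + 1) :=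
      mod_cast (Nat.lt_pow_succ_log_self hq (r n)).le
    have := Real.logb_le_logb_of_le one_lt_two (Nat.cast_pos.2 (hr n)) hlt
    rw [Real.logb_pow] at this
    push_cast at this
    dsimp only
    rw [← sub_div, ← mul_div_assoc]
    gcongr
    linarith
  · have hle : (q : ℝ) ^ (Nat.log q (r n)) ≤ r n :=
      mod_cast Nat.pow_log_le_self q (Nat.one_le_iff_ne_zero.1 (hr n))
    have := Real.logb_le_logb_of_le one_lt_two (by positivity) hle
    rw [Real.logb_pow] at this
    dsimp only
    rw [← mul_div_assoc]
    gcongr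
    linarith

end Asymptotics

end ShiftedBCJ

namespace ShiftedBCJ

open Counted

/-! ### The intermediate lists -/

section Lists

variable {F : Type} [Field F] [DecidableEq F] {h ℓ : ℕ}

/-- A base list with target `τ A`. -/
def baseVecs (A : Matrix (Fin (h + h)) (Fin ℓ) F) (u : ℕ) (τ : Fin (h + h) → F) (v m : ℕ) :
    List (Fin (h + h) → ℤ) :=
  (baseList A u (Matrix.vecMul τ A) v m).val

/-- A list on level 1 with target `τ A`. -/
def midVecs (A : Matrix (Fin (h + h)) (Fin ℓ) F) (u : ℕ → ℕ) (τ : Fin (h + h) → F)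
    (o g : ℕ → ℕ) : List (Fin (h + h) → ℤ) :=
  (representationMerge A (u 0) (Matrix.vecMul τ A) (o 1) (g 1)
    (baseVecs A (u 1) 0 (o 2) (g 2)) (baseVecs A (u 1) τ (o 2) (g 2))).val

/-- The list on level 0 with target `τ A`. -/
def finalVecs (A : Matrix (Fin (h + h)) (Fin ℓ) F) (u : ℕ → ℕ) (τ : Fin (h + h) → F)
    (o g : ℕ → ℕ) : List (Fin (h + h) → ℤ) :=
  (representationMerge A ℓ (Matrix.vecMul τ A) (o 0) (g 0)
    (midVecs A u 0 o g) (midVecs A u τ o g)).val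

variable [Fintype F]

theorem shiftedBCJ2_val (v : ℕ) (ε : ℕ → ℕ) (A : Matrix (Fin (h + h)) (Fin ℓ) F) (s : Fin ℓ → F)
    (τ : Fin (h + h) → F)
    (hτ : (fun j => (s j + Matrix.vecMul (castVec F 1) A j) / 2) = Matrix.vecMul τ A) :
    (shiftedBCJ2 v ε A s).val =
      (finalVecs A (mergeLength (Fintype.card F) (h + h) v ε) τ (ones v ε) (negs ε)).map
        fun x j => 2 * x j - 1 := by
  unfold finalVecs midVecs baseVecs
  rw [← hτ, Matrix.zero_vecMul, shiftedBCJ2]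
  simp only [bind_val, forEach_val, syndrome_val, pure_val]

/-- The equations for `u`, `o` and `g` keep these functions opaque in the estimates that follow. -/
theorem shiftedBCJ2_steps (v : ℕ) (ε : ℕ → ℕ) (A : Matrix (Fin (h + h)) (Fin ℓ) F)
    (s : Fin ℓ → F) (τ : Fin (h + h) → F)
    (hτ : (fun j => (s j + Matrix.vecMul (castVec F 1) A j) / 2) = Matrix.vecMul τ A)
    {u o g : ℕ → ℕ} (hu : u = mergeLength (Fintype.card F) (h + h) v ε) (ho : o = ones v ε)
    (hg : g = negs ε) :
    (shiftedBCJ2 v ε A s).steps = (h + h) * ℓ + 2 * ℓ +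
      (baseList A (u 1) (Matrix.vecMul 0 A) (o 2) (g 2)).steps +
      (baseList A (u 1) (Matrix.vecMul τ A) (o 2) (g 2)).steps +
      (representationMerge A (u 0) (Matrix.vecMul 0 A) (o 1) (g 1)
        (baseVecs A (u 1) 0 (o 2) (g 2)) (baseVecs A (u 1) 0 (o 2) (g 2))).steps +
      (representationMerge A (u 0) (Matrix.vecMul τ A) (o 1) (g 1)
        (baseVecs A (u 1) 0 (o 2) (g 2)) (baseVecs A (u 1) τ (o 2) (g 2))).steps +
      (representationMerge A ℓ (Matrix.vecMul τ A) (o 0) (g 0)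
        (midVecs A u 0 o g) (midVecs A u τ o g)).steps +
      (finalVecs A u τ o g).length * (h + h + 1) := by
  subst hu ho hg
  unfold finalVecs midVecs baseVecs
  rw [← hτ, Matrix.zero_vecMul, shiftedBCJ2]
  simp only [bind_steps, forEach_steps, syndrome_val, syndrome_steps, pure_steps,
    tick_steps, List.map_const', List.sum_replicate, smul_eq_mul, add_zero]
  ring

theorem wellFormed_of_mem_representationMerge {N : ℕ} {A : Matrix (Fin N) (Fin ℓ) F} {u v m : ℕ}
    {t : Fin ℓ → F} {L₁ L₂ : List (Fin N → ℤ)} {z : Fin N → ℤ}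
    (hz : z ∈ (representationMerge A u t v m L₁ L₂).val) :
    WellFormed v m z ∧ ∀ j : Fin ℓ, (j : ℕ) < u → Matrix.vecMul (castVec F z) A j = t j := by
  simp only [representationMerge, bind_val, pure_val, List.mem_filter, mem_merge, syndrome_val,
    decide_eq_true_eq] at hz
  obtain ⟨⟨x, -, y, -, hxy, rfl⟩, hz⟩ := hz
  refine ⟨hz, fun j hj => ?_⟩
  have := firstPositions_eq_iff.1 hxy j hj
  rw [castVec_add, Matrix.add_vecMul]
  simp only [Pi.sub_apply, Pi.add_apply] at this ⊢
  rw [← this]; ring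

theorem two_ne_zero_of_neg_one_ne (hF : (-1 : F) ≠ 1) : (2 : F) ≠ 0 := by
  intro h
  apply hF
  linear_combination -h

/-- Every output vector is a solution. -/
theorem sound (hF : (-1 : F) ≠ 1) {v : ℕ} {ε : ℕ → ℕ} {A : Matrix (Fin (h + h)) (Fin ℓ) F}
    {s : Fin ℓ → F} {e : Fin (h + h) → ℤ} (he : e ∈ (shiftedBCJ2 v ε A s).val) :
    (∀ j, e j = 1 ∨ e j = -1) ∧ (Finset.univ.filter fun j => e j = 1).card = v ∧
      syndromeOf A e = s := by
  rw [shiftedBCJ2] at he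
  simp only [bind_val, forEach_val, syndrome_val, pure_val, List.mem_map] at he
  obtain ⟨z, hz, rfl⟩ := he
  obtain ⟨hw, hs⟩ := wellFormed_of_mem_representationMerge hz
  -- On level 0 the number of entries -1 is `negs ε 0`, which is 0, so the filtered vector is
  -- binary.
  have hno : ∀ j, z j ≠ -1 := by
    intro j hj
    have := Finset.card_eq_zero.1 hw.2.2
    have hj' : j ∈ Finset.univ.filter fun j => z j = -1 := by simp [hj]
    rw [this] at hj'
    simp at hj'
  refine ⟨fun j => ?_, ?_, ?_⟩
  · have := hw.1 j
    have := hno j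
    change 2 * z j - 1 = 1 ∨ 2 * z j - 1 = -1
    omega
  · rw [← show _ = v from hw.2.1]
    congr 1
    ext j
    simp only [Finset.mem_filter, Finset.mem_univ, true_and]
    omega
  · have h2 := two_ne_zero_of_neg_one_ne hF
    have e1 : (fun j => ((2 * z j - 1 : ℤ) : F)) = (2 : F) • castVec F z - castVec F 1 := by
      funext j; simp [castVec]
    rw [syndromeOf, e1, Matrix.sub_vecMul, Matrix.smul_vecMul]
    funext j
    rw [Pi.sub_apply, Pi.smul_apply, hs j j.2, smul_eq_mul, mul_div_cancel₀ _ h2]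
    ring

/-- The shifted vector `(e + (1, …, 1)) / 2`. -/
def shifted (e : Fin (h + h) → ℤ) : Fin (h + h) → ℤ := fun j => (e j + 1) / 2

theorem two_mul_shifted_sub_one {e : Fin (h + h) → ℤ} (he : ∀ j, e j = 1 ∨ e j = -1) :
    (fun j => 2 * shifted e j - 1) = e := by
  funext j
  have := he j
  unfold shifted
  omega

/-- This supplies the vector τ for which the target of the algorithm is τA. Odd characteristic makes
the division by 2 meaningful. -/
theorem shifted_syndrome (hF : (-1 : F) ≠ 1) {e : Fin (h + h) → ℤ} (he : ∀ j, e j = 1 ∨ e j = -1)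
    (A : Matrix (Fin (h + h)) (Fin ℓ) F) :
    (fun j => (syndromeOf A e j + Matrix.vecMul (castVec F 1) A j) / 2) =
      Matrix.vecMul (castVec F (shifted e)) A := by
  have h2 := two_ne_zero_of_neg_one_ne hF
  have e1 : castVec F e = (2 : F) • castVec F (shifted e) - castVec F 1 := by
    conv_lhs => rw [← two_mul_shifted_sub_one he]
    funext j; simp [castVec]
  funext j
  change (Matrix.vecMul (castVec F e) A j + _) / 2 = _
  rw [e1, Matrix.sub_vecMul, Matrix.smul_vecMul]
  simp only [Pi.sub_apply, Pi.smul_apply, smul_eq_mul]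
  rw [sub_add_cancel, mul_div_cancel_left₀ _ h2]

theorem Vanish.mono {N : ℕ} {A : Matrix (Fin N) (Fin ℓ) F} {x : Fin N → F} {u u' : ℕ}
    (hx : Vanish A x u) (h : u' ≤ u) : Vanish A x u' := fun j hj => hx j (hj.trans_le h)

theorem Vanish.sub {N : ℕ} {A : Matrix (Fin N) (Fin ℓ) F} {x y : Fin N → F} {u : ℕ}
    (hx : Vanish A x u) (hy : Vanish A y u) : Vanish A (x - y) u := by
  intro j hj
  rw [Matrix.sub_vecMul, Pi.sub_apply, hx j hj, hy j hj, sub_zero]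

theorem vanish_zero {N : ℕ} {A : Matrix (Fin N) (Fin ℓ) F} {u : ℕ} : Vanish A 0 u := by
  intro j _
  rw [Matrix.zero_vecMul, Pi.zero_apply]

/-- Only one condition on the summands is needed. As u₁ ≤ u₀, the syndrome of x - y agrees with τA
on the first u₁ positions once x does so on u₀ positions and yA vanishes on u₁. -/
theorem mem_midVecs {A : Matrix (Fin (h + h)) (Fin ℓ) F} {u : ℕ → ℕ} {τ : Fin (h + h) → F}
    {o g : ℕ → ℕ} (hu : u 1 ≤ u 0) {x y : Fin (h + h) → ℤ} (hx : WellFormed (o 1) (g 1) x)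
    (hy : y ∈ balancedReps (o 2 / 2) (g 2 / 2) x) (hxA : Vanish A (castVec F x - τ) (u 0))
    (hyA : Vanish A (castVec F y) (u 1)) : x ∈ midVecs A u τ o g := by
  rw [balancedReps, Finset.mem_filter] at hy
  refine (mem_representationMerge ..).2 ⟨y, (mem_baseList ..).2 ⟨hy.1, by rwa [sub_zero]⟩, x - y,
    (mem_baseList ..).2 ⟨hy.2, ?_⟩, ?_, ?_, ?_⟩
  · rw [castVec_sub, sub_right_comm]
    exact (hxA.mono hu).sub hyA
  · rwa [castVec_sub, add_sub_cancel]
  · rwa [add_sub_cancel]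
  · rw [add_sub_cancel]

/-- Four base vectors are involved, but three conditions suffice: those for the second summands on
both levels follow by subtraction, and the last merge imposes nothing because the target is zA
itself. -/
theorem mem_finalVecs {A : Matrix (Fin (h + h)) (Fin ℓ) F} {u : ℕ → ℕ} {o g : ℕ → ℕ}
    (hu : u 1 ≤ u 0) {z x y₁ y₃ : Fin (h + h) → ℤ}
    (hz : WellFormed (o 0) (g 0) z) (hx : WellFormed (o 1) (g 1) x)
    (hzx : WellFormed (o 1) (g 1) (z - x)) (hy₁ : y₁ ∈ balancedReps (o 2 / 2) (g 2 / 2) x)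
    (hy₃ : y₃ ∈ balancedReps (o 2 / 2) (g 2 / 2) (z - x)) (hxA : Vanish A (castVec F x) (u 0))
    (hyA₁ : Vanish A (castVec F y₁) (u 1)) (hyA₃ : Vanish A (castVec F y₃) (u 1)) :
    z ∈ finalVecs A u (castVec F z) o g := by
  refine (mem_representationMerge ..).2 ⟨x, mem_midVecs hu hx hy₁ (by rwa [sub_zero]) hyA₁, z - x,
    mem_midVecs hu hzx hy₃ ?_ hyA₃, ?_, ?_, ?_⟩
  · rw [castVec_sub, sub_sub_cancel_left, ← zero_sub]
    exact vanish_zero.sub hxA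
  · rw [castVec_sub, add_sub_cancel, sub_self]
    exact vanish_zero
  · rwa [add_sub_cancel]
  · rw [add_sub_cancel]

end Lists

/-! ### The second moment method -/

section Success

variable {F : Type} [Field F] [Fintype F] [DecidableEq F] {N ℓ : ℕ}

/-- The second moment method: Cauchy–Schwarz applied to X = 1_{X > 0} · X, where X counts the
indices whose conditions all hold. -/
theorem sq_sum_prob_le {ι : Type*} (W : Finset ι) (cs : ι → List ((Fin N → F) × ℕ)) :
    (∑ w ∈ W, prob ℓ (cs w)) ^ 2 ≤
      ((Finset.univ.filter fun A : Matrix (Fin N) (Fin ℓ) F =>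
        ∃ w ∈ W, ∀ c ∈ cs w, Vanish A c.1 c.2).card : ℝ) /
          Fintype.card (Matrix (Fin N) (Fin ℓ) F) *
        ∑ w ∈ W, ∑ w' ∈ W, prob ℓ (cs w' ++ cs w) := by
  classical
  set X : Matrix (Fin N) (Fin ℓ) F → ℝ := fun A =>
    ∑ w ∈ W, if ∀ c ∈ cs w, Vanish A c.1 c.2 then 1 else 0 with hX
  set T : ℝ := ((Fintype.card (Matrix (Fin N) (Fin ℓ) F) : ℕ) : ℝ) with hT
  have hT0 : 0 < T := Nat.cast_pos.2 Fintype.card_pos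
  have h1 : ∑ w ∈ W, prob ℓ (cs w) = (∑ A, X A) / T := by
    rw [hX, Finset.sum_comm, Finset.sum_div]
    exact Finset.sum_congr rfl fun w _ => (sum_indicator_div _ _ fun A => Iff.rfl).symm
  have h2 : ∑ w ∈ W, ∑ w' ∈ W, prob ℓ (cs w' ++ cs w) = (∑ A, X A ^ 2) / T := by
    simp_rw [hX, sq, Finset.sum_mul_sum]
    symm
    rw [Finset.sum_comm, Finset.sum_div]
    refine Finset.sum_congr rfl fun w _ => ?_
    rw [Finset.sum_comm, Finset.sum_div]
    refine Finset.sum_congr rfl fun w' _ => ?_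
    rw [← sum_indicator_div (fun A => (∀ c ∈ cs w, Vanish A c.1 c.2) ∧
      (∀ c ∈ cs w', Vanish A c.1 c.2))]
    · simp only [ite_and, mul_ite, mul_one, mul_zero]
      congr 1
      refine Finset.sum_congr rfl fun A _ => ?_
      split_ifs <;> rfl
    · intro A
      simp only [List.mem_append]
      constructor
      · rintro ⟨h, h'⟩ c (hc | hc)
        exacts [h' c hc, h c hc]
      · exact fun h => ⟨fun c hc => h c (Or.inr hc), fun c hc => h c (Or.inl hc)⟩
  have h3 : ∑ A, X A = ∑ A, (if ∃ w ∈ W, ∀ c ∈ cs w, Vanish A c.1 c.2 then (1 : ℝ) else 0) * X A := by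
    refine Finset.sum_congr rfl fun A _ => ?_
    split_ifs with h
    · rw [one_mul]
    · rw [zero_mul, hX]
      push Not at h
      refine Finset.sum_eq_zero fun w hw => if_neg ?_
      push Not
      exact h w hw
  have h4 := Finset.sum_mul_sq_le_sq_mul_sq Finset.univ
    (fun A => if ∃ w ∈ W, ∀ c ∈ cs w, Vanish A c.1 c.2 then (1 : ℝ) else 0) X
  rw [← h3] at h4
  simp only [ite_pow, one_pow, ne_eq, OfNat.ofNat_ne_zero, not_false_eq_true, zero_pow,
    Finset.sum_boole] at h4
  rw [h1, h2, div_pow, div_mul_div_comm, ← sq]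
  gcongr

/-- The case of `sum_prob_cons_le` in which summing over all representations costs only a constant.
The hypothesis with u + 1 fits u = ⌊log_q r⌋, for which r < q^(u+1). -/
theorem sum_prob_cons_le_mul {ι : Type*} {u k : ℕ} (hu : u ≤ ℓ) {cs : List ((Fin N → F) × ℕ)}
    (hk : cs.length ≤ k) {I : Finset ι} {f : ι → Fin N → F} (hf : Set.InjOn f I)
    (hI : I.card ≤ Fintype.card F ^ (u + 1)) :
    ∑ i ∈ I, prob ℓ ((f i, u) :: cs) ≤
      prob ℓ cs * ((Fintype.card F : ℝ) + (Fintype.card F : ℝ) ^ k) := by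
  refine (sum_prob_cons_le hu cs I f hf).trans (mul_le_mul_of_nonneg_left ?_ (prob_nonneg cs))
  have hq := card_pos_real (F := F)
  refine add_le_add ?_ (pow_le_pow_right₀ one_lt_card_real.le hk)
  rw [div_le_iff₀ (by positivity), ← pow_succ']
  exact_mod_cast hI

/-- The entries 0, 1 and -1 stay distinct in a field with -1 ≠ 1. This gives the injectivity needed
for counting vectors in a span. -/
theorem castVec_injOn (hF : (-1 : F) ≠ 1) {s : Set (Fin N → ℤ)}
    (hs : ∀ x ∈ s, ∀ j, x j = 0 ∨ x j = 1 ∨ x j = -1) : Set.InjOn (castVec F) s := by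
  intro x hx y hy hxy
  funext j
  have hj : (x j : F) = y j := congrFun hxy j
  have h1 : (1 : F) ≠ -1 := hF.symm
  rcases hs x hx j with h | h | h <;> rcases hs y hy j with h' | h' | h' <;>
    rw [h, h'] at hj ⊢ <;> simp_all [eq_comm]

/-- If the number of representations is close to `q ^ u` on both levels, then some representation
of `z` satisfies the constraints on which the lists are merged with large probability. -/
theorem sq_card_le_mul_prob_exists (hF : (-1 : F) ≠ 1) {u₀ u₁ : ℕ} (hu₀ : u₀ ≤ ℓ) (hu₁ : u₁ ≤ ℓ)
    (z : Fin N → ℤ) (T₀ : Finset (Fin N → ℤ)) (T₁ : (Fin N → ℤ) → Finset (Fin N → ℤ))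
    (h₀ : ∀ x ∈ T₀, ∀ j, x j = 0 ∨ x j = 1 ∨ x j = -1)
    (h₁ : ∀ x, ∀ y ∈ T₁ x, ∀ j, y j = 0 ∨ y j = 1 ∨ y j = -1)
    (c₀ : T₀.card ≤ Fintype.card F ^ (u₀ + 1))
    (c₁ : ∀ x ∈ T₀, (T₁ x).card ≤ Fintype.card F ^ (u₁ + 1))
    (c₂ : ∀ x ∈ T₀, (T₁ (z - x)).card ≤ Fintype.card F ^ (u₁ + 1))
    {b₀ b₁ : ℕ} (l₀ : b₀ ≤ T₀.card) (l₁ : ∀ x ∈ T₀, b₁ ≤ (T₁ x).card)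
    (l₂ : ∀ x ∈ T₀, b₁ ≤ (T₁ (z - x)).card) :
    ((b₀ : ℝ) * b₁ ^ 2 / ((Fintype.card F : ℝ) ^ u₀ * ((Fintype.card F : ℝ) ^ u₁) ^ 2)) ^ 2 ≤
      ((Finset.univ.filter fun A : Matrix (Fin N) (Fin ℓ) F =>
        ∃ x ∈ T₀, ∃ y₁ ∈ T₁ x, ∃ y₃ ∈ T₁ (z - x), Vanish A (castVec F x) u₀ ∧
          Vanish A (castVec F y₁) u₁ ∧ Vanish A (castVec F y₃) u₁).card : ℝ) /
          Fintype.card (Matrix (Fin N) (Fin ℓ) F) *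
        ((Fintype.card F : ℝ) + (Fintype.card F : ℝ) ^ 5) ^ 6 := by
  have hq := card_pos_real (F := F)
  set q : ℝ := ((Fintype.card F : ℕ) : ℝ)
  set K : ℝ := q + q ^ 5 with hK
  have hK0 : 0 ≤ K := by positivity
  set W := T₀.sigma fun x => T₁ x ×ˢ T₁ (z - x) with hW
  set cs : (Σ _ : Fin N → ℤ, (Fin N → ℤ) × (Fin N → ℤ)) → List ((Fin N → F) × ℕ) := fun w =>
    [(castVec F w.2.2, u₁), (castVec F w.2.1, u₁), (castVec F w.1, u₀)] with hcs
  have key := sq_sum_prob_le (ℓ := ℓ) W cs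
  have hset : (Finset.univ.filter fun A : Matrix (Fin N) (Fin ℓ) F =>
        ∃ w ∈ W, ∀ c ∈ cs w, Vanish A c.1 c.2) = Finset.univ.filter fun A =>
        ∃ x ∈ T₀, ∃ y₁ ∈ T₁ x, ∃ y₃ ∈ T₁ (z - x), Vanish A (castVec F x) u₀ ∧
          Vanish A (castVec F y₁) u₁ ∧ Vanish A (castVec F y₃) u₁ := by
    ext A
    simp only [Finset.mem_filter, Finset.mem_univ, true_and, hW, hcs, Finset.mem_sigma,
      Finset.mem_product, List.forall_mem_cons, List.not_mem_nil, false_imp_iff, implies_true,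
      and_true]
    constructor
    · rintro ⟨⟨x, y₁, y₃⟩, ⟨hx, hy₁, hy₃⟩, a, b, c⟩
      exact ⟨x, hx, y₁, hy₁, y₃, hy₃, c, b, a⟩
    · rintro ⟨x, hx, y₁, hy₁, y₃, hy₃, c, b, a⟩
      exact ⟨⟨x, y₁, y₃⟩, ⟨hx, hy₁, hy₃⟩, a, b, c⟩
  rw [hset] at key
  -- Summing over one triple, one coordinate after the other, costs a factor K each time. At most
  -- five conditions are in force before a new one is added, three from `cs'` and two from the
  -- triple itself; hence the q^5 in K.
  have inner : ∀ cs' : List ((Fin N → F) × ℕ), cs'.length ≤ 3 →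
      ∑ w ∈ W, prob ℓ (cs w ++ cs') ≤ prob ℓ cs' * K ^ 3 := by
    intro cs' hlen
    have step : ∀ (u : ℕ) (_ : u ≤ ℓ) (I : Finset (Fin N → ℤ))
        (_ : ∀ x ∈ I, ∀ j, x j = 0 ∨ x j = 1 ∨ x j = -1)
        (_ : I.card ≤ Fintype.card F ^ (u + 1)) (cs'' : List ((Fin N → F) × ℕ)),
        cs''.length ≤ 5 → ∑ i ∈ I, prob ℓ ((castVec F i, u) :: cs'') ≤ prob ℓ cs'' * K :=
      fun u hu I hI hc cs'' hl => sum_prob_cons_le_mul hu hl (castVec_injOn hF hI) hc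
    calc ∑ w ∈ W, prob ℓ (cs w ++ cs')
        = ∑ x ∈ T₀, ∑ y₁ ∈ T₁ x, ∑ y₃ ∈ T₁ (z - x),
          prob ℓ ((castVec F y₃, u₁) :: (castVec F y₁, u₁) :: (castVec F x, u₀) :: cs') := by
          rw [hW, Finset.sum_sigma]
          exact Finset.sum_congr rfl fun x _ => Finset.sum_product ..
      _ ≤ ∑ x ∈ T₀, ∑ y₁ ∈ T₁ x,
          prob ℓ ((castVec F y₁, u₁) :: (castVec F x, u₀) :: cs') * K :=
          Finset.sum_le_sum fun x hx => Finset.sum_le_sum fun y₁ _ =>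
            step _ hu₁ _ (h₁ _) (c₂ x hx) _ (by simp; omega)
      _ ≤ ∑ x ∈ T₀, prob ℓ ((castVec F x, u₀) :: cs') * K * K := by
          refine Finset.sum_le_sum fun x hx => ?_
          rw [← Finset.sum_mul]
          exact mul_le_mul_of_nonneg_right (step _ hu₁ _ (h₁ _) (c₁ x hx) _ (by simp; omega)) hK0
      _ ≤ prob ℓ cs' * K * K * K := by
          rw [← Finset.sum_mul, ← Finset.sum_mul]
          refine mul_le_mul_of_nonneg_right (mul_le_mul_of_nonneg_right ?_ hK0) hK0
          exact step _ hu₀ _ h₀ c₀ _ (by omega)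
      _ = prob ℓ cs' * K ^ 3 := by ring
  -- Applying `inner` to w' with w fixed, and then to w with no further conditions, gives K^3 twice.
  have hsecond : ∑ w ∈ W, ∑ w' ∈ W, prob ℓ (cs w' ++ cs w) ≤ K ^ 6 := by
    calc ∑ w ∈ W, ∑ w' ∈ W, prob ℓ (cs w' ++ cs w) ≤ ∑ w ∈ W, prob ℓ (cs w) * K ^ 3 :=
          Finset.sum_le_sum fun w _ => inner _ (by simp [hcs])
      _ = (∑ w ∈ W, prob ℓ (cs w ++ [])) * K ^ 3 := by simp [Finset.sum_mul]
      _ ≤ (prob ℓ ([] : List ((Fin N → F) × ℕ)) * K ^ 3) * K ^ 3 :=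
          mul_le_mul_of_nonneg_right (inner [] (by simp)) (by positivity)
      _ = K ^ 6 := by rw [prob_nil]; ring
  have hfirst : (b₀ : ℝ) * b₁ ^ 2 / (q ^ u₀ * (q ^ u₁) ^ 2) ≤ ∑ w ∈ W, prob ℓ (cs w) := by
    have hp : ∀ w ∈ W, 1 / (q ^ u₀ * (q ^ u₁) ^ 2) ≤ prob ℓ (cs w) := by
      intro w _
      have e1 := prob_cons_ge hu₀ (castVec F w.1) []
      have e2 := prob_cons_ge hu₁ (castVec F w.2.1) [(castVec F w.1, u₀)]
      have e3 := prob_cons_ge hu₁ (castVec F w.2.2)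
        [(castVec F w.2.1, u₁), (castVec F w.1, u₀)]
      rw [prob_nil] at e1
      calc 1 / (q ^ u₀ * (q ^ u₁) ^ 2) = 1 / q ^ u₀ / q ^ u₁ / q ^ u₁ := by field_simp
        _ ≤ prob ℓ [(castVec F w.1, u₀)] / q ^ u₁ / q ^ u₁ := by gcongr
        _ ≤ prob ℓ [(castVec F w.2.1, u₁), (castVec F w.1, u₀)] / q ^ u₁ := by gcongr
        _ ≤ _ := e3
    have hc : b₀ * b₁ ^ 2 ≤ W.card := by
      rw [hW, Finset.card_sigma]
      calc b₀ * b₁ ^ 2 ≤ T₀.card * b₁ ^ 2 := Nat.mul_le_mul_right _ l₀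
        _ = T₀.card • b₁ ^ 2 := rfl
        _ ≤ _ := Finset.card_nsmul_le_sum _ _ _ fun x hx => by
            rw [Finset.card_product, sq]
            exact Nat.mul_le_mul (l₁ x hx) (l₂ x hx)
    calc (b₀ : ℝ) * b₁ ^ 2 / (q ^ u₀ * (q ^ u₁) ^ 2)
        = ((b₀ * b₁ ^ 2 : ℕ) : ℝ) * (1 / (q ^ u₀ * (q ^ u₁) ^ 2)) := by push_cast; ring
      _ ≤ (W.card : ℝ) * (1 / (q ^ u₀ * (q ^ u₁) ^ 2)) := by gcongr
      _ ≤ ∑ w ∈ W, prob ℓ (cs w) := by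
          rw [← nsmul_eq_mul]
          exact Finset.card_nsmul_le_sum _ _ _ hp
  calc ((b₀ : ℝ) * b₁ ^ 2 / (q ^ u₀ * (q ^ u₁) ^ 2)) ^ 2 ≤ (∑ w ∈ W, prob ℓ (cs w)) ^ 2 := by
        gcongr
    _ ≤ _ := key
    _ ≤ _ := by gcongr

end Success

end ShiftedBCJ

namespace ShiftedBCJ

open Counted

/-! ### Expected list sizes -/

section Cost

variable {F : Type} [Field F] [Fintype F] [DecidableEq F] {N h ℓ : ℕ}

/-- The mean of a real function of a uniformly random matrix. -/
noncomputable def mean (f : Matrix (Fin N) (Fin ℓ) F → ℝ) : ℝ :=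
  (∑ A, f A) / Fintype.card (Matrix (Fin N) (Fin ℓ) F)

theorem mean_sum {ι : Type*} (I : Finset ι) (f : ι → Matrix (Fin N) (Fin ℓ) F → ℝ) :
    mean (fun A => ∑ i ∈ I, f i A) = ∑ i ∈ I, mean (f i) := by
  simp only [mean]
  rw [Finset.sum_comm, Finset.sum_div]

theorem mean_add (f g : Matrix (Fin N) (Fin ℓ) F → ℝ) :
    mean (fun A => f A + g A) = mean f + mean g := by
  simp only [mean]
  rw [Finset.sum_add_distrib, add_div]

theorem mean_const_mul (c : ℝ) (f : Matrix (Fin N) (Fin ℓ) F → ℝ) :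
    mean (fun A => c * f A) = c * mean f := by
  simp only [mean]
  rw [← Finset.mul_sum, mul_div_assoc]

theorem mean_const (c : ℝ) : mean (fun _ : Matrix (Fin N) (Fin ℓ) F => c) = c := by
  have : (Fintype.card (Matrix (Fin N) (Fin ℓ) F) : ℝ) ≠ 0 := Nat.cast_ne_zero.2 Fintype.card_ne_zero
  simp only [mean]
  rw [Finset.sum_const, nsmul_eq_mul, Finset.card_univ, mul_div_cancel_left₀ _ this]

theorem mean_mono {f g : Matrix (Fin N) (Fin ℓ) F → ℝ} (hfg : ∀ A, f A ≤ g A) :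
    mean f ≤ mean g := by
  unfold mean
  gcongr
  exact hfg _

theorem mean_indicator (P : Matrix (Fin N) (Fin ℓ) F → Prop) [DecidablePred P]
    (cs : List ((Fin N → F) × ℕ)) (hP : ∀ A, P A ↔ ∀ c ∈ cs, Vanish A c.1 c.2) :
    mean (fun A => if P A then (1 : ℝ) else 0) = prob ℓ cs := sum_indicator_div P cs hP

theorem castVec_mem_entries {v m : ℕ} {x : Fin N → ℤ} (hx : x ∈ searchSpace N v m) :
    ∀ j, x j = 0 ∨ x j = 1 ∨ x j = -1 := (mem_searchSpace.1 hx).1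

theorem castVec_injOn_searchSpace (hF : (-1 : F) ≠ 1) (v m : ℕ) :
    Set.InjOn (castVec F) (searchSpace N v m : Set (Fin N → ℤ)) :=
  castVec_injOn hF fun _ hx => castVec_mem_entries hx

theorem castVec_injOn_balancedSpace (hF : (-1 : F) ≠ 1) (v m : ℕ) :
    Set.InjOn (castVec F) (balancedSpace h v m : Set (Fin (h + h) → ℤ)) :=
  (castVec_injOn_searchSpace hF _ _).mono (Finset.coe_subset.2 balancedSpace_subset)

section base

variable (τ : Fin (h + h) → F) (u v m : ℕ)

theorem mean_length_baseVecs :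
    mean (fun A : Matrix (Fin (h + h)) (Fin ℓ) F => ((baseVecs A u τ v m).length : ℝ)) =
      ∑ z ∈ balancedSpace h (v / 2) (m / 2), prob ℓ [(castVec F z - τ, u)] := by
  simp only [length_eq_sum, baseVecs, sum_baseList]
  rw [mean_sum]
  exact Finset.sum_congr rfl fun z _ => mean_indicator _ _ fun A => by simp

theorem mean_length_baseVecs_le (hF : (-1 : F) ≠ 1) (hu : u ≤ ℓ) :
    mean (fun A : Matrix (Fin (h + h)) (Fin ℓ) F => ((baseVecs A u τ v m).length : ℝ)) ≤
      (balancedSpace h (v / 2) (m / 2)).card / (Fintype.card F : ℝ) ^ u + 1 := by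
  rw [mean_length_baseVecs]
  refine (sum_prob_cons_le hu [] _ (fun z => castVec F z - τ) ?_).trans_eq ?_
  · exact fun x hx y hy hxy => castVec_injOn_balancedSpace hF _ _ hx hy (sub_left_injective hxy)
  · rw [prob_nil]; simp

theorem le_mean_length_baseVecs (hu : u ≤ ℓ) :
    (balancedSpace h (v / 2) (m / 2)).card / (Fintype.card F : ℝ) ^ u ≤
      mean (fun A : Matrix (Fin (h + h)) (Fin ℓ) F => ((baseVecs A u τ v m).length : ℝ)) := by
  rw [mean_length_baseVecs, div_eq_mul_one_div, ← nsmul_eq_mul]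
  refine Finset.card_nsmul_le_sum _ _ _ fun z _ => ?_
  have := prob_cons_ge hu (castVec F z - τ) []
  rwa [prob_nil] at this

end base

section mid

variable (τ : Fin (h + h) → F) (v m : ℕ) {u₀ u₁ : ℕ}

/-- The condition on y alone follows from the other two, because u₁ ≤ u₀. Leaving it out is
essential for the upper bound, which needs independent conditions. -/
theorem mean_collisions_baseVecs (hu : u₁ ≤ u₀) :
    mean (fun A : Matrix (Fin (h + h)) (Fin ℓ) F =>
      collisions A u₀ τ (baseVecs A u₁ 0 v m) (baseVecs A u₁ τ v m)) =
      ∑ x ∈ balancedSpace h (v / 2) (m / 2), ∑ y ∈ balancedSpace h (v / 2) (m / 2),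
        prob ℓ [(castVec F x + castVec F y - τ, u₀), (castVec F x, u₁)] := by
  simp only [collisions, baseVecs, sum_baseList, sub_zero]
  rw [mean_sum]
  refine Finset.sum_congr rfl fun x _ => ?_
  have : ∀ A : Matrix (Fin (h + h)) (Fin ℓ) F, (if Vanish A (castVec F x) u₁ then
      ∑ y ∈ balancedSpace h (v / 2) (m / 2), (if Vanish A (castVec F y - τ) u₁ then
        (if Vanish A (castVec F x + castVec F y - τ) u₀ then (1 : ℝ) else 0) else 0) else 0) =
      ∑ y ∈ balancedSpace h (v / 2) (m / 2), (if Vanish A (castVec F x) u₁ ∧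
        Vanish A (castVec F y - τ) u₁ ∧ Vanish A (castVec F x + castVec F y - τ) u₀ then
          (1 : ℝ) else 0) := by
    intro A
    split_ifs with hx
    · simp [hx, ite_and]
    · simp [hx]
  simp only [this]
  rw [mean_sum]
  refine Finset.sum_congr rfl fun y _ => mean_indicator _ _ fun A => ?_
  simp only [List.forall_mem_cons, List.not_mem_nil, false_imp_iff, implies_true, and_true]
  constructor
  · exact fun hA => ⟨hA.2.2, hA.1⟩
  · refine fun hA => ⟨hA.2, ?_, hA.1⟩
    have := (hA.1.mono hu).sub hA.2
    rwa [add_sub_assoc, add_sub_cancel_left] at this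

/-- The additive terms 1 and q are the sizes of the span of no vector and of one vector, as in
`sum_prob_cons_le`. -/
theorem mean_collisions_baseVecs_le (hF : (-1 : F) ≠ 1) (hu : u₁ ≤ u₀) (hu₀ : u₀ ≤ ℓ) :
    mean (fun A : Matrix (Fin (h + h)) (Fin ℓ) F =>
      collisions A u₀ τ (baseVecs A u₁ 0 v m) (baseVecs A u₁ τ v m)) ≤
      ((balancedSpace h (v / 2) (m / 2)).card / (Fintype.card F : ℝ) ^ u₁ + 1) *
        ((balancedSpace h (v / 2) (m / 2)).card / (Fintype.card F : ℝ) ^ u₀ +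
          Fintype.card F) := by
  rw [mean_collisions_baseVecs τ v m hu]
  have hinj := castVec_injOn_balancedSpace (h := h) hF (v / 2) (m / 2)
  have h1 := sum_prob_cons_le (ℓ := ℓ) (hu.trans hu₀) [] _ _ hinj
  simp only [prob_nil, one_mul, List.length_nil, pow_zero] at h1
  refine le_trans ?_ (mul_le_mul_of_nonneg_right h1 (by positivity))
  rw [Finset.sum_mul]
  refine Finset.sum_le_sum fun x _ => ?_
  refine (sum_prob_cons_le hu₀ [(castVec F x, u₁)] _
    (fun y => castVec F x + castVec F y - τ) ?_).trans_eq ?_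
  · exact fun y hy y' hy' hyy' => hinj hy hy' (add_right_injective _ (sub_left_injective hyy'))
  · simp

theorem le_mean_collisions_baseVecs (hu : u₁ ≤ u₀) (hu₀ : u₀ ≤ ℓ) :
    ((balancedSpace h (v / 2) (m / 2)).card : ℝ) ^ 2 /
      ((Fintype.card F : ℝ) ^ u₁ * (Fintype.card F : ℝ) ^ u₀) ≤
    mean (fun A : Matrix (Fin (h + h)) (Fin ℓ) F =>
      collisions A u₀ τ (baseVecs A u₁ 0 v m) (baseVecs A u₁ τ v m)) := by
  have hq := card_pos_real (F := F)
  rw [mean_collisions_baseVecs τ v m hu, sq, div_eq_mul_one_div, mul_assoc, ← nsmul_eq_mul]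
  refine Finset.card_nsmul_le_sum _ _ _ fun x _ => ?_
  rw [← nsmul_eq_mul]
  refine Finset.card_nsmul_le_sum _ _ _ fun y _ => ?_
  have e1 := prob_cons_ge (hu.trans hu₀) (castVec F x) []
  have e2 := prob_cons_ge hu₀ (castVec F x + castVec F y - τ) [(castVec F x, u₁)]
  rw [prob_nil] at e1
  refine le_trans ?_ e2
  rw [← div_div]
  gcongr

end mid

/-- Pairs with sum in D are reindexed by the sum and the first summand. In this way a merged list
becomes a sum over vectors together with their representations. -/
theorem sum_pairs_eq {G : Type*} [AddCommGroup G] [DecidableEq G] (B D : Finset G)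
    (f : G → G → ℝ) :
    ∑ x ∈ B, ∑ y ∈ B, (if x + y ∈ D then f x (x + y) else 0) =
      ∑ z ∈ D, ∑ x ∈ B.filter fun x => z - x ∈ B, f x z := by
  simp_rw [Finset.sum_filter]
  rw [Finset.sum_comm (s := D)]
  refine Finset.sum_congr rfl fun x _ => ?_
  rw [← Finset.sum_filter, ← Finset.sum_filter]
  refine Finset.sum_bij' (fun y _ => x + y) (fun z _ => z - x) ?_ ?_ ?_ ?_ ?_
  · intro y hy
    simp only [Finset.mem_filter, add_sub_cancel_left] at hy ⊢
    exact hy.symm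
  · intro z hz
    simp only [Finset.mem_filter, add_sub_cancel] at hz ⊢
    exact hz.symm
  · intro y _; simp
  · intro z _; simp
  · intro y _; rfl

section final

variable (A : Matrix (Fin (h + h)) (Fin ℓ) F) {u : ℕ → ℕ} (τ : Fin (h + h) → F) (o g : ℕ → ℕ)

/-- A vector x occurs in the list once for each balanced representation whose first summand y passes
the base merge; the second summand then passes automatically. -/
theorem sum_midVecs (hu : u 1 ≤ u 0) (f : (Fin (h + h) → ℤ) → ℝ) :
    ((midVecs A u τ o g).map f).sum =
      ∑ x ∈ searchSpace (h + h) (o 1) (g 1), ∑ y ∈ balancedReps (o 2 / 2) (g 2 / 2) x,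
        if Vanish A (castVec F y) (u 1) ∧ Vanish A (castVec F x - τ) (u 0) then f x else 0 := by
  unfold balancedReps
  rw [← sum_pairs_eq (balancedSpace h (o 2 / 2) (g 2 / 2)) (searchSpace (h + h) (o 1) (g 1))
    (fun y x => if Vanish A (castVec F y) (u 1) ∧ Vanish A (castVec F x - τ) (u 0) then f x
      else 0)]
  simp only [midVecs, sum_representationMerge, baseVecs, sum_baseList, sub_zero]
  refine Finset.sum_congr rfl fun x _ => ?_
  simp only [castVec_add, mem_searchSpace]
  split_ifs with hx
  · refine Finset.sum_congr rfl fun y _ => ?_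
    by_cases hxy : Vanish A (castVec F x + castVec F y - τ) (u 0)
    · have : Vanish A (castVec F y - τ) (u 1) := by
        have := (hxy.mono hu).sub hx
        rwa [add_sub_assoc, add_sub_cancel_left] at this
      simp [hxy, this, hx]
    · simp [hxy]
  · simp [hx]

/-- Of the five conditions on (x, y, x', y'), the one on x' follows from those on x and on x + x'.
The order of the remaining four is the order in which the sums are later evaluated, from the head of
the list to its end. -/
theorem mean_collisions_midVecs (hu : u 1 ≤ u 0) (hu₀ : u 0 ≤ ℓ) :
    mean (fun A : Matrix (Fin (h + h)) (Fin ℓ) F =>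
      collisions A ℓ τ (midVecs A u 0 o g) (midVecs A u τ o g)) =
      ∑ x ∈ searchSpace (h + h) (o 1) (g 1), ∑ y ∈ balancedReps (o 2 / 2) (g 2 / 2) x,
      ∑ x' ∈ searchSpace (h + h) (o 1) (g 1), ∑ y' ∈ balancedReps (o 2 / 2) (g 2 / 2) x',
        prob ℓ [(castVec F y', u 1), (castVec F x + castVec F x' - τ, ℓ), (castVec F y, u 1),
          (castVec F x, u 0)] := by
  simp only [collisions, sum_midVecs _ _ _ _ hu, sub_zero]
  have : ∀ (A : Matrix (Fin (h + h)) (Fin ℓ) F) (x y : Fin (h + h) → ℤ),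
      (if Vanish A (castVec F y) (u 1) ∧ Vanish A (castVec F x) (u 0) then
        ∑ x' ∈ searchSpace (h + h) (o 1) (g 1), ∑ y' ∈ balancedReps (o 2 / 2) (g 2 / 2) x',
        (if Vanish A (castVec F y') (u 1) ∧ Vanish A (castVec F x' - τ) (u 0) then
          (if Vanish A (castVec F x + castVec F x' - τ) ℓ then (1 : ℝ) else 0) else 0) else 0) =
      ∑ x' ∈ searchSpace (h + h) (o 1) (g 1), ∑ y' ∈ balancedReps (o 2 / 2) (g 2 / 2) x',
        if (Vanish A (castVec F y) (u 1) ∧ Vanish A (castVec F x) (u 0)) ∧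
          (Vanish A (castVec F y') (u 1) ∧ Vanish A (castVec F x' - τ) (u 0)) ∧
          Vanish A (castVec F x + castVec F x' - τ) ℓ then (1 : ℝ) else 0 := by
    intro A x y
    by_cases hxy : Vanish A (castVec F y) (u 1) ∧ Vanish A (castVec F x) (u 0)
    · rw [if_pos hxy]
      simp only [hxy, and_self, true_and, ite_and]
    · simp only [hxy, false_and, if_false, Finset.sum_const_zero]
  simp only [this, mean_sum]
  refine Finset.sum_congr rfl fun x _ => Finset.sum_congr rfl fun y _ =>
    Finset.sum_congr rfl fun x' _ => Finset.sum_congr rfl fun y' _ =>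
    mean_indicator _ _ fun A => ?_
  simp only [List.forall_mem_cons, List.not_mem_nil, false_imp_iff, implies_true, and_true]
  constructor
  · rintro ⟨⟨a, b⟩, ⟨c, -⟩, d⟩
    exact ⟨c, d, a, b⟩
  · rintro ⟨c, d, a, b⟩
    refine ⟨⟨a, b⟩, ⟨c, ?_⟩, d⟩
    have := (d.mono hu₀).sub b
    rwa [add_sub_assoc, add_sub_cancel_left] at this

/-- The sums over y and y' cost only a constant K each, since q^(u₁) nearly equals the number of
representations. Those over x and x' give the main terms, with q^2 for the span of the two vectors x
and y that precede x'. -/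
theorem mean_collisions_midVecs_le (hF : (-1 : F) ≠ 1) (hu : u 1 ≤ u 0) (hu₀ : u 0 ≤ ℓ)
    (hr : ∀ x ∈ searchSpace (h + h) (o 1) (g 1),
      (balancedReps (o 2 / 2) (g 2 / 2) x).card ≤ Fintype.card F ^ (u 1 + 1)) :
    mean (fun A : Matrix (Fin (h + h)) (Fin ℓ) F =>
      collisions A ℓ τ (midVecs A u 0 o g) (midVecs A u τ o g)) ≤
      ((searchSpace (h + h) (o 1) (g 1)).card / (Fintype.card F : ℝ) ^ u 0 + 1) *
      (((searchSpace (h + h) (o 1) (g 1)).card / (Fintype.card F : ℝ) ^ ℓ +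
        (Fintype.card F : ℝ) ^ 2) *
        ((Fintype.card F : ℝ) + (Fintype.card F : ℝ) ^ 3) ^ 2) := by
  rw [mean_collisions_midVecs τ o g hu hu₀]
  set D := searchSpace (h + h) (o 1) (g 1)
  set Q : ℝ := ((Fintype.card F : ℕ) : ℝ)
  have hQ : 0 < Q := card_pos_real (F := F)
  set K : ℝ := Q + Q ^ 3
  have hK : 0 ≤ K := by positivity
  have hinj := castVec_injOn_searchSpace (F := F) (N := h + h) hF (o 1) (g 1)
  have hinj' : ∀ x, Set.InjOn (castVec F)
      (balancedReps (h := h) (o 2 / 2) (g 2 / 2) x : Set (Fin (h + h) → ℤ)) := fun x =>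
    (castVec_injOn_balancedSpace hF _ _).mono (Finset.coe_subset.2 (Finset.filter_subset _ _))
  have h1 := sum_prob_cons_le (ℓ := ℓ) hu₀ [] D _ hinj
  simp only [prob_nil, one_mul, List.length_nil, pow_zero] at h1
  refine le_trans ?_ (mul_le_mul_of_nonneg_right h1 (by positivity))
  rw [Finset.sum_mul]
  refine Finset.sum_le_sum fun x hx => ?_
  calc _ ≤ ∑ y ∈ balancedReps (o 2 / 2) (g 2 / 2) x, ∑ x' ∈ D,
        prob ℓ [(castVec F x + castVec F x' - τ, ℓ), (castVec F y, u 1), (castVec F x, u 0)] *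
          K := Finset.sum_le_sum fun y _ => Finset.sum_le_sum fun x' hx' =>
            sum_prob_cons_le_mul (hu.trans hu₀) (by simp) (hinj' x') (hr x' hx')
    _ ≤ ∑ y ∈ balancedReps (o 2 / 2) (g 2 / 2) x,
        prob ℓ [(castVec F y, u 1), (castVec F x, u 0)] * (D.card / Q ^ ℓ + Q ^ 2) * K := by
          refine Finset.sum_le_sum fun y _ => ?_
          rw [← Finset.sum_mul]
          refine mul_le_mul_of_nonneg_right ?_ hK
          refine sum_prob_cons_le le_rfl [(castVec F y, u 1), (castVec F x, u 0)] D
            (fun x' => castVec F x + castVec F x' - τ) ?_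
          exact fun y hy y' hy' hyy' =>
            hinj hy hy' (add_right_injective _ (sub_left_injective hyy'))
    _ ≤ prob ℓ [(castVec F x, u 0)] * K * (D.card / Q ^ ℓ + Q ^ 2) * K := by
          rw [← Finset.sum_mul, ← Finset.sum_mul]
          refine mul_le_mul_of_nonneg_right (mul_le_mul_of_nonneg_right ?_ (by positivity)) hK
          exact sum_prob_cons_le_mul (hu.trans hu₀) (by simp) (hinj' x) (hr x hx)
    _ = _ := by ring

/-- The subset B leaves room for restricting to balanced vectors, which are the ones known to have
many balanced representations. -/
theorem le_mean_collisions_midVecs (hu : u 1 ≤ u 0) (hu₀ : u 0 ≤ ℓ) {B : Finset (Fin (h + h) → ℤ)}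
    (hB : B ⊆ searchSpace (h + h) (o 1) (g 1)) {b : ℕ}
    (hb : ∀ x ∈ B, b ≤ (balancedReps (o 2 / 2) (g 2 / 2) x).card) :
    ((B.card : ℝ) * b) ^ 2 / ((Fintype.card F : ℝ) ^ u 0 * ((Fintype.card F : ℝ) ^ u 1) ^ 2 *
      (Fintype.card F : ℝ) ^ ℓ) ≤
    mean (fun A : Matrix (Fin (h + h)) (Fin ℓ) F =>
      collisions A ℓ τ (midVecs A u 0 o g) (midVecs A u τ o g)) := by
  rw [mean_collisions_midVecs τ o g hu hu₀]
  set D := searchSpace (h + h) (o 1) (g 1)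
  set Q : ℝ := ((Fintype.card F : ℕ) : ℝ)
  have hQ : 0 < Q := card_pos_real (F := F)
  set P : ℝ := 1 / (Q ^ u 0 * (Q ^ u 1) ^ 2 * Q ^ ℓ) with hP
  have hP0 : 0 ≤ P := by positivity
  have aux : ∀ (c : ℝ) (f : (Fin (h + h) → ℤ) → (Fin (h + h) → ℤ) → ℝ), 0 ≤ c →
      (∀ x y, c ≤ f x y) →
      B.card * (b * c) ≤ ∑ x ∈ D, ∑ y ∈ balancedReps (o 2 / 2) (g 2 / 2) x, f x y := by
    intro c f hc hf
    have : ∀ x ∈ B, b * c ≤ ∑ y ∈ balancedReps (o 2 / 2) (g 2 / 2) x, f x y := by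
      intro x hx
      calc (b : ℝ) * c ≤ (balancedReps (o 2 / 2) (g 2 / 2) x).card * c := by
            gcongr; exact hb x hx
        _ ≤ _ := by
            rw [← nsmul_eq_mul]
            exact Finset.card_nsmul_le_sum _ _ _ fun y _ => hf x y
    calc (B.card : ℝ) * (b * c) ≤ ∑ x ∈ B, ∑ y ∈ balancedReps (o 2 / 2) (g 2 / 2) x, f x y := by
          rw [← nsmul_eq_mul]
          exact Finset.card_nsmul_le_sum _ _ _ this
      _ ≤ _ := Finset.sum_le_sum_of_subset_of_nonneg hB fun x _ _ =>
          Finset.sum_nonneg fun y _ => hc.trans (hf x y)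
  calc ((B.card : ℝ) * b) ^ 2 / (Q ^ u 0 * (Q ^ u 1) ^ 2 * Q ^ ℓ)
      = B.card * (b * (B.card * (b * P))) := by rw [hP]; ring
    _ ≤ _ := by
      refine aux _ _ (by positivity) fun x y => aux _ _ hP0 fun x' y' => ?_
      have e1 := prob_cons_ge hu₀ (castVec F x) []
      have e2 := prob_cons_ge (hu.trans hu₀) (castVec F y) [(castVec F x, u 0)]
      have e3 := prob_cons_ge (le_refl ℓ) (castVec F x + castVec F x' - τ)
        [(castVec F y, u 1), (castVec F x, u 0)]
      have e4 := prob_cons_ge (hu.trans hu₀) (castVec F y')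
        [(castVec F x + castVec F x' - τ, ℓ), (castVec F y, u 1), (castVec F x, u 0)]
      rw [prob_nil] at e1
      calc P = 1 / Q ^ u 0 / Q ^ u 1 / Q ^ ℓ / Q ^ u 1 := by rw [hP]; field_simp
        _ ≤ prob ℓ [(castVec F x, u 0)] / Q ^ u 1 / Q ^ ℓ / Q ^ u 1 := by gcongr
        _ ≤ prob ℓ [(castVec F y, u 1), (castVec F x, u 0)] / Q ^ ℓ / Q ^ u 1 := by gcongr
        _ ≤ prob ℓ [(castVec F x + castVec F x' - τ, ℓ), (castVec F y, u 1),
            (castVec F x, u 0)] / Q ^ u 1 := by gcongr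
        _ ≤ _ := e4

end final

end Cost

end ShiftedBCJ

namespace ShiftedBCJ

open Counted

/-! ### Expected number of steps -/

section Steps

variable {F : Type} [Field F] [Fintype F] [DecidableEq F] {h ℓ : ℕ}

theorem collisions_nonneg {N : ℕ} (A : Matrix (Fin N) (Fin ℓ) F) (u : ℕ) (τ : Fin N → F)
    (L₁ L₂ : List (Fin N → ℤ)) : 0 ≤ collisions A u τ L₁ L₂ := by
  refine le_trans (Nat.cast_nonneg _) (length_representationMerge_le A u τ 0 0 L₁ L₂)

section bounds

variable {v : ℕ} {ε : ℕ → ℕ} {A : Matrix (Fin (h + h)) (Fin ℓ) F} {s : Fin ℓ → F}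
  {τ : Fin (h + h) → F}
  (hτ : (fun j => (s j + Matrix.vecMul (castVec F 1) A j) / 2) = Matrix.vecMul τ A)
  {u o g : ℕ → ℕ} (hu : u = mergeLength (Fintype.card F) (h + h) v ε) (ho : o = ones v ε)
  (hg : g = negs ε)

include hτ hu ho hg

theorem steps_eq :
    ((shiftedBCJ2 v ε A s).steps : ℝ) = ((h + h : ℕ) : ℝ) * ℓ + 2 * ℓ +
      4 * (enumerate h (o 2 / 2) (g 2 / 2)).steps +
      4 * (searchSpace h (o 2 / 2) (g 2 / 2)).card * (((h + h : ℕ) : ℝ) * ℓ + (ℓ + 1)) +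
      ((baseVecs A (u 1) 0 (o 2) (g 2)).length + (baseVecs A (u 1) τ (o 2) (g 2)).length) *
        (((h + h : ℕ) : ℝ) + 1) +
      (3 * (baseVecs A (u 1) 0 (o 2) (g 2)).length + (baseVecs A (u 1) τ (o 2) (g 2)).length) *
        (((h + h : ℕ) : ℝ) * ℓ + (ℓ + 1)) +
      2 * (((h + h : ℕ) : ℝ) + 1) * (collisions A (u 0) 0 (baseVecs A (u 1) 0 (o 2) (g 2))
        (baseVecs A (u 1) 0 (o 2) (g 2)) + collisions A (u 0) τ (baseVecs A (u 1) 0 (o 2) (g 2))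
        (baseVecs A (u 1) τ (o 2) (g 2)) + collisions A ℓ τ (midVecs A u 0 o g)
        (midVecs A u τ o g)) +
      ((midVecs A u 0 o g).length + (midVecs A u τ o g).length) *
        (((h + h : ℕ) : ℝ) * ℓ + (ℓ + 1)) +
      (finalVecs A u τ o g).length * (((h + h : ℕ) : ℝ) + 1) := by
  rw [shiftedBCJ2_steps v ε A s τ hτ hu ho hg]
  have hb : ∀ τ', (baseList A (u 1) (Matrix.vecMul τ' A) (o 2) (g 2)).val =
    baseVecs A (u 1) τ' (o 2) (g 2) := fun _ => rfl
  rw [baseList_steps, baseList_steps, hb, hb]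
  push_cast [representationMerge_steps]
  ring

theorem le_steps :
    ((searchSpace h (o 2 / 2) (g 2 / 2)).card : ℝ) ≤ (shiftedBCJ2 v ε A s).steps ∧
    ((baseVecs A (u 1) 0 (o 2) (g 2)).length : ℝ) ≤ (shiftedBCJ2 v ε A s).steps ∧
    collisions A (u 0) 0 (baseVecs A (u 1) 0 (o 2) (g 2)) (baseVecs A (u 1) 0 (o 2) (g 2)) ≤
      (shiftedBCJ2 v ε A s).steps ∧
    collisions A ℓ τ (midVecs A u 0 o g) (midVecs A u τ o g) ≤ (shiftedBCJ2 v ε A s).steps := by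
  rw [steps_eq hτ hu ho hg]
  have c1 := collisions_nonneg A (u 0) 0 (baseVecs A (u 1) 0 (o 2) (g 2))
    (baseVecs A (u 1) 0 (o 2) (g 2))
  have c2 := collisions_nonneg A (u 0) τ (baseVecs A (u 1) 0 (o 2) (g 2))
    (baseVecs A (u 1) τ (o 2) (g 2))
  have c3 := collisions_nonneg A ℓ τ (midVecs A u 0 o g) (midVecs A u τ o g)
  generalize collisions A (u 0) 0 _ _ = x1 at *
  generalize collisions A (u 0) τ _ _ = x2 at *
  generalize collisions A ℓ τ _ _ = x3 at *
  generalize (searchSpace h (o 2 / 2) (g 2 / 2)).card = x4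
  generalize (baseVecs A (u 1) 0 (o 2) (g 2)).length = x5
  generalize (baseVecs A (u 1) τ (o 2) (g 2)).length = x6
  have hN0 : (0 : ℝ) ≤ ((h + h : ℕ) : ℝ) := Nat.cast_nonneg _
  generalize ((h + h : ℕ) : ℝ) = N at *
  set p := N * ℓ + (ℓ + 1) with hp
  have hNl : 0 ≤ N * ℓ + 2 * ℓ := by positivity
  have hP : (1 : ℝ) ≤ p := by
    have : (0 : ℝ) ≤ N * ℓ + ℓ := by positivity
    linarith
  have hN : (1 : ℝ) ≤ N + 1 := by linarith
  have k4 := le_mul_of_one_le_right (Nat.cast_nonneg (α := ℝ) x4) hP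
  have k5 := le_mul_of_one_le_right (Nat.cast_nonneg (α := ℝ) x5) hP
  have k6 := le_mul_of_one_le_right (Nat.cast_nonneg (α := ℝ) x6) hP
  have k1 := le_mul_of_one_le_left c1 hN
  have k2 := le_mul_of_one_le_left c2 hN
  have k3 := le_mul_of_one_le_left c3 hN
  have n4 : (0 : ℝ) ≤ x4 := Nat.cast_nonneg _
  have n5 : (0 : ℝ) ≤ x5 := Nat.cast_nonneg _
  have n6 : (0 : ℝ) ≤ x6 := Nat.cast_nonneg _
  have r1 : (0 : ℝ) ≤ (enumerate h (o 2 / 2) (g 2 / 2)).steps := Nat.cast_nonneg _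
  have r2 : 0 ≤ ((x5 : ℝ) + x6) * (N + 1) := by positivity
  have r3 : 0 ≤ (((midVecs A u 0 o g).length : ℝ) + (midVecs A u τ o g).length) * p := by
    positivity
  have r4 : 0 ≤ ((finalVecs A u τ o g).length : ℝ) * (N + 1) := by positivity
  refine ⟨?_, ?_, ?_, ?_⟩ <;> linarith

/-- List lengths after filtering are bounded by collisions, and every unit cost by the polynomial
factor p. The constant comes from the half vectors: 2 for the initial steps, 8 for four enumerations
and 4 for their keys and table accesses. -/
theorem steps_le (hH : 1 ≤ (searchSpace h (o 2 / 2) (g 2 / 2)).card) :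
    ((shiftedBCJ2 v ε A s).steps : ℝ) ≤ 14 * ((((h + h : ℕ) : ℝ) + 1) * (ℓ + 1)) *
      ((searchSpace h (o 2 / 2) (g 2 / 2)).card +
        ((baseVecs A (u 1) 0 (o 2) (g 2)).length + (baseVecs A (u 1) τ (o 2) (g 2)).length) +
        (collisions A (u 0) 0 (baseVecs A (u 1) 0 (o 2) (g 2))
          (baseVecs A (u 1) 0 (o 2) (g 2)) + collisions A (u 0) τ (baseVecs A (u 1) 0 (o 2) (g 2))
          (baseVecs A (u 1) τ (o 2) (g 2))) + collisions A ℓ τ (midVecs A u 0 o g)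
          (midVecs A u τ o g)) := by
  rw [steps_eq hτ hu ho hg]
  have c1 := length_representationMerge_le A (u 0) 0 (o 1) (g 1)
    (baseVecs A (u 1) 0 (o 2) (g 2)) (baseVecs A (u 1) 0 (o 2) (g 2))
  have c2 := length_representationMerge_le A (u 0) τ (o 1) (g 1)
    (baseVecs A (u 1) 0 (o 2) (g 2)) (baseVecs A (u 1) τ (o 2) (g 2))
  have c3 := length_representationMerge_le A ℓ τ (o 0) (g 0) (midVecs A u 0 o g)
    (midVecs A u τ o g)
  change ((midVecs A u 0 o g).length : ℝ) ≤ _ at c1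
  change ((midVecs A u τ o g).length : ℝ) ≤ _ at c2
  change ((finalVecs A u τ o g).length : ℝ) ≤ _ at c3
  have hE : ((enumerate h (o 2 / 2) (g 2 / 2)).steps : ℝ) ≤
      1 + 4 * h * (searchSpace h (o 2 / 2) (g 2 / 2)).card :=
    mod_cast enumerate_steps_le h (o 2 / 2) (g 2 / 2)
  generalize collisions A (u 0) 0 _ _ = x1 at *
  generalize collisions A (u 0) τ _ _ = x2 at *
  generalize collisions A ℓ τ _ _ = x3 at *
  have hH' : (1 : ℝ) ≤ (searchSpace h (o 2 / 2) (g 2 / 2)).card := mod_cast hH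
  generalize ((searchSpace h (o 2 / 2) (g 2 / 2)).card : ℝ) = x4 at *
  have b5 : (0 : ℝ) ≤ (baseVecs A (u 1) 0 (o 2) (g 2)).length := Nat.cast_nonneg _
  have b6 : (0 : ℝ) ≤ (baseVecs A (u 1) τ (o 2) (g 2)).length := Nat.cast_nonneg _
  have b7 : (0 : ℝ) ≤ (midVecs A u 0 o g).length := Nat.cast_nonneg _
  have b8 : (0 : ℝ) ≤ (midVecs A u τ o g).length := Nat.cast_nonneg _
  have b9 : (0 : ℝ) ≤ (finalVecs A u τ o g).length := Nat.cast_nonneg _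
  generalize ((baseVecs A (u 1) 0 (o 2) (g 2)).length : ℝ) = x5 at *
  generalize ((baseVecs A (u 1) τ (o 2) (g 2)).length : ℝ) = x6 at *
  generalize ((midVecs A u 0 o g).length : ℝ) = x7 at *
  generalize ((midVecs A u τ o g).length : ℝ) = x8 at *
  generalize ((finalVecs A u τ o g).length : ℝ) = x9 at *
  generalize ((enumerate h (o 2 / 2) (g 2 / 2)).steps : ℝ) = x0 at *
  push_cast
  have hh : (0 : ℝ) ≤ h := Nat.cast_nonneg _
  have hl : (0 : ℝ) ≤ ℓ := Nat.cast_nonneg _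
  set p : ℝ := ((h : ℝ) + h + 1) * (ℓ + 1) with hp
  have hhl : 0 ≤ (h : ℝ) * ℓ := by positivity
  have p1 : ((h : ℝ) + h) * ℓ + (ℓ + 1) ≤ p := by rw [hp]; linarith
  have p2 : (h : ℝ) + h + 1 ≤ p := by rw [hp]; linarith
  have p3 : ((h : ℝ) + h) * ℓ + 2 * ℓ ≤ 2 * p := by rw [hp]; linarith
  have p0 : 0 ≤ p := by positivity
  have e1 : x0 ≤ 2 * p * x4 := by
    have : (1 + 4 * h) * x4 ≤ 2 * p * x4 := mul_le_mul_of_nonneg_right (by linarith) (by linarith)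
    linarith
  have e2 : 2 * p ≤ 2 * p * x4 := le_mul_of_one_le_right (by linarith) hH'
  have e3 := mul_le_mul_of_nonneg_left p1 (show 0 ≤ 4 * x4 by linarith)
  have e4 := mul_le_mul_of_nonneg_left p2 (show 0 ≤ x5 + x6 by linarith)
  have e5 := mul_le_mul_of_nonneg_left p1 (show 0 ≤ 3 * x5 + x6 by linarith)
  have e6 := mul_le_mul_of_nonneg_left p2 (show 0 ≤ 2 * (x1 + x2 + x3) by linarith)
  have e7 := mul_le_mul_of_nonneg_left p1 (show 0 ≤ x7 + x8 by linarith)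
  have e8 := mul_le_mul_of_nonneg_left p2 (show 0 ≤ x9 by linarith)
  have f1 := mul_le_mul_of_nonneg_right c1 p0
  have f2 := mul_le_mul_of_nonneg_right c2 p0
  have f3 := mul_le_mul_of_nonneg_right c3 p0
  have g5 := mul_nonneg b5 p0
  have g6 := mul_nonneg b6 p0
  have g1 := mul_nonneg (b7.trans c1) p0
  have g2 := mul_nonneg (b8.trans c2) p0
  have g3 := mul_nonneg (b9.trans c3) p0
  linarith

end bounds

/-- Balanced representations are among those counted by `levelReps`, and u is the rounded-down
logarithm of that maximum. -/
theorem card_balancedReps_le_pow {v : ℕ} {ε : ℕ → ℕ} {i v' m' : ℕ} {x : Fin (h + h) → ℤ}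
    (hx : WellFormed (ones v ε i) (negs ε i) x) (hv : ones v ε (i + 1) = 2 * v')
    (hm : negs ε (i + 1) = 2 * m') :
    (balancedReps v' m' x).card ≤
      Fintype.card F ^ (mergeLength (Fintype.card F) (h + h) v ε i + 1) := by
  calc (balancedReps v' m' x).card ≤ (representations (2 * v') (2 * m') x).card :=
        Finset.card_le_card balancedReps_subset
    _ ≤ levelReps (h + h) v ε i := by
        rw [levelReps, numReps, hv, hm]
        exact Finset.le_sup (f := fun x => (representations (2 * v') (2 * m') x).card)
          (mem_searchSpace.2 hx)
    _ ≤ _ := (Nat.lt_pow_succ_log_self Fintype.one_lt_card _).le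

section expected

variable (hF : (-1 : F) ≠ 1) {v : ℕ} {ε u o g : ℕ → ℕ}
  (hu : u = mergeLength (Fintype.card F) (h + h) v ε) (ho : o = ones v ε) (hg : g = negs ε)
  (hu₁ : u 1 ≤ u 0) (hu₀ : u 0 ≤ ℓ) (ho₂ : 2 ∣ o 2) (hg₂ : 2 ∣ g 2)
  {e : Fin (h + h) → ℤ} (he : ∀ j, e j = 1 ∨ e j = -1)

include hF hu ho hg hu₁ hu₀ he

theorem le_expectedSteps {B : Finset (Fin (h + h) → ℤ)}
    (hB : B ⊆ searchSpace (h + h) (o 1) (g 1)) {b : ℕ}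
    (hb : ∀ x ∈ B, b ≤ (balancedReps (o 2 / 2) (g 2 / 2) x).card) :
    max (max ((searchSpace h (o 2 / 2) (g 2 / 2)).card : ℝ)
        ((searchSpace h (o 2 / 2) (g 2 / 2)).card ^ 2 / (Fintype.card F : ℝ) ^ u 1))
      (max (((searchSpace h (o 2 / 2) (g 2 / 2)).card ^ 2) ^ 2 /
          ((Fintype.card F : ℝ) ^ u 1 * (Fintype.card F : ℝ) ^ u 0))
        ((B.card * b) ^ 2 / ((Fintype.card F : ℝ) ^ u 0 * ((Fintype.card F : ℝ) ^ u 1) ^ 2 *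
          (Fintype.card F : ℝ) ^ ℓ))) ≤
      expectedSteps F ℓ v ε e := by
  have hs := fun A : Matrix (Fin (h + h)) (Fin ℓ) F =>
    le_steps (shifted_syndrome hF he A) hu ho hg
  change _ ≤ mean fun A : Matrix (Fin (h + h)) (Fin ℓ) F =>
    ((shiftedBCJ2 v ε A (syndromeOf A e)).steps : ℝ)
  have m1 := le_mean_length_baseVecs (F := F) (h := h) 0 (u 1) (o 2) (g 2) (hu₁.trans hu₀)
  have m2 := le_mean_collisions_baseVecs (F := F) (h := h) 0 (o 2) (g 2) hu₁ hu₀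
  have m3 := le_mean_collisions_midVecs (castVec F (shifted e)) o g hu₁ hu₀ hB hb
  rw [card_balancedSpace, Nat.cast_pow] at m1 m2
  refine max_le (max_le ?_ ?_) (max_le ?_ ?_)
  · rw [← mean_const (F := F) (N := h + h) (ℓ := ℓ) ((searchSpace h (o 2 / 2) (g 2 / 2)).card : ℝ)]
    exact mean_mono fun A => (hs A).1
  · exact m1.trans (mean_mono fun A => (hs A).2.1)
  · exact m2.trans (mean_mono fun A => (hs A).2.2.1)
  · exact m3.trans (mean_mono fun A => (hs A).2.2.2)

include ho₂ hg₂

/-- The correction terms from dependent vectors are absorbed into a constant depending only on q.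
The exception is D / q^(u₀), a vector of level 1 in the first list with boundedly many partners,
which has to be kept. -/
theorem expectedSteps_le (hH : 1 ≤ (searchSpace h (o 2 / 2) (g 2 / 2)).card) :
    expectedSteps F ℓ v ε e ≤ 14 * ((((h + h : ℕ) : ℝ) + 1) * (ℓ + 1)) *
      (20 * (Fintype.card F : ℝ) ^ 8 *
        ((searchSpace h (o 2 / 2) (g 2 / 2)).card +
          (searchSpace h (o 2 / 2) (g 2 / 2)).card ^ 2 / (Fintype.card F : ℝ) ^ u 1 +
          ((searchSpace h (o 2 / 2) (g 2 / 2)).card ^ 2) ^ 2 /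
            ((Fintype.card F : ℝ) ^ u 1 * (Fintype.card F : ℝ) ^ u 0) +
          (searchSpace (h + h) (o 1) (g 1)).card / (Fintype.card F : ℝ) ^ u 0 +
          (searchSpace (h + h) (o 1) (g 1)).card ^ 2 /
            ((Fintype.card F : ℝ) ^ u 0 * (Fintype.card F : ℝ) ^ ℓ))) := by
  have hs := mean_mono fun A : Matrix (Fin (h + h)) (Fin ℓ) F =>
    steps_le (shifted_syndrome hF he A) hu ho hg hH
  change mean (fun A : Matrix (Fin (h + h)) (Fin ℓ) F =>
    ((shiftedBCJ2 v ε A (syndromeOf A e)).steps : ℝ)) ≤ _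
  refine hs.trans ?_
  rw [mean_const_mul, mean_add, mean_add, mean_add, mean_add, mean_add, mean_const]
  refine mul_le_mul_of_nonneg_left ?_ (by positivity)
  have m1 := fun τ => mean_length_baseVecs_le (h := h) τ (u 1) (o 2) (g 2) hF (hu₁.trans hu₀)
  have m2 := fun τ => mean_collisions_baseVecs_le (h := h) τ (o 2) (g 2) hF hu₁ hu₀
  have m3 := mean_collisions_midVecs_le (castVec F (shifted e)) o g hF hu₁ hu₀ (by
    intro x hx
    subst hu ho hg
    exact card_balancedReps_le_pow (mem_searchSpace.1 hx) (Nat.mul_div_cancel' ho₂).symm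
      (Nat.mul_div_cancel' hg₂).symm)
  rw [card_balancedSpace, Nat.cast_pow] at m1 m2
  have n1 := m1 0
  have n2 := m1 (castVec F (shifted e))
  have n3 := m2 0
  have n4 := m2 (castVec F (shifted e))
  refine (add_le_add (add_le_add (add_le_add le_rfl (add_le_add n1 n2)) (add_le_add n3 n4))
    m3).trans ?_
  have hH' : (1 : ℝ) ≤ (searchSpace h (o 2 / 2) (g 2 / 2)).card := mod_cast hH
  have hq := (one_lt_card_real (F := F)).le
  generalize ((searchSpace h (o 2 / 2) (g 2 / 2)).card : ℝ) = H at *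
  have hD : (0 : ℝ) ≤ (searchSpace (h + h) (o 1) (g 1)).card := Nat.cast_nonneg _
  generalize ((searchSpace (h + h) (o 1) (g 1)).card : ℝ) = D at *
  generalize (Fintype.card F : ℝ) = q at *
  have hq0 : 0 < q := by linarith
  have eY : (H ^ 2) ^ 2 / (q ^ u 1 * q ^ u 0) = H ^ 2 / q ^ u 1 * (H ^ 2 / q ^ u 0) := by
    rw [div_mul_div_comm, ← sq]
  have eW : D ^ 2 / (q ^ u 0 * q ^ ℓ) = D / q ^ u 0 * (D / q ^ ℓ) := by
    rw [div_mul_div_comm, ← sq]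
  have lY : H ^ 2 / q ^ u 0 ≤ H ^ 2 / q ^ u 1 := by gcongr
  have lZ : D / q ^ ℓ ≤ D / q ^ u 0 := by gcongr
  rw [eY, eW]
  have hX : 0 ≤ H ^ 2 / q ^ u 1 := by positivity
  have hY : 0 ≤ H ^ 2 / q ^ u 0 := by positivity
  have hZ : 0 ≤ D / q ^ u 0 := by positivity
  have hZ' : 0 ≤ D / q ^ ℓ := by positivity
  generalize H ^ 2 / q ^ u 1 = X at *
  generalize H ^ 2 / q ^ u 0 = Y at *
  generalize D / q ^ u 0 = Z at *
  generalize D / q ^ ℓ = Z' at *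
  clear n1 n2 n3 n4 m1 m2 m3 hs
  have hXY := mul_nonneg hX hY
  have hZZ := mul_nonneg hZ hZ'
  have q8 : (1 : ℝ) ≤ q ^ 8 := one_le_pow₀ hq
  have q18 : q ≤ q ^ 8 := le_self_pow₀ hq (by norm_num)
  have q28 : q ^ 2 ≤ q ^ 8 := pow_le_pow_right₀ hq (by norm_num)
  have hK : (q + q ^ 3) ^ 2 ≤ 4 * q ^ 6 := by
    have : q + q ^ 3 ≤ 2 * q ^ 3 := by linarith [le_self_pow₀ hq (show 3 ≠ 0 by norm_num)]
    calc (q + q ^ 3) ^ 2 ≤ (2 * q ^ 3) ^ 2 := by gcongr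
      _ = 4 * q ^ 6 := by ring
  -- The product contains Z' without the factor Z; it is absorbed by Z' ≤ Z, which holds because u₀
  -- ≤ ℓ.
  have t1 : (Z + 1) * ((Z' + q ^ 2) * (q + q ^ 3) ^ 2) ≤ 8 * q ^ 8 * (Z * Z' + Z + 1) := by
    calc (Z + 1) * ((Z' + q ^ 2) * (q + q ^ 3) ^ 2)
        ≤ (Z + 1) * ((Z' + q ^ 2) * (4 * q ^ 6)) := by gcongr
      _ = 4 * (q ^ 6 * (Z * Z' + Z') + q ^ 8 * (Z + 1)) := by ring
      _ ≤ 4 * (q ^ 8 * (Z * Z' + Z) + q ^ 8 * (Z + 1)) := by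
          gcongr
          norm_num
      _ ≤ 8 * q ^ 8 * (Z * Z' + Z + 1) := by
          have : 0 ≤ q ^ 8 * (Z * Z' + 1) := by positivity
          linarith
  have t2 : (X + 1) * (Y + q) ≤ X * Y + q ^ 8 * (2 * X + 1) := by
    have : q * (X + 1) ≤ q ^ 8 * (X + 1) := by gcongr
    have : X ≤ q ^ 8 * X := le_mul_of_one_le_left hX q8
    linarith
  have s1 : H ≤ q ^ 8 * H := le_mul_of_one_le_left (by linarith) q8
  have s2 : X ≤ q ^ 8 * X := le_mul_of_one_le_left hX q8
  have s3 : X * Y ≤ q ^ 8 * (X * Y) := le_mul_of_one_le_left hXY q8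
  have s4 : q ^ 8 ≤ q ^ 8 * H := le_mul_of_one_le_right (by linarith) hH'
  have s5 : 0 ≤ q ^ 8 * (Z * Z') := by positivity
  have s6 : 0 ≤ q ^ 8 * Z := by positivity
  linarith

end expected

end Steps

end ShiftedBCJ

namespace ShiftedBCJ

/-! ### Success probability -/

section SuccessProb

variable {F : Type} [Field F] [Fintype F] [DecidableEq F] {h ℓ : ℕ}

theorem wellFormed_shifted {N v : ℕ} {x : Fin N → ℤ} (hx : ∀ j, x j = 1 ∨ x j = -1)
    (hv : (Finset.univ.filter fun j => x j = 1).card = v) :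
    WellFormed v 0 fun j => (x j + 1) / 2 := by
  refine ⟨fun j => ?_, ?_, ?_⟩
  · have := hx j
    dsimp only
    omega
  · rw [← hv]
    congr 1
    ext j
    have := hx j
    simp only [Finset.mem_filter, Finset.mem_univ, true_and]
    omega
  · rw [Finset.card_eq_zero, Finset.filter_eq_empty_iff]
    intro j _
    have := hx j
    dsimp only
    omega

theorem shifted_mem_balancedSpace {v : ℕ} {e : Fin (h + h) → ℤ} (he : ∀ j, e j = 1 ∨ e j = -1)
    (h₁ : (Finset.univ.filter fun j : Fin h => e (Fin.castAdd h j) = 1).card = v)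
    (h₂ : (Finset.univ.filter fun j : Fin h => e (Fin.natAdd h j) = 1).card = v) :
    shifted e ∈ balancedSpace h v 0 := by
  rw [← Fin.append_castAdd_natAdd (f := shifted e)]
  exact append_mem_balancedSpace.2 ⟨wellFormed_shifted (fun j => he _) h₁,
    wellFormed_shifted (fun j => he _) h₂⟩

/-- The divisibility assumptions in explicit form. In particular the weights in each half on level 1
are again even, so the halves can be represented separately. -/
theorem ones_negs_eq {a c d v : ℕ} {ε : ℕ → ℕ} (hv : v = 8 * a) (hε₁ : ε 1 = 4 * c)
    (hε₂ : ε 2 = 2 * d) :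
    ones v ε 1 = 2 * (2 * a + 2 * c) ∧ ones v ε 2 = 2 * (a + c + d) ∧
      negs ε 1 = 2 * (2 * c) ∧ negs ε 2 = 2 * (c + d) := by
  have o1 : ones v ε 1 = v / 2 + ε 1 := rfl
  have o2 : ones v ε 2 = (v / 2 + ε 1) / 2 + ε 2 := rfl
  have g1 : negs ε 1 = 0 / 2 + ε 1 := rfl
  have g2 : negs ε 2 = (0 / 2 + ε 1) / 2 + ε 2 := rfl
  omega

/-- The bound does not mention e, which makes the conclusion uniform over all evenly split
solutions. -/
theorem sq_div_le_successProb (hF : (-1 : F) ≠ 1) {a c d v : ℕ} {ε u : ℕ → ℕ}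
    (hv : v = 8 * a) (hε₁ : ε 1 = 4 * c) (hε₂ : ε 2 = 2 * d)
    (hu : u = mergeLength (Fintype.card F) (h + h) v ε)
    (hu₁ : u 1 ≤ u 0) (hu₀ : u 0 ≤ ℓ) {e : Fin (h + h) → ℤ} (he : ∀ j, e j = 1 ∨ e j = -1)
    (h₁ : (Finset.univ.filter fun j : Fin h => e (Fin.castAdd h j) = 1).card = v / 2)
    (h₂ : (Finset.univ.filter fun j : Fin h => e (Fin.natAdd h j) = 1).card = v / 2) :
    ((((repsLower h (2 * a) 0 (2 * c) : ℕ) : ℝ) ^ 2 *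
      (((repsLower h (a + c) c d : ℕ) : ℝ) ^ 2) ^ 2) /
      ((Fintype.card F : ℝ) ^ u 0 * ((Fintype.card F : ℝ) ^ u 1) ^ 2)) ^ 2 /
      ((Fintype.card F : ℝ) + (Fintype.card F : ℝ) ^ 5) ^ 6 ≤ successProb F ℓ v ε e := by
  have hq := card_pos_real (F := F)
  obtain ⟨o1, o2, g1, g2⟩ := ones_negs_eq hv hε₁ hε₂
  set z := shifted e with hz
  have hzb : z ∈ balancedSpace h (2 * (2 * a)) (2 * 0) := by
    have := shifted_mem_balancedSpace he h₁ h₂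
    rwa [show v / 2 = 2 * (2 * a) by omega] at this
  have hz0 : WellFormed (ones v ε 0) (negs ε 0) z := by
    have := wellFormed_of_mem_balancedSpace hzb
    rwa [show 2 * (2 * (2 * a)) = v by omega] at this
  -- Only balanced summands of z are used, so that x and z - x both have many balanced
  -- representations on the next level.
  set T₀ := balancedReps (2 * a + 2 * c) (2 * c) z with hT₀
  have hT : ∀ x ∈ T₀, x ∈ balancedSpace h (2 * a + 2 * c) (2 * c) ∧
      z - x ∈ balancedSpace h (2 * a + 2 * c) (2 * c) := fun x hx => Finset.mem_filter.1 hx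
  have hwf : ∀ x ∈ balancedSpace h (2 * a + 2 * c) (2 * c),
      WellFormed (ones v ε 1) (negs ε 1) x := by
    intro x hx
    rw [o1, g1]
    exact wellFormed_of_mem_balancedSpace hx
  have hup : ∀ x ∈ balancedSpace h (2 * a + 2 * c) (2 * c),
      (balancedReps (a + c + d) (c + d) x).card ≤ Fintype.card F ^ (u 1 + 1) := by
    intro x hx
    rw [hu]
    exact card_balancedReps_le_pow (hwf x hx) o2 g2
  have hlow : ∀ x ∈ balancedSpace h (2 * a + 2 * c) (2 * c),
      repsLower h (a + c) c d ^ 2 ≤ (balancedReps (a + c + d) (c + d) x).card := by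
    intro x hx
    rw [← mul_add] at hx
    exact repsLower_sq_le_card_balancedReps hx
  have key := sq_card_le_mul_prob_exists (ℓ := ℓ) hF hu₀ (hu₁.trans hu₀) z T₀
    (balancedReps (a + c + d) (c + d)) (fun x hx => (hwf x (hT x hx).1).1)
    (fun x y hy => (wellFormed_of_mem_balancedSpace (Finset.mem_filter.1 hy).1).1)
    (by rw [hu]; exact card_balancedReps_le_pow hz0 o1 g1)
    (fun x hx => hup x (hT x hx).1) (fun x hx => hup _ (hT x hx).2)
    (b₀ := repsLower h (2 * a) 0 (2 * c) ^ 2) (b₁ := repsLower h (a + c) c d ^ 2)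
    (by have := repsLower_sq_le_card_balancedReps (ε := 2 * c) hzb; rwa [zero_add] at this)
    (fun x hx => hlow x (hT x hx).1) (fun x hx => hlow _ (hT x hx).2)
  rw [Nat.cast_pow, Nat.cast_pow] at key
  rw [div_le_iff₀ (by positivity)]
  refine key.trans ?_
  unfold successProb
  gcongr
  rename_i A _
  rintro ⟨x, hx, y₁, hy₁, y₃, hy₃, hxA, hy₁A, hy₃A⟩
  rw [shiftedBCJ2_val v ε A _ (castVec F z) (shifted_syndrome hF he A), ← hu]
  refine List.mem_map.2 ⟨z, mem_finalVecs hu₁ hz0 (hwf x (hT x hx).1) (hwf _ (hT x hx).2)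
    (y₁ := y₁) (y₃ := y₃) ?_ ?_ hxA hy₁A hy₃A, two_mul_shifted_sub_one he⟩
  · rwa [o2, g2, Nat.mul_div_cancel_left _ two_pos, Nat.mul_div_cancel_left _ two_pos]
  · rwa [o2, g2, Nat.mul_div_cancel_left _ two_pos, Nat.mul_div_cancel_left _ two_pos]

end SuccessProb

/-! ### Exponents -/

section Exponents

theorem tendsto_logb_max {a b : ℕ → ℝ} {A B : ℝ} (ha0 : ∀ n, 0 < a n) (hb0 : ∀ n, 0 < b n)
    (ha : Tendsto (fun n : ℕ => Real.logb 2 (a n) / n) atTop (𝓝 A))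
    (hb : Tendsto (fun n : ℕ => Real.logb 2 (b n) / n) atTop (𝓝 B)) :
    Tendsto (fun n : ℕ => Real.logb 2 (max (a n) (b n)) / n) atTop (𝓝 (max A B)) := by
  refine (ha.max hb).congr fun n => ?_
  have hn : (0 : ℝ) ≤ n := Nat.cast_nonneg n
  rcases le_total (a n) (b n) with h | h
  · rw [max_eq_right h, max_eq_right]
    exact div_le_div_of_nonneg_right (Real.logb_le_logb_of_le one_lt_two (ha0 n) h) hn
  · rw [max_eq_left h, max_eq_left]
    exact div_le_div_of_nonneg_right (Real.logb_le_logb_of_le one_lt_two (hb0 n) h) hn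

theorem tendsto_logb_squeeze {a b c : ℕ → ℝ} {C : ℝ} (ha0 : ∀ n, 0 < a n)
    (hab : ∀ n, a n ≤ b n) (hbc : ∀ n, b n ≤ c n)
    (ha : Tendsto (fun n : ℕ => Real.logb 2 (a n) / n) atTop (𝓝 C))
    (hc : Tendsto (fun n : ℕ => Real.logb 2 (c n) / n) atTop (𝓝 C)) :
    Tendsto (fun n : ℕ => Real.logb 2 (b n) / n) atTop (𝓝 C) :=
  tendsto_of_tendsto_of_tendsto_of_le_of_le ha hc
    (fun n => div_le_div_of_nonneg_right (Real.logb_le_logb_of_le one_lt_two (ha0 n) (hab n))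
      (Nat.cast_nonneg n))
    (fun n => div_le_div_of_nonneg_right
      (Real.logb_le_logb_of_le one_lt_two ((ha0 n).trans_le (hab n)) (hbc n)) (Nat.cast_nonneg n))

theorem tendsto_logb_add_one {a : ℕ → ℕ} {A : ℝ}
    (ha : Tendsto (fun n => (a n : ℝ) / n) atTop (𝓝 A)) :
    Tendsto (fun n : ℕ => Real.logb 2 ((a n : ℝ) + 1) / n) atTop (𝓝 0) := by
  have := (tendsto_log_div_zero (fun n => by simp) (tendsto_add_one_div ha)).div_const (Real.log 2)
  rw [zero_div] at this
  refine this.congr fun n => ?_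
  rw [Real.logb]; ring

theorem tendsto_add_div {a b : ℕ → ℕ} {A B : ℝ}
    (ha : Tendsto (fun n => (a n : ℝ) / n) atTop (𝓝 A))
    (hb : Tendsto (fun n => (b n : ℝ) / n) atTop (𝓝 B)) :
    Tendsto (fun n => ((a n + b n : ℕ) : ℝ) / n) atTop (𝓝 (A + B)) := by
  refine (ha.add hb).congr fun n => ?_
  push_cast; ring

theorem tendsto_div_of_mul {a : ℕ → ℕ} {k : ℕ} (hk : 0 < k) {A : ℝ}
    (ha : Tendsto (fun n => ((k * a n : ℕ) : ℝ) / n) atTop (𝓝 A)) :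
    Tendsto (fun n => (a n : ℝ) / n) atTop (𝓝 (A / k)) := by
  have hk' : (k : ℝ) ≠ 0 := Nat.cast_ne_zero.2 hk.ne'
  refine (ha.div_const (k : ℝ)).congr fun n => ?_
  push_cast; field_simp

theorem tendsto_half {a : ℕ → ℕ} {A : ℝ} (h : ∀ n, 2 * (a n / 2) = a n)
    (ha : Tendsto (fun n => (a n : ℝ) / n) atTop (𝓝 A)) :
    Tendsto (fun n => ((a n / 2 : ℕ) : ℝ) / n) atTop (𝓝 (A / 2)) :=
  tendsto_div_of_mul two_pos (ha.congr fun n => by rw [h n])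

/-- A vector with one of its representations is recovered from the pair of summands, so there are no
more of these than pairs of vectors on the next level. -/
theorem card_searchSpace_mul_repsLower_le {N a b ε : ℕ} :
    (searchSpace N (2 * a) (2 * b)).card * repsLower N a b ε ≤
      (searchSpace N (a + ε) (b + ε)).card ^ 2 := by
  calc (searchSpace N (2 * a) (2 * b)).card * repsLower N a b ε
      ≤ ∑ x ∈ searchSpace N (2 * a) (2 * b), (representations (a + ε) (b + ε) x).card :=
        Finset.card_nsmul_le_sum _ _ _ fun x hx =>
          repsLower_le_card_representations (mem_searchSpace.1 hx)
    _ = ((searchSpace N (2 * a) (2 * b)).sigma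
          fun x => representations (a + ε) (b + ε) x).card := (Finset.card_sigma _ _).symm
    _ ≤ (searchSpace N (a + ε) (b + ε) ×ˢ searchSpace N (a + ε) (b + ε)).card := by
        refine Finset.card_le_card_of_injOn (fun p => (p.2, p.1 - p.2)) ?_ ?_
        · rintro ⟨x, y⟩ hp
          have := mem_representations.1 (Finset.mem_sigma.1 hp).2
          simpa [mem_searchSpace] using this
        · rintro ⟨x, y⟩ - ⟨x', y'⟩ - hp
          simp only [Prod.mk.injEq] at hp
          obtain ⟨rfl, hp⟩ := hp
          rw [sub_left_inj] at hp
          rw [hp]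
    _ = _ := by rw [Finset.card_product, sq]

theorem repsLower_pos {N a b ε : ℕ} (h : 2 * a + 2 * b + 2 * ε ≤ N) : 0 < repsLower N a b ε := by
  unfold repsLower
  exact Nat.mul_pos (Nat.choose_pos (by omega)) (Nat.mul_pos (Nat.choose_pos (by omega))
    (Nat.mul_pos (Nat.choose_pos (by omega)) (Nat.choose_pos (by omega))))

theorem repsLower_le_numReps {N a b ε : ℕ} (h : 2 * a + 2 * b ≤ N) :
    repsLower N a b ε ≤ numReps N (2 * a) (2 * b) (a + ε) (b + ε) := by
  obtain ⟨x, hx⟩ := searchSpace_nonempty h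
  exact (repsLower_le_card_representations (mem_searchSpace.1 hx)).trans
    (Finset.le_sup (f := fun x => (representations (a + ε) (b + ε) x).card) hx)

theorem card_representations_le_repsUpper {N a b ε : ℕ} {x : Fin N → ℤ}
    (hx : WellFormed (2 * a) (2 * b) x) :
    (representations (a + ε) (b + ε) x).card ≤ repsUpper N a b ε :=
  card_representations_le hx (by ring)

theorem numReps_le_repsUpper {N a b ε : ℕ} :
    numReps N (2 * a) (2 * b) (a + ε) (b + ε) ≤ repsUpper N a b ε :=
  Finset.sup_le fun _ hx => card_representations_le_repsUpper (mem_searchSpace.1 hx)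

/-- The exponent of the number of representations. -/
noncomputable def repsExp (S V M E : ℝ) : ℝ :=
  M + V + (S - V - M) * hBin (2 * E / (S - V - M)) + 2 * E

theorem repsExp_eq (S V M E : ℝ) :
    2 * (M / 2) + 2 * (V / 2) +
      (S - 2 * (V / 2) - 2 * (M / 2)) * hBin (2 * E / (S - 2 * (V / 2) - 2 * (M / 2))) + 2 * E =
      repsExp S V M E := by
  rw [repsExp, mul_div_cancel₀ M two_ne_zero, mul_div_cancel₀ V two_ne_zero]

/-- Homogeneity of degree 1, used to pass from length h to length h + h by squaring. -/
theorem repsExp_half (S V M E : ℝ) : repsExp (S / 2) (V / 2) (M / 2) (E / 2) =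
    repsExp S V M E / 2 := by
  rw [repsExp, repsExp, show S / 2 - V / 2 - M / 2 = (S - V - M) / 2 by ring,
    show 2 * (E / 2) / ((S - V - M) / 2) = 2 * E / (S - V - M) by
      rw [div_div_eq_mul_div]; congr 1; ring]
  ring

section reps

variable {N a b ε : ℕ → ℕ} {S V M E : ℝ} (h : ∀ n, 2 * a n + 2 * b n + 2 * ε n ≤ N n)
    (hN : Tendsto (fun n => (N n : ℝ) / n) atTop (𝓝 S))
    (ha : Tendsto (fun n => (a n : ℝ) / n) atTop (𝓝 (V / 2)))
    (hb : Tendsto (fun n => (b n : ℝ) / n) atTop (𝓝 (M / 2)))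
    (hε : Tendsto (fun n => (ε n : ℝ) / n) atTop (𝓝 E))

include h hN ha hb hε

theorem tendsto_logb_repsLower_repsExp :
    Tendsto (fun n => Real.logb 2 (repsLower (N n) (a n) (b n) (ε n) : ℝ) / n) atTop
      (𝓝 (repsExp S V M E)) := by
  rw [← repsExp_eq]
  exact tendsto_logb_repsLower h hN ha hb hε

theorem tendsto_logb_card_representations {x : (n : ℕ) → Fin (N n) → ℤ}
    (hx : ∀ n, WellFormed (2 * a n) (2 * b n) (x n)) :
    Tendsto (fun n => Real.logb 2
      ((representations (a n + ε n) (b n + ε n) (x n)).card : ℝ) / n) atTop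
      (𝓝 (repsExp S V M E)) := by
  rw [← repsExp_eq]
  exact tendsto_logb_of_reps_bounds h hN ha hb hε
    (fun n => repsLower_le_card_representations (hx n))
    (fun n => card_representations_le_repsUpper (hx n))

theorem tendsto_logb_mul_log_numReps {q : ℕ} (hq : 1 < q) :
    Tendsto (fun n => Real.logb 2 (q : ℝ) *
      ((Nat.log q (numReps (N n) (2 * a n) (2 * b n) (a n + ε n) (b n + ε n)) : ℝ) / n)) atTop
      (𝓝 (repsExp S V M E)) := by
  have h2 : ∀ n, 2 * a n + 2 * b n ≤ N n := fun n => by have := h n; omega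
  rw [← repsExp_eq]
  exact tendsto_log_mul_div hq (fun n => (repsLower_pos (h n)).trans_le (repsLower_le_numReps (h2 n)))
    (tendsto_logb_of_reps_bounds h hN ha hb hε (fun n => repsLower_le_numReps (h2 n))
      (fun n => numReps_le_repsUpper))

end reps

theorem tendsto_logb_card_searchSpace_half {N v m : ℕ → ℕ} {S V M : ℝ}
    (h : ∀ n, v n + m n ≤ N n)
    (hN : Tendsto (fun n => (N n : ℝ) / n) atTop (𝓝 (S / 2)))
    (hv : Tendsto (fun n => (v n : ℝ) / n) atTop (𝓝 (V / 2)))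
    (hm : Tendsto (fun n => (m n : ℝ) / n) atTop (𝓝 (M / 2))) :
    Tendsto (fun n => Real.logb 2 ((searchSpace (N n) (v n) (m n)).card : ℝ) / n) atTop
      (𝓝 (S * gTri (V / S) (M / S) / 2)) := by
  have := tendsto_logb_card_searchSpace h hN hv hm
  rwa [div_div_div_cancel_right₀ two_ne_zero, div_div_div_cancel_right₀ two_ne_zero,
    div_mul_eq_mul_div] at this

theorem tendsto_logb_card_field_pow (F : Type) [Field F] [Fintype F] {u : ℕ → ℕ} {U : ℝ}
    (hu : Tendsto (fun n => Real.logb 2 (Fintype.card F) * ((u n : ℝ) / n)) atTop (𝓝 U)) :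
    Tendsto (fun n : ℕ => Real.logb 2 ((Fintype.card F : ℝ) ^ u n) / n) atTop (𝓝 U) := by
  refine hu.congr fun n => ?_
  rw [Real.logb_pow]; ring

end Exponents

end ShiftedBCJ

/-! ### The theorem -/

open ShiftedBCJ

theorem mainTheorem3
    -- the field, of odd order `q`, so that `-1` has order `z = 2`
    (F : Type) [Field F] [Fintype F] [DecidableEq F] (hF : (-1 : F) ≠ 1)
    -- `k`, `ℓ`, half the length `k + ℓ`, target weight, overlaps `ε n i` on level `i`
    (k ℓ h v : ℕ → ℕ) (ε : ℕ → ℕ → ℕ)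
    (R L V : ℝ) (E : ℕ → ℝ)
    (hk : Tendsto (fun n => (k n : ℝ) / n) atTop (𝓝 R))
    (hℓ : Tendsto (fun n => (ℓ n : ℝ) / n) atTop (𝓝 L))
    (hv : Tendsto (fun n => (v n : ℝ) / n) atTop (𝓝 V))
    (hε : ∀ i, 1 ≤ i → i ≤ 2 → Tendsto (fun n => (ε n i : ℝ) / n) atTop (𝓝 (E i)))
    -- all halvings in the algorithm are exact
    (hh : ∀ n, k n + ℓ n = h n + h n)
    (hdvd : ∀ n, 8 ∣ v n ∧ 4 ∣ ε n 1 ∧ 2 ∣ ε n 2)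
    -- the vectors on level `i` can be split as prescribed
    (hfit : ∀ n, ∀ i < 2,
      ShiftedBCJ.ones (v n) (ε n) i + ShiftedBCJ.negs (ε n) i + 2 * ε n (i + 1) ≤ k n + ℓ n)
    -- the positions on which one merges are nested: `u₁ ≤ u₀ ≤ ℓ`
    (hu : ∀ n,
      ShiftedBCJ.mergeLength (Fintype.card F) (h n + h n) (v n) (ε n) 1 ≤
        ShiftedBCJ.mergeLength (Fintype.card F) (h n + h n) (v n) (ε n) 0 ∧
      ShiftedBCJ.mergeLength (Fintype.card F) (h n + h n) (v n) (ε n) 0 ≤ ℓ n) :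
    -- weights and search spaces on level `i`
    (∀ i ≤ 2,
      Tendsto (fun n => (ShiftedBCJ.ones (v n) (ε n) i : ℝ) / n) atTop
        (𝓝 (ShiftedBCJ.Vlim V E i)) ∧
      Tendsto (fun n => (ShiftedBCJ.negs (ε n) i : ℝ) / n) atTop
        (𝓝 (ShiftedBCJ.Mlim E i)) ∧
      Tendsto (fun n => Real.logb 2 ((ShiftedBCJ.searchSpace (h n + h n)
          (ShiftedBCJ.ones (v n) (ε n) i) (ShiftedBCJ.negs (ε n) i)).card : ℝ) / n) atTop
        (𝓝 (ShiftedBCJ.SigmaExp R L V E i))) ∧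
    -- number of representations of a vector on level `i`, and number of merge positions
    (∀ i < 2,
      (∀ x : (n : ℕ) → Fin (h n + h n) → ℤ,
        (∀ n, ShiftedBCJ.WellFormed (ShiftedBCJ.ones (v n) (ε n) i)
          (ShiftedBCJ.negs (ε n) i) (x n)) →
        Tendsto (fun n => Real.logb 2 ((ShiftedBCJ.representations
            (ShiftedBCJ.ones (v n) (ε n) (i + 1)) (ShiftedBCJ.negs (ε n) (i + 1))
            (x n)).card : ℝ) / n) atTop
          (𝓝 (ShiftedBCJ.UExp R L V E i))) ∧
      Tendsto (fun n => Real.logb 2 (Fintype.card F) *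
          ((ShiftedBCJ.mergeLength (Fintype.card F) (h n + h n) (v n) (ε n) i : ℝ) / n)) atTop
        (𝓝 (ShiftedBCJ.UExp R L V E i))) ∧
    -- everything the algorithm outputs is a solution
    (∀ n, ∀ (A : Matrix (Fin (h n + h n)) (Fin (ℓ n)) F) (s : Fin (ℓ n) → F),
      ∀ e ∈ (ShiftedBCJ.shiftedBCJ2 (v n) (ε n) A s).val,
        (∀ j, e j = 1 ∨ e j = -1) ∧ (Finset.univ.filter fun j => e j = 1).card = v n ∧
          ShiftedBCJ.syndromeOf A e = s) ∧
    -- a solution whose entries `1` are evenly split is found with subexponentially small loss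
    (∀ δ > (0 : ℝ), ∀ᶠ n : ℕ in atTop, ∀ e : Fin (h n + h n) → ℤ,
      (∀ j, e j = 1 ∨ e j = -1) →
      (Finset.univ.filter fun j : Fin (h n) => e (Fin.castAdd (h n) j) = 1).card = v n / 2 →
      (Finset.univ.filter fun j : Fin (h n) => e (Fin.natAdd (h n) j) = 1).card = v n / 2 →
      (2 : ℝ) ^ (-δ * n) ≤ ShiftedBCJ.successProb F (ℓ n) (v n) (ε n) e) ∧
    -- the exponent of the cost
    (∀ e : (n : ℕ) → Fin (h n + h n) → ℤ, (∀ n j, e n j = 1 ∨ e n j = -1) →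
      Tendsto (fun n => Real.logb 2
          (ShiftedBCJ.expectedSteps F (ℓ n) (v n) (ε n) (e n)) / n) atTop
        (𝓝 (ShiftedBCJ.costExp (Real.logb 2 (Fintype.card F)) R L V E))) := by
  have hq : 1 < Fintype.card F := Fintype.one_lt_card
  choose a ha using fun n => (hdvd n).1
  choose c hc using fun n => (hdvd n).2.1
  choose d hd using fun n => (hdvd n).2.2
  have lv := fun n => ones_negs_eq (ha n) (hc n) (hd n)
  have o0 : ∀ n, ones (v n) (ε n) 0 = v n := fun n => rfl
  have g0 : ∀ n, negs (ε n) 0 = 0 := fun n => rfl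
  have f0 : ∀ n, 8 * a n + 2 * (4 * c n) ≤ h n + h n := fun n => by
    have := hfit n 0 two_pos
    rw [o0, g0, zero_add, ha n, hc n, hh n] at this
    omega
  have f1 : ∀ n, 2 * (2 * a n + 2 * c n) + 2 * (2 * c n) + 2 * (2 * d n) ≤ h n + h n := fun n => by
    have := hfit n 1 one_lt_two
    rwa [(lv n).1, (lv n).2.2.1, hd n, hh n] at this
  have hle : ∀ i ≤ 2, ∀ n, ones (v n) (ε n) i + negs (ε n) i ≤ h n + h n := by
    intro i hi n
    obtain ⟨l1, l2, l3, l4⟩ := lv n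
    have := f0 n; have := f1 n; have := o0 n; have := g0 n; have := ha n
    interval_cases i <;> omega
  have heven : ∀ i ≤ 2, ∀ n, 2 * (ones (v n) (ε n) i / 2) = ones (v n) (ε n) i ∧
      2 * (negs (ε n) i / 2) = negs (ε n) i := by
    intro i hi n
    obtain ⟨l1, l2, l3, l4⟩ := lv n
    have := o0 n; have := g0 n; have := ha n
    interval_cases i <;> omega
  have hN : Tendsto (fun n => ((h n + h n : ℕ) : ℝ) / n) atTop (𝓝 (R + L)) := by
    simp_rw [← hh]
    exact tendsto_add_div hk hℓ
  have hhalf : Tendsto (fun n => (h n : ℝ) / n) atTop (𝓝 ((R + L) / 2)) := by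
    simp_rw [← two_mul] at hN
    exact tendsto_div_of_mul two_pos hN
  have t0 : Tendsto (fun n : ℕ => ((0 : ℕ) : ℝ) / n) atTop (𝓝 0) := by simp
  have hO : ∀ i ≤ 2, Tendsto (fun n => (ones (v n) (ε n) i : ℝ) / n) atTop (𝓝 (Vlim V E i)) ∧
      Tendsto (fun n => (negs (ε n) i : ℝ) / n) atTop (𝓝 (Mlim E i)) := by
    intro i
    induction i with
    | zero => exact fun _ => ⟨hv, t0⟩
    | succ i ih =>
      intro hi
      obtain ⟨h1, h2⟩ := ih (by omega)
      have e1 : ∀ n, 2 * (ones (v n) (ε n) i / 2) = ones (v n) (ε n) i :=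
        fun n => (heven i (by omega) n).1
      have e2 : ∀ n, 2 * (negs (ε n) i / 2) = negs (ε n) i := fun n => (heven i (by omega) n).2
      exact ⟨tendsto_add_div (tendsto_half e1 h1) (hε (i + 1) (by omega) hi),
        tendsto_add_div (tendsto_half e2 h2) (hε (i + 1) (by omega) hi)⟩
  have hOh : ∀ i ≤ 2,
      Tendsto (fun n => ((ones (v n) (ε n) i / 2 : ℕ) : ℝ) / n) atTop (𝓝 (Vlim V E i / 2)) ∧
      Tendsto (fun n => ((negs (ε n) i / 2 : ℕ) : ℝ) / n) atTop (𝓝 (Mlim E i / 2)) := by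
    intro i hi
    exact ⟨tendsto_half (fun n => (heven i hi n).1) (hO i hi).1,
      tendsto_half (fun n => (heven i hi n).2) (hO i hi).2⟩
  have hS : ∀ i ≤ 2, Tendsto (fun n => Real.logb 2 ((searchSpace (h n + h n)
      (ones (v n) (ε n) i) (negs (ε n) i)).card : ℝ) / n) atTop (𝓝 (SigmaExp R L V E i)) :=
    fun i hi => tendsto_logb_card_searchSpace (hle i hi) hN (hO i hi).1 (hO i hi).2
  have hfit' : ∀ i < 2, ∀ n, 2 * (ones (v n) (ε n) i / 2) + 2 * (negs (ε n) i / 2) +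
      2 * ε n (i + 1) ≤ h n + h n := by
    intro i hi n
    rw [(heven i hi.le n).1, (heven i hi.le n).2, ← hh n]
    exact hfit n i hi
  have hU : ∀ i < 2, Tendsto (fun n => Real.logb 2 (Fintype.card F) *
      ((mergeLength (Fintype.card F) (h n + h n) (v n) (ε n) i : ℝ) / n)) atTop
      (𝓝 (UExp R L V E i)) := by
    intro i hi
    have := tendsto_logb_mul_log_numReps (hfit' i hi) hN (hOh i hi.le).1 (hOh i hi.le).2
      (hε (i + 1) (by omega) (by omega)) hq
    simp_rw [fun n => (heven i hi.le n).1, fun n => (heven i hi.le n).2] at this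
    exact this
  have hQ : ∀ i < 2, Tendsto (fun n : ℕ => Real.logb 2 ((Fintype.card F : ℝ) ^
      mergeLength (Fintype.card F) (h n + h n) (v n) (ε n) i) / n) atTop (𝓝 (UExp R L V E i)) :=
    fun i hi => tendsto_logb_card_field_pow F (hU i hi)
  have hQℓ : Tendsto (fun n : ℕ => Real.logb 2 ((Fintype.card F : ℝ) ^ ℓ n) / n) atTop
      (𝓝 (Real.logb 2 (Fintype.card F) * L)) := tendsto_logb_const_pow _ hℓ
  have hA : Tendsto (fun n => ((2 * a n : ℕ) : ℝ) / n) atTop (𝓝 (Vlim V E 0 / 2 / 2)) := by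
    have := tendsto_div_of_mul two_pos (a := fun n => 2 * a n) (A := Vlim V E 0 / 2) (by
      refine (hOh 0 (by omega)).1.congr fun n => ?_
      rw [o0, ha n]
      congr 2
      omega)
    exact this
  have hAC : Tendsto (fun n => ((a n + c n : ℕ) : ℝ) / n) atTop (𝓝 (Vlim V E 1 / 2 / 2)) := by
    have := tendsto_div_of_mul two_pos (a := fun n => a n + c n) (A := Vlim V E 1 / 2) (by
      refine (hOh 1 (by omega)).1.congr fun n => ?_
      rw [(lv n).1]
      congr 2
      omega)
    exact this
  have hC : Tendsto (fun n => (c n : ℝ) / n) atTop (𝓝 (Mlim E 1 / 2 / 2)) := by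
    have := tendsto_div_of_mul two_pos (a := c) (A := Mlim E 1 / 2) (by
      refine (hOh 1 (by omega)).2.congr fun n => ?_
      rw [(lv n).2.2.1]
      congr 2
      omega)
    exact this
  have hC2 : Tendsto (fun n => ((2 * c n : ℕ) : ℝ) / n) atTop (𝓝 (E 1 / 2)) := by
    have := tendsto_div_of_mul two_pos (a := fun n => 2 * c n) (A := E 1) (by
      refine (hε 1 le_rfl one_le_two).congr fun n => ?_
      rw [hc n]
      congr 2
      omega)
    exact this
  have hD : Tendsto (fun n => (d n : ℝ) / n) atTop (𝓝 (E 2 / 2)) := by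
    have := tendsto_div_of_mul two_pos (a := d) (A := E 2) (by
      refine (hε 2 one_le_two le_rfl).congr fun n => ?_
      rw [hd n])
    exact this
  have p0 : ∀ n, 2 * (2 * a n) + 2 * 0 + 2 * (2 * c n) ≤ h n := fun n => by
    have := f0 n; omega
  have p1 : ∀ n, 2 * (a n + c n) + 2 * c n + 2 * d n ≤ h n := fun n => by
    have := f1 n; omega
  have hR0 : Tendsto (fun n => Real.logb 2 (repsLower (h n) (2 * a n) 0 (2 * c n) : ℝ) / n) atTop
      (𝓝 (UExp R L V E 0 / 2)) := by
    have := tendsto_logb_repsLower_repsExp (M := Mlim E 0 / 2) p0 hhalf hA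
      (by simp [Mlim]) hC2
    rwa [repsExp_half] at this
  have hR1 : Tendsto (fun n => Real.logb 2 (repsLower (h n) (a n + c n) (c n) (d n) : ℝ) / n) atTop
      (𝓝 (UExp R L V E 1 / 2)) := by
    have := tendsto_logb_repsLower_repsExp p1 hhalf hAC hC hD
    rwa [repsExp_half] at this
  have r0 : ∀ n, (repsLower (h n) (2 * a n) 0 (2 * c n) : ℝ) ≠ 0 := fun n =>
    Nat.cast_ne_zero.2 (repsLower_pos (p0 n)).ne'
  have r1 : ∀ n, (repsLower (h n) (a n + c n) (c n) (d n) : ℝ) ≠ 0 := fun n =>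
    Nat.cast_ne_zero.2 (repsLower_pos (p1 n)).ne'
  have hqu : ∀ m : ℕ, (Fintype.card F : ℝ) ^ m ≠ 0 := fun m => by positivity
  refine ⟨fun i hi => ⟨(hO i hi).1, (hO i hi).2, hS i hi⟩, fun i hi => ⟨fun x hx => ?_, hU i hi⟩,
    fun n A s e he => sound hF he, fun δ hδ => ?_, fun e he => ?_⟩
  · have := tendsto_logb_card_representations (hfit' i hi) hN (hOh i hi.le).1 (hOh i hi.le).2
      (hε (i + 1) (by omega) (by omega)) (x := x) (fun n => by
        rw [(heven i hi.le n).1, (heven i hi.le n).2]; exact hx n)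
    exact this
  · set K : ℝ := ((Fintype.card F : ℝ) + (Fintype.card F : ℝ) ^ 5) ^ 6 with hK
    have hK0 : 0 < K := by positivity
    have hlim := tendsto_logb_div (fun n => pow_ne_zero 2 (div_ne_zero
        (mul_ne_zero (pow_ne_zero 2 (r0 n)) (pow_ne_zero 2 (pow_ne_zero 2 (r1 n))))
        (mul_ne_zero (hqu _) (pow_ne_zero 2 (hqu _))))) (fun _ => hK0.ne')
      (tendsto_logb_pow 2 (tendsto_logb_div
        (fun n => mul_ne_zero (pow_ne_zero 2 (r0 n)) (pow_ne_zero 2 (pow_ne_zero 2 (r1 n))))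
        (fun n => mul_ne_zero (hqu _) (pow_ne_zero 2 (hqu _)))
        (tendsto_logb_mul (fun n => pow_ne_zero 2 (r0 n))
          (fun n => pow_ne_zero 2 (pow_ne_zero 2 (r1 n))) (tendsto_logb_pow 2 hR0)
          (tendsto_logb_pow 2 (tendsto_logb_pow 2 hR1)))
        (tendsto_logb_mul (fun n => hqu _) (fun n => pow_ne_zero 2 (hqu _)) (hQ 0 two_pos)
          (tendsto_logb_pow 2 (hQ 1 one_lt_two))))) (tendsto_logb_const K)
    -- The limit is 0: two squares of quantities with exponent U₀/2, respectively four with U₁/2,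
    -- cancel against the exponents U₀ and 2U₁ of the powers of q.
    have hev := hlim.eventually (lt_mem_nhds (a := -δ) (by push_cast; linarith))
    filter_upwards [hev, eventually_gt_atTop 0] with n hn hn0 e he h₁ h₂
    refine le_trans ?_ (sq_div_le_successProb hF (ha n) (hc n) (hd n) rfl (hu n).1 (hu n).2 he
      h₁ h₂)
    have hn0' : (0 : ℝ) < n := Nat.cast_pos.2 hn0
    rw [lt_div_iff₀ hn0'] at hn
    refine (Real.le_logb_iff_rpow_le one_lt_two ?_).1 hn.le
    have := r0 n; have := r1 n
    positivity
  · set H : ℕ → ℝ := fun n => ((searchSpace (h n) (ones (v n) (ε n) 2 / 2)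
      (negs (ε n) 2 / 2)).card : ℝ) with hHdef
    set D : ℕ → ℝ := fun n => ((searchSpace (h n + h n) (ones (v n) (ε n) 1)
      (negs (ε n) 1)).card : ℝ) with hDdef
    have hH1 : ∀ n, 1 ≤ (searchSpace (h n) (ones (v n) (ε n) 2 / 2) (negs (ε n) 2 / 2)).card := by
      intro n
      refine (searchSpace_nonempty ?_).card_pos
      have := hle 2 le_rfl n; have := heven 2 le_rfl n
      omega
    have hHpos : ∀ n, 0 < H n := fun n => Nat.cast_pos.2 (hH1 n)
    have hDpos : ∀ n, 0 < D n := fun n =>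
      Nat.cast_pos.2 (searchSpace_nonempty (hle 1 one_le_two n)).card_pos
    have hHlim : Tendsto (fun n => Real.logb 2 (H n) / n) atTop (𝓝 (SigmaExp R L V E 2 / 2)) :=
      tendsto_logb_card_searchSpace_half (fun n => by
        have := hle 2 le_rfl n; have := heven 2 le_rfl n; omega) hhalf (hOh 2 le_rfl).1
        (hOh 2 le_rfl).2
    have hDlim : Tendsto (fun n => Real.logb 2 (D n) / n) atTop (𝓝 (SigmaExp R L V E 1)) :=
      hS 1 one_le_two
    have hBpos : ∀ n, 0 < (searchSpace (h n) (ones (v n) (ε n) 1 / 2)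
        (negs (ε n) 1 / 2)).card := fun n => (searchSpace_nonempty (by
          have := hle 1 one_le_two n; have := heven 1 one_le_two n; omega)).card_pos
    have hBlim : Tendsto (fun n => Real.logb 2 ((searchSpace (h n) (ones (v n) (ε n) 1 / 2)
        (negs (ε n) 1 / 2)).card : ℝ) / n) atTop (𝓝 (SigmaExp R L V E 1 / 2)) :=
      tendsto_logb_card_searchSpace_half (fun n => by
        have := hle 1 one_le_two n; have := heven 1 one_le_two n; omega) hhalf
        (hOh 1 one_le_two).1 (hOh 1 one_le_two).2
    set u : ℕ → ℕ → ℕ := fun n => mergeLength (Fintype.card F) (h n + h n) (v n) (ε n)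
    have hqp : ∀ m : ℕ, 0 < (Fintype.card F : ℝ) ^ m := fun m => by positivity
    have hX := tendsto_logb_div (fun n => pow_ne_zero 2 (hHpos n).ne') (fun n => hqu (u n 1))
      (tendsto_logb_pow 2 hHlim) (hQ 1 one_lt_two)
    have hY := tendsto_logb_div (fun n => pow_ne_zero 2 (pow_ne_zero 2 (hHpos n).ne'))
      (fun n => mul_ne_zero (hqu (u n 1)) (hqu (u n 0)))
      (tendsto_logb_pow 2 (tendsto_logb_pow 2 hHlim))
      (tendsto_logb_mul (fun n => hqu (u n 1)) (fun n => hqu (u n 0)) (hQ 1 one_lt_two)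
        (hQ 0 two_pos))
    have hZ := tendsto_logb_div (fun n => (hDpos n).ne') (fun n => hqu (u n 0)) hDlim
      (hQ 0 two_pos)
    have hW := tendsto_logb_div (fun n => pow_ne_zero 2 (hDpos n).ne')
      (fun n => mul_ne_zero (hqu (u n 0)) (hqu (ℓ n)))
      (tendsto_logb_pow 2 hDlim)
      (tendsto_logb_mul (fun n => hqu (u n 0)) (fun n => hqu (ℓ n)) (hQ 0 two_pos) hQℓ)
    set B : (n : ℕ) → Finset (Fin (h n + h n) → ℤ) := fun n =>
      balancedSpace (h n) (ones (v n) (ε n) 1 / 2) (negs (ε n) 1 / 2) with hBdef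
    have hBc : ∀ n, ((B n).card : ℝ) = ((searchSpace (h n) (ones (v n) (ε n) 1 / 2)
        (negs (ε n) 1 / 2)).card : ℝ) ^ 2 := fun n => by
      rw [hBdef]; dsimp only; rw [card_balancedSpace]; push_cast; rfl
    have hBne : ∀ n, ((B n).card : ℝ) ≠ 0 := fun n => by
      rw [hBc]; exact pow_ne_zero 2 (Nat.cast_ne_zero.2 (hBpos n).ne')
    have hBl : Tendsto (fun n => Real.logb 2 ((B n).card : ℝ) / n) atTop
        (𝓝 (SigmaExp R L V E 1)) := by
      have := tendsto_logb_pow 2 hBlim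
      simp_rw [hBc]
      convert this using 2
      push_cast; ring
    set b : ℕ → ℕ := fun n => repsLower (h n) (a n + c n) (c n) (d n) ^ 2 with hbdef
    have hbne : ∀ n, (b n : ℝ) ≠ 0 := fun n => by
      rw [hbdef]; push_cast; exact pow_ne_zero 2 (r1 n)
    have hbl : Tendsto (fun n => Real.logb 2 (b n : ℝ) / n) atTop (𝓝 (UExp R L V E 1)) := by
      have := tendsto_logb_pow 2 hR1
      simp_rw [hbdef, Nat.cast_pow]
      convert this using 2
      push_cast; ring
    -- The exponent is 2(Σ₁ + U₁) - U₀ - 2U₁ - QL. The representation counts cancel against the two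
    -- base merges, leaving the last term of C.
    have hW' := tendsto_logb_div
      (fun n => pow_ne_zero 2 (mul_ne_zero (hBne n) (hbne n)))
      (fun n => mul_ne_zero (mul_ne_zero (hqu (u n 0)) (pow_ne_zero 2 (hqu (u n 1)))) (hqu (ℓ n)))
      (tendsto_logb_pow 2 (tendsto_logb_mul hBne hbne hBl hbl))
      (tendsto_logb_mul (fun n => mul_ne_zero (hqu (u n 0)) (pow_ne_zero 2 (hqu (u n 1))))
        (fun n => hqu (ℓ n))
        (tendsto_logb_mul (fun n => hqu (u n 0)) (fun n => pow_ne_zero 2 (hqu (u n 1)))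
          (hQ 0 two_pos) (tendsto_logb_pow 2 (hQ 1 one_lt_two))) hQℓ)
    have hXpos : ∀ n, 0 < H n ^ 2 / (Fintype.card F : ℝ) ^ u n 1 := fun n =>
      div_pos (pow_pos (hHpos n) 2) (hqp _)
    have hYpos : ∀ n, 0 < (H n ^ 2) ^ 2 /
        ((Fintype.card F : ℝ) ^ u n 1 * (Fintype.card F : ℝ) ^ u n 0) := fun n =>
      div_pos (pow_pos (pow_pos (hHpos n) 2) 2) (mul_pos (hqp _) (hqp _))
    have hZpos : ∀ n, 0 < D n / (Fintype.card F : ℝ) ^ u n 0 := fun n =>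
      div_pos (hDpos n) (hqp _)
    have hWpos : ∀ n, 0 < D n ^ 2 /
        ((Fintype.card F : ℝ) ^ u n 0 * (Fintype.card F : ℝ) ^ ℓ n) := fun n =>
      div_pos (pow_pos (hDpos n) 2) (mul_pos (hqp _) (hqp _))
    have hWpos' : ∀ n, 0 < ((B n).card * b n : ℝ) ^ 2 / ((Fintype.card F : ℝ) ^ u n 0 *
        ((Fintype.card F : ℝ) ^ u n 1) ^ 2 * (Fintype.card F : ℝ) ^ ℓ n) := fun n =>
      div_pos (sq_pos_of_ne_zero (mul_ne_zero (hBne n) (hbne n)))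
        (mul_pos (mul_pos (hqp _) (pow_pos (hqp _) 2)) (hqp _))
    -- a vector of level 1 costs no more than its representations
    have hsub : SigmaExp R L V E 1 + UExp R L V E 1 ≤ 2 * SigmaExp R L V E 2 := by
      have l1 := tendsto_logb_repsLower_repsExp (hfit' 1 one_lt_two) hN (hOh 1 one_le_two).1
        (hOh 1 one_le_two).2 (hε 2 one_le_two le_rfl)
      have pos : ∀ n, (repsLower (h n + h n) (ones (v n) (ε n) 1 / 2) (negs (ε n) 1 / 2)
          (ε n 2) : ℝ) ≠ 0 := fun n =>
        Nat.cast_ne_zero.2 (repsLower_pos (hfit' 1 one_lt_two n)).ne'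
      have l2 := tendsto_logb_mul (fun n => (hDpos n).ne') pos hDlim l1
      have l3 := tendsto_logb_pow 2 (hS 2 le_rfl)
      refine le_of_tendsto_of_tendsto' l2 (by exact_mod_cast l3) fun n => ?_
      refine div_le_div_of_nonneg_right (Real.logb_le_logb_of_le one_lt_two ?_ ?_)
        (Nat.cast_nonneg n)
      · exact lt_of_le_of_ne (by positivity) (mul_ne_zero (hDpos n).ne' (pos n)).symm
      · have := card_searchSpace_mul_repsLower_le (N := h n + h n)
          (a := ones (v n) (ε n) 1 / 2) (b := negs (ε n) 1 / 2) (ε := ε n 2)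
        rw [(heven 1 one_le_two n).1, (heven 1 one_le_two n).2] at this
        change _ ≤ (searchSpace (h n + h n) (ones (v n) (ε n) 2) (negs (ε n) 2)).card ^ 2 at this
        rw [hDdef]
        dsimp only
        exact_mod_cast this
    have hlow := tendsto_logb_max (fun n => lt_max_of_lt_left (hHpos n))
      (fun n => lt_max_of_lt_left (hYpos n)) (tendsto_logb_max hHpos hXpos hHlim hX)
      (tendsto_logb_max hYpos hWpos' hY hW')
    -- The upper bound has the four exponents of C and additionally Σ₁ - U₀.
    have hup := tendsto_logb_max (fun n => lt_max_of_lt_left (lt_max_of_lt_left (hHpos n)))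
      hZpos (tendsto_logb_max (fun n => lt_max_of_lt_left (hHpos n))
      (fun n => lt_max_of_lt_left (hYpos n)) (tendsto_logb_max hHpos hXpos hHlim hX)
      (tendsto_logb_max hYpos hWpos hY hW)) hZ
    set c₀ : ℝ := 14 * (20 * (Fintype.card F : ℝ) ^ 8) * 5 with hc₀
    have hc₀pos : 0 < c₀ := by positivity
    have hN1 : ∀ n, ((h n + h n : ℕ) : ℝ) + 1 ≠ 0 := fun n => by positivity
    have hℓ1 : ∀ n, (ℓ n : ℝ) + 1 ≠ 0 := fun n => by positivity
    have hup' := tendsto_logb_mul (fun n => mul_ne_zero hc₀pos.ne' (mul_ne_zero (hN1 n) (hℓ1 n)))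
      (fun n => (lt_max_of_lt_right (hZpos n)).ne')
      (tendsto_logb_mul (fun _ => hc₀pos.ne') (fun n => mul_ne_zero (hN1 n) (hℓ1 n))
        (tendsto_logb_const c₀) (tendsto_logb_mul hN1 hℓ1 (tendsto_logb_add_one hN)
          (tendsto_logb_add_one hℓ))) hup
    refine tendsto_logb_squeeze
      (c := fun n => c₀ * ((((h n + h n : ℕ) : ℝ) + 1) * ((ℓ n : ℝ) + 1)) *
        max (max (max (H n) (H n ^ 2 / (Fintype.card F : ℝ) ^ u n 1))
          (max ((H n ^ 2) ^ 2 / ((Fintype.card F : ℝ) ^ u n 1 * (Fintype.card F : ℝ) ^ u n 0))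
            (D n ^ 2 / ((Fintype.card F : ℝ) ^ u n 0 * (Fintype.card F : ℝ) ^ ℓ n))))
          (D n / (Fintype.card F : ℝ) ^ u n 0))
      (fun n => lt_max_of_lt_left (lt_max_of_lt_left (hHpos n)))
      (fun n => le_expectedSteps hF rfl rfl rfl (hu n).1 (hu n).2 (he n) (B := B n) (b := b n)
        ?_ ?_) (fun n => (expectedSteps_le hF rfl rfl rfl (hu n).1 (hu n).2 ?_ ?_ (he n)
          (hH1 n)).trans ?_) ?_ ?_
    · have : B n ⊆ _ := balancedSpace_subset
      rwa [(heven 1 one_le_two n).1, (heven 1 one_le_two n).2] at this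
    · intro x hx
      obtain ⟨l1, l2, l3, l4⟩ := lv n
      rw [l2, l4, Nat.mul_div_cancel_left _ two_pos, Nat.mul_div_cancel_left _ two_pos]
      refine repsLower_sq_le_card_balancedReps ?_
      rw [hBdef] at hx
      dsimp only at hx
      rwa [l1, l3, Nat.mul_div_cancel_left _ two_pos, Nat.mul_div_cancel_left _ two_pos,
        ← mul_add] at hx
    · exact Dvd.intro _ (heven 2 le_rfl n).1
    · exact Dvd.intro _ (heven 2 le_rfl n).2
    -- Each of the five terms is at most their maximum; this is the factor 5 in c₀.
    · have bound : ∀ x y z w t : ℝ,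
          x + y + z + t + w ≤ 5 * max (max (max x y) (max z w)) t := by
        intro x y z w t
        have := le_max_left (max (max x y) (max z w)) t
        have := le_max_right (max (max x y) (max z w)) t
        have := le_max_left (max x y) (max z w)
        have := le_max_right (max x y) (max z w)
        have := le_max_left x y
        have := le_max_right x y
        have := le_max_left z w
        have := le_max_right z w
        linarith
      rw [hc₀]
      calc _ ≤ 14 * ((((h n + h n : ℕ) : ℝ) + 1) * (ℓ n + 1)) *
            (20 * (Fintype.card F : ℝ) ^ 8 * (5 * _)) :=
            mul_le_mul_of_nonneg_left (mul_le_mul_of_nonneg_left (bound _ _ _ _ _)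
              (by positivity)) (by positivity)
        _ = _ := by ring
    · convert hlow using 2
      rw [costExp]
      congr 2
      · push_cast; ring
      · push_cast; ring
      · push_cast; ring
    · convert hup' using 2
      rw [costExp, zero_add, zero_add, zero_add]
      refine Eq.trans ?_ (max_eq_left ?_).symm
      · congr 2
        · push_cast; ring
        · push_cast; ring
        · push_cast; ring
      -- By `hsub`, Σ₁ - U₀ ≤ 2Σ₂ - U₁ - U₀, so the additional exponent does not enlarge the
      -- maximum.
      · refine le_max_of_le_right (le_max_of_le_left ?_)
        push_cast
        linarith
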